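/- **Conventions.** Manifolds are smooth, finite-dimensional, of constant dimension, without boundary, Hausdorff and second countable. Let $G\rightrightarrows M$ be a Lie groupoid with source $\alpha$, target $\beta$ (submersions), unit map $\epsilon$, inversion $i$, and product $gh$ defined for $\beta(g)=\alpha(h)$. Write $l_g:\alpha^{-1}(\beta(g))\to\alpha^{-1}(\alpha(g))$, $h\mapsto gh$, and $r_g:\beta^{-1}(\alpha(g))\to\beta^{-1}(\beta(g))$, $h\mapsto hg$. Let $\tau:AG\to M$ be the vector bundle with $A_xG=\ker T_{\epsilon(x)}\alpha$. For $X\in\Gamma(\tau)$ put $$\overleftarrow{X}(g)=(T_{\epsilon(\beta(g))}l_g)(X(\beta(g))),\qquad \overrightarrow{X}(g)=-(T_{\epsilon(\alpha(g))}(r_g\circ i))(X(\alpha(g))).$$ The Lie algebroid structure of $AG$ has the bracket with $\overleftarrow{[\![X,Y]\!]}=[\overleftarrow X,\overleftarrow Y]$ and the anchor $T_{\epsilon(x)}\beta|_{A_xG}$; the same definition applies to every Lie groupoid. Let $V\alpha=\ker T\alpha$, $V\beta=\ker T\beta$, and let $$\mathcal P^\tau G=\{(u,g,v): g\in G,\ u\in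 A_{\alpha(g)}G,\ v\in A_{\beta(g)}G\}\to G,\quad (u,g,v)\mapsto g,$$ $$\Theta:\mathcal P^\tau G\to V\beta\oplus_G V\alpha,\qquad \Theta(u,g,v)=\big(T_{\epsilon(\alpha(g))}(r_g\circ i)(u),\,T_{\epsilon(\beta(g))}l_g(v)\big).$$ Finally, let $G_\beta\star G_\alpha=\{(g,h,s)\in G^3:\beta(g)=\beta(h),\ \alpha(h)=\alpha(s)\}$. **Theorem.** $AG$, with the above bracket and anchor, is a Lie algebroid. $G_\beta\star G_\alpha$ is an embedded submanifold of $G\times G\times G$ and a Lie groupoid over $G$ with source $(g,h,s)\mapsto g$, target $(g,h,s)\mapsto s$, units $(g,g,g)$, product $(g,h,s)(s,h',s')=(g,h's^{-1}h,s')$ and inverse $(g,h,s)^{-1}=(s,gh^{-1}s,g)$; let $A(G_\beta\star G_\alpha)\to G$ be its Lie algebroid. Then: 1. The map $\Psi:A(G_\beta\star G_\alpha)\to V\beta\oplus_GV\alpha$, $\Psi_g(0_g,X_g,Z_g)=(X_g,Z_g-X_g)$, and the map $\Theta:\mathcal P^\tau G\to V\beta\oplus_GV\alpha$ are isomorphisms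 of vector bundles over the identity of $G$. There are Lie algebroid structures on $V\beta\oplus_GV\alpha$ and on $\mathcal P^\tau G$ for which $\Psi$ and $\Theta$ are isomorphisms of Lie algebroids. In particular, $\mathcal P^\tau G\cong V\beta\oplus_GV\alpha\to G$ carries an integrable Lie algebroid structure, namely that of the Lie groupoid $G_\beta\star G_\alpha\rightrightarrows G$. 2. The anchor of $V\beta\oplus_GV\alpha$ is $(X_g,Y_g)\mapsto X_g+Y_g$. For $X,Y,X',Y'\in\Gamma(\tau)$ the pair $(\overrightarrow X,\overleftarrow Y)$ is a smooth section of $V\beta\oplus_GV\alpha$, and $$[\![(\overrightarrow X,\overleftarrow Y),(\overrightarrow{X'},\overleftarrow{Y'})]\!]=\big(-\overrightarrow{[\![X,X']\!]},\ \overleftarrow{[\![Y,Y']\!]}\big).$$ This characterizes the structure: it is the only Lie algebroid structure on $V\beta\oplus_GV\alpha\to G$ with this anchor and this bracket relation. -/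

import Mathlib

open Bundle Manifold
open scoped ContDiff

/-- The fibres of a pulled back bundle are additive groups, not only additive monoids. -/
instance Bundle.Pullback.addCommGroupFiber {B B' : Type*} (f : B' → B) (V : B → Type*)
    [h : ∀ x, AddCommGroup (V x)] (x : B') : AddCommGroup ((f *ᵖ V) x) :=
  inferInstanceAs (AddCommGroup (V (f x)))

section Subbundles

variable {EB B F : Type*} [NormedAddCommGroup EB] [NormedSpace ℝ EB]
  [TopologicalSpace B] [ChartedSpace EB B] [NormedAddCommGroup F] [NormedSpace ℝ F]
  {V : B → Type*} [TopologicalSpace (TotalSpace F V)] [∀ x, TopologicalSpace (V x)]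
  [FiberBundle F V] [∀ x, AddCommGroup (V x)] [∀ x, Module ℝ (V x)]

/-- The section `s` of the bundle `V → B` is smooth on the set `U`. -/
def SmoothSectionOn (EB F : Type*) {B : Type*} [NormedAddCommGroup EB] [NormedSpace ℝ EB]
    [TopologicalSpace B] [ChartedSpace EB B] [NormedAddCommGroup F] [NormedSpace ℝ F]
    {V : B → Type*} [TopologicalSpace (TotalSpace F V)] [∀ x, TopologicalSpace (V x)]
    [FiberBundle F V] (s : ∀ x, V x) (U : Set B) : Prop :=
  ContMDiffOn 𝓘(ℝ, EB) (𝓘(ℝ, EB).prod 𝓘(ℝ, F)) ∞ (fun x => TotalSpace.mk' F x (s x)) U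

/-- A family of linear subspaces `K x ⊆ V x` is a smooth vector subbundle of `V` if it is locally
spanned by a smooth frame. -/
def IsSmoothSubbundle (EB F : Type*) {B : Type*} [NormedAddCommGroup EB] [NormedSpace ℝ EB]
    [TopologicalSpace B] [ChartedSpace EB B] [NormedAddCommGroup F] [NormedSpace ℝ F]
    {V : B → Type*} [TopologicalSpace (TotalSpace F V)] [∀ x, TopologicalSpace (V x)]
    [FiberBundle F V] [∀ x, AddCommGroup (V x)] [∀ x, Module ℝ (V x)]
    (K : ∀ x, Submodule ℝ (V x)) : Prop :=
  ∀ x₀ : B, ∃ U : Set B, IsOpen U ∧ x₀ ∈ U ∧ ∃ (k : ℕ) (s : Fin k → ∀ x, V x),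
    (∀ i, SmoothSectionOn EB F (s i) U) ∧
    ∀ x ∈ U, LinearIndependent ℝ (fun i => s i x) ∧
      Submodule.span ℝ (Set.range fun i => s i x) = K x

section Sections

variable [VectorBundle ℝ F V]

/-- The space `Γ(K)` of global smooth sections of `V` with values in the subbundle `K`. -/
noncomputable def SubbundleSection (EB F : Type*) {B : Type*} [NormedAddCommGroup EB] [NormedSpace ℝ EB]
    [TopologicalSpace B] [ChartedSpace EB B] [NormedAddCommGroup F] [NormedSpace ℝ F]
    {V : B → Type*} [TopologicalSpace (TotalSpace F V)] [∀ x, TopologicalSpace (V x)]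
    [FiberBundle F V] [∀ x, AddCommGroup (V x)] [∀ x, Module ℝ (V x)] [VectorBundle ℝ F V]
    (K : ∀ x, Submodule ℝ (V x)) : Submodule ℝ Cₛ^∞⟮𝓘(ℝ, EB); F, V⟯ where
  carrier := {s | ∀ x, s x ∈ K x}
  add_mem' := fun ha hb x => (K x).add_mem (ha x) (hb x)
  zero_mem' := fun x => (K x).zero_mem
  smul_mem' := fun c _ ha x => (K x).smul_mem c (ha x)

variable {K : ∀ x, Submodule ℝ (V x)}

/-- The value of a section of `K` at a point, as an element of the fibre of `K`. -/
noncomputable def sectionVal (s : SubbundleSection EB F K) (x : B) : K x :=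
  ⟨s.1 x, s.2 x⟩

/-- The product of a smooth function and a smooth section. -/
noncomputable def sectionSMul (f : C^∞⟮𝓘(ℝ, EB), B; ℝ⟯) (s : SubbundleSection EB F K) :
    SubbundleSection EB F K :=
  ⟨⟨fun x => f x • s.1 x, f.contMDiff.smul_section s.1.contMDiff⟩,
    fun x => (K x).smul_mem _ (s.2 x)⟩

end Sections

/-- A fibrewise linear map between subbundles (over the identity of the base) is smooth if it maps
smooth local sections to smooth local sections. -/
def SmoothBundleMap (EB F F' : Type*) {B : Type*} [NormedAddCommGroup EB] [NormedSpace ℝ EB]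
    [TopologicalSpace B] [ChartedSpace EB B]
    [NormedAddCommGroup F] [NormedSpace ℝ F] [NormedAddCommGroup F'] [NormedSpace ℝ F']
    {V : B → Type*} [TopologicalSpace (TotalSpace F V)] [∀ x, TopologicalSpace (V x)]
    [FiberBundle F V] [∀ x, AddCommGroup (V x)] [∀ x, Module ℝ (V x)]
    {V' : B → Type*} [TopologicalSpace (TotalSpace F' V')] [∀ x, TopologicalSpace (V' x)]
    [FiberBundle F' V'] [∀ x, AddCommGroup (V' x)] [∀ x, Module ℝ (V' x)]
    {K : ∀ x, Submodule ℝ (V x)} (Φ : ∀ x, K x →ₗ[ℝ] V' x) : Prop :=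
  ∀ (U : Set B) (s : ∀ x, K x), IsOpen U → SmoothSectionOn EB F (fun x => (s x : V x)) U →
    SmoothSectionOn EB F' (fun x => Φ x (s x)) U

end Subbundles

/-- A Lie algebroid structure on the vector bundle `K → B`, where `K` is given as a subbundle of
an ambient bundle `V → B` (every vector bundle is a subbundle of itself). -/
@[ext]
structure LieAlgebroid (EB F : Type*) {B : Type*} [NormedAddCommGroup EB] [NormedSpace ℝ EB]
    [TopologicalSpace B] [ChartedSpace EB B] [IsManifold 𝓘(ℝ, EB) ∞ B]
    [NormedAddCommGroup F] [NormedSpace ℝ F]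
    {V : B → Type*} [TopologicalSpace (TotalSpace F V)] [∀ x, TopologicalSpace (V x)]
    [FiberBundle F V] [∀ x, AddCommGroup (V x)] [∀ x, Module ℝ (V x)] [VectorBundle ℝ F V]
    (K : ∀ x, Submodule ℝ (V x)) where
  isSmoothSubbundle : IsSmoothSubbundle EB F K
  anchor : ∀ x, K x →ₗ[ℝ] TangentSpace 𝓘(ℝ, EB) x
  smooth_anchor : SmoothBundleMap EB F EB anchor
  bracket : SubbundleSection EB F K →ₗ[ℝ] SubbundleSection EB F K →ₗ[ℝ] SubbundleSection EB F K
  bracket_self : ∀ X, bracket X X = 0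
  jacobi : ∀ X Y Z, bracket X (bracket Y Z) = bracket (bracket X Y) Z + bracket Y (bracket X Z)
  leibniz : ∀ (X Y : SubbundleSection EB F K) (f : C^∞⟮𝓘(ℝ, EB), B; ℝ⟯) (x : B),
    sectionVal (bracket X (sectionSMul f Y)) x =
      f x • sectionVal (bracket X Y) x +
        (show ℝ from mfderiv 𝓘(ℝ, EB) 𝓘(ℝ, ℝ) f x (anchor x (sectionVal X x))) • sectionVal Y x

section Isomorphisms

variable {EB F F' B : Type*} [NormedAddCommGroup EB] [NormedSpace ℝ EB]
    [TopologicalSpace B] [ChartedSpace EB B] [IsManifold 𝓘(ℝ, EB) ∞ B]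
    [NormedAddCommGroup F] [NormedSpace ℝ F] [NormedAddCommGroup F'] [NormedSpace ℝ F']
    {V : B → Type*} [TopologicalSpace (TotalSpace F V)] [∀ x, TopologicalSpace (V x)]
    [FiberBundle F V] [∀ x, AddCommGroup (V x)] [∀ x, Module ℝ (V x)] [VectorBundle ℝ F V]
    {V' : B → Type*} [TopologicalSpace (TotalSpace F' V')] [∀ x, TopologicalSpace (V' x)]
    [FiberBundle F' V'] [∀ x, AddCommGroup (V' x)] [∀ x, Module ℝ (V' x)] [VectorBundle ℝ F' V']
    {K : ∀ x, Submodule ℝ (V x)} {K' : ∀ x, Submodule ℝ (V' x)}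

/-- An isomorphism of Lie algebroids over the identity of the base: an isomorphism of smooth vector
bundles which is compatible with the anchors and with the brackets. -/
structure LieAlgebroidIso (𝒜 : LieAlgebroid EB F K) (𝒜' : LieAlgebroid EB F' K') where
  toEquiv : ∀ x, K x ≃ₗ[ℝ] K' x
  smooth_toFun : SmoothBundleMap EB F F' (K := K) (V' := V')
    fun x => (K' x).subtype ∘ₗ (toEquiv x).toLinearMap
  smooth_invFun : SmoothBundleMap EB F' F (K := K') (V' := V)
    fun x => (K x).subtype ∘ₗ (toEquiv x).symm.toLinearMap
  map_anchor : ∀ x (v : K x), 𝒜'.anchor x (toEquiv x v) = 𝒜.anchor x v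
  map_bracket : ∀ (X Y : SubbundleSection EB F K) (X' Y' : SubbundleSection EB F' K'),
    (∀ x, sectionVal X' x = toEquiv x (sectionVal X x)) →
    (∀ x, sectionVal Y' x = toEquiv x (sectionVal Y x)) →
    ∀ x, sectionVal (𝒜'.bracket X' Y') x = toEquiv x (sectionVal (𝒜.bracket X Y) x)

end Isomorphisms

/-- A Lie groupoid `G ⇉ M`. The product `mul g h` is meaningful only if `tgt g = src h`; its values
at other pairs are irrelevant. -/
structure LieGroupoid (EG EM G M : Type*) [NormedAddCommGroup EG] [NormedSpace ℝ EG]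
    [NormedAddCommGroup EM] [NormedSpace ℝ EM] [TopologicalSpace G] [ChartedSpace EG G]
    [TopologicalSpace M] [ChartedSpace EM M] where
  src : C^∞⟮𝓘(ℝ, EG), G; 𝓘(ℝ, EM), M⟯
  tgt : C^∞⟮𝓘(ℝ, EG), G; 𝓘(ℝ, EM), M⟯
  unit : C^∞⟮𝓘(ℝ, EM), M; 𝓘(ℝ, EG), G⟯
  inv : C^∞⟮𝓘(ℝ, EG), G; 𝓘(ℝ, EG), G⟯
  mul : G → G → G
  isSubmersion_src : IsSubmersion 𝓘(ℝ, EG) 𝓘(ℝ, EM) ∞ src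
  isSubmersion_tgt : IsSubmersion 𝓘(ℝ, EG) 𝓘(ℝ, EM) ∞ tgt
  /-- The product is smooth on the submanifold of composable pairs. -/
  smooth_mul : ContMDiffOn (𝓘(ℝ, EG).prod 𝓘(ℝ, EG)) 𝓘(ℝ, EG) ∞
    (fun p : G × G => mul p.1 p.2) {p | tgt p.1 = src p.2}
  src_mul : ∀ g h, tgt g = src h → src (mul g h) = src g
  tgt_mul : ∀ g h, tgt g = src h → tgt (mul g h) = tgt h
  mul_assoc : ∀ g h k, tgt g = src h → tgt h = src k → mul g (mul h k) = mul (mul g h) k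
  src_unit : ∀ x, src (unit x) = x
  tgt_unit : ∀ x, tgt (unit x) = x
  unit_mul : ∀ g, mul (unit (src g)) g = g
  mul_unit : ∀ g, mul g (unit (tgt g)) = g
  src_inv : ∀ g, src (inv g) = tgt g
  tgt_inv : ∀ g, tgt (inv g) = src g
  inv_mul : ∀ g, mul (inv g) g = unit (tgt g)
  mul_inv : ∀ g, mul g (inv g) = unit (src g)

namespace LieGroupoid

noncomputable section

variable {EG EM G M : Type*} [NormedAddCommGroup EG] [NormedSpace ℝ EG]
    [NormedAddCommGroup EM] [NormedSpace ℝ EM] [TopologicalSpace G] [ChartedSpace EG G]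
    [TopologicalSpace M] [ChartedSpace EM M]
    (𝒢 : LieGroupoid EG EM G M)

/-- The ambient bundle `ε^* TG → M` of the Lie algebroid. -/
abbrev AmbientBundle : M → Type _ :=
  (𝒢.unit : M → G) *ᵖ (TangentSpace 𝓘(ℝ, EG) : G → Type _)

/-- The vector bundle `AG → M` with fibres `A_x G = ker T_{ε(x)} α`. -/
def algebroidFiber (x : M) : Submodule ℝ (𝒢.AmbientBundle x) :=
  LinearMap.ker (M := TangentSpace 𝓘(ℝ, EG) (𝒢.unit x))
    (mfderiv 𝓘(ℝ, EG) 𝓘(ℝ, EM) 𝒢.src (𝒢.unit x)).toLinearMap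

/-- `T_{ε(β(g))} l_g`, where `l_g : α⁻¹(β(g)) → α⁻¹(α(g))`, `h ↦ gh`. Only its values on vectors
which are tangent to the `α`-fibre, that is on `A_{β(g)} G`, are meaningful; there the derivative
within the fibre is the tangent map. -/
def leftTangent (g : G) :
    TangentSpace 𝓘(ℝ, EG) (𝒢.unit (𝒢.tgt g)) →L[ℝ] TangentSpace 𝓘(ℝ, EG) g :=
  mfderivWithin 𝓘(ℝ, EG) 𝓘(ℝ, EG) (fun h => 𝒢.mul g h) {h | 𝒢.src h = 𝒢.tgt g}
    (𝒢.unit (𝒢.tgt g))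

/-- `T_{ε(α(g))} (r_g ∘ i)`, where `r_g : β⁻¹(α(g)) → β⁻¹(β(g))`, `h ↦ hg`, and where the inversion
`i` maps `α⁻¹(α(g))` to `β⁻¹(α(g))`. Only its values on vectors which are tangent to the `α`-fibre,
that is on `A_{α(g)} G`, are meaningful. -/
def rightInvTangent (g : G) :
    TangentSpace 𝓘(ℝ, EG) (𝒢.unit (𝒢.src g)) →L[ℝ] TangentSpace 𝓘(ℝ, EG) g :=
  mfderivWithin 𝓘(ℝ, EG) 𝓘(ℝ, EG) (fun h => 𝒢.mul (𝒢.inv h) g) {h | 𝒢.src h = 𝒢.src g}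
    (𝒢.unit (𝒢.src g))

/-- The fibres of the bundle `Vβ ⊕ Vα → G`, where `V_g β = ker T_g β` and `V_g α = ker T_g α`. -/
def verticalSum (g : G) : Submodule ℝ
    (((TangentSpace 𝓘(ℝ, EG) : G → Type _) ×ᵇ (TangentSpace 𝓘(ℝ, EG) : G → Type _)) g) :=
  Submodule.prod (M := TangentSpace 𝓘(ℝ, EG) g) (M' := TangentSpace 𝓘(ℝ, EG) g)
    (LinearMap.ker (mfderiv 𝓘(ℝ, EG) 𝓘(ℝ, EM) 𝒢.tgt g).toLinearMap)
    (LinearMap.ker (mfderiv 𝓘(ℝ, EG) 𝓘(ℝ, EM) 𝒢.src g).toLinearMap)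

/-- The fibres `A_{α(g)} G × A_{β(g)} G` of the bundle
`AG ×_{τ,α} G ×_{β,τ} AG → G`, `(u, g, v) ↦ g`. -/
def prolongation (g : G) : Submodule ℝ
    ((((𝒢.src : G → M) *ᵖ 𝒢.AmbientBundle) ×ᵇ ((𝒢.tgt : G → M) *ᵖ 𝒢.AmbientBundle)) g) :=
  Submodule.prod (M := 𝒢.AmbientBundle (𝒢.src g)) (M' := 𝒢.AmbientBundle (𝒢.tgt g))
    (𝒢.algebroidFiber (𝒢.src g)) (𝒢.algebroidFiber (𝒢.tgt g))

section Algebroid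

variable [IsManifold 𝓘(ℝ, EG) ∞ G] [IsManifold 𝓘(ℝ, EM) ∞ M]

/-- The smooth sections of `AG → M`. -/
abbrev AlgebroidSection : Type _ := SubbundleSection EM EG 𝒢.algebroidFiber

/-- The left-invariant vector field `g ↦ T_{ε(β(g))} l_g (X(β(g)))`. -/
def leftInvariant (X : 𝒢.AlgebroidSection) (g : G) : TangentSpace 𝓘(ℝ, EG) g :=
  𝒢.leftTangent g (sectionVal X (𝒢.tgt g)).1

/-- The right-invariant vector field `g ↦ - T (r_g ∘ i) (X(α(g)))`. -/
def rightInvariant (X : 𝒢.AlgebroidSection) (g : G) : TangentSpace 𝓘(ℝ, EG) g :=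
  -𝒢.rightInvTangent g (sectionVal X (𝒢.src g)).1

/-- `𝒜` is the Lie algebroid structure on `AG` of the Lie groupoid `G ⇉ M`: the left-invariant
vector field of the bracket of two sections is the Lie bracket of their left-invariant vector
fields, and the anchor is the restriction of `T_{ε(x)} β`. -/
structure IsLieAlgebroid (𝒜 : LieAlgebroid EM EG 𝒢.algebroidFiber) : Prop where
  leftInvariant_bracket : ∀ (X Y : 𝒢.AlgebroidSection) (g : G),
    𝒢.leftInvariant (𝒜.bracket X Y) g =
      VectorField.mlieBracket 𝓘(ℝ, EG) (𝒢.leftInvariant X) (𝒢.leftInvariant Y) g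
  anchor_eq : ∀ (x : M) (v : 𝒢.algebroidFiber x),
    𝒜.anchor x v = (show TangentSpace 𝓘(ℝ, EM) x from
      mfderiv 𝓘(ℝ, EG) 𝓘(ℝ, EM) 𝒢.tgt (𝒢.unit x) v.1)

end Algebroid

/-- The space `G_β ⋆ G_α` of triples `(g, h, s)` with `β(g) = β(h)` and `α(h) = α(s)`, with the
subspace topology of `G × G × G`. -/
abbrev Star : Type _ :=
  {p : G × G × G // 𝒢.tgt p.1 = 𝒢.tgt p.2.1 ∧ 𝒢.src p.2.1 = 𝒢.src p.2.2}

/-- The Lie groupoid `ℋ` has base `G`, total space `G_β ⋆ G_α` and the structural maps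
`α(g, h, s) = g`, `β(g, h, s) = s`, `ε(g) = (g, g, g)`,
`(g, h, s) (s, h', s') = (g, h' s⁻¹ h, s')` and `(g, h, s)⁻¹ = (s, g h⁻¹ s, g)`. -/
structure IsStarGroupoid {ES : Type*} [NormedAddCommGroup ES] [NormedSpace ℝ ES]
    [ChartedSpace ES 𝒢.Star] (ℋ : LieGroupoid ES EG 𝒢.Star G) : Prop where
  src_eq : ∀ p, ℋ.src p = p.1.1
  tgt_eq : ∀ p, ℋ.tgt p = p.1.2.2
  unit_eq : ∀ g, (ℋ.unit g).1 = (g, g, g)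
  mul_eq : ∀ p q : 𝒢.Star, p.1.2.2 = q.1.1 →
    (ℋ.mul p q).1 = (p.1.1, 𝒢.mul (𝒢.mul q.1.2.1 (𝒢.inv q.1.1)) p.1.2.1, q.1.2.2)
  inv_eq : ∀ p, (ℋ.inv p).1 =
    (p.1.2.2, 𝒢.mul (𝒢.mul p.1.1 (𝒢.inv p.1.2.1)) p.1.2.2, p.1.1)

/-- The tangent map at `(g, g, g)` of the projection `G_β ⋆ G_α → G`, `(g, h, s) ↦ h`, on the fibre
`A_g` of the Lie algebroid. -/
def tangentMid {ES : Type*} [NormedAddCommGroup ES] [NormedSpace ℝ ES]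
    [ChartedSpace ES 𝒢.Star] (ℋ : LieGroupoid ES EG 𝒢.Star G) (g : G)
    (v : ℋ.algebroidFiber g) : TangentSpace 𝓘(ℝ, EG) g :=
  mfderiv 𝓘(ℝ, ES) 𝓘(ℝ, EG) (fun p : 𝒢.Star => p.1.2.1) (ℋ.unit g) v.1

/-- The tangent map at `(g, g, g)` of the projection `G_β ⋆ G_α → G`, `(g, h, s) ↦ s`, on the fibre
`A_g` of the Lie algebroid. -/
def tangentLast {ES : Type*} [NormedAddCommGroup ES] [NormedSpace ℝ ES]
    [ChartedSpace ES 𝒢.Star] (ℋ : LieGroupoid ES EG 𝒢.Star G) (g : G)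
    (v : ℋ.algebroidFiber g) : TangentSpace 𝓘(ℝ, EG) g :=
  mfderiv 𝓘(ℝ, ES) 𝓘(ℝ, EG) (fun p : 𝒢.Star => p.1.2.2) (ℋ.unit g) v.1

end

end LieGroupoid

/-! ### Lie brackets of vector fields related by a smooth map. -/

section RelatedVectorFields

open VectorField Filter Set
open scoped Topology

variable {E E' N N' : Type*} [NormedAddCommGroup E] [NormedSpace ℝ E]
  [NormedAddCommGroup E'] [NormedSpace ℝ E']
  [TopologicalSpace N] [ChartedSpace E N] [TopologicalSpace N'] [ChartedSpace E' N']

/-! All bracket computations rest on one principle: if two pairs of vector fields are related by a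
smooth map, so are their Lie brackets (`mfderiv_mlieBracket_of_related`). A left-invariant field
`←X` is `α`-vertical and related to itself by every left translation of an `α`-fibre. Brackets of
left-invariant fields are therefore left-invariant, and their values along the units give the
bracket on `AG`; Jacobi and Leibniz are inherited from vector fields. Inversion relates `←X` to
`-→X`, so `[→X, →X'] = -→⟦X, X'⟧`. On the product of the `α`-fibres over `α(g)` and `β(g)`, the map
`(c, d) ↦ c⁻¹ g d` relates `(←X, 0)` to `-→X` and `(0, ←Y)` to `←Y`. Fields on different factors of
a product commute, hence so do `→X` and `←Y`.

The fibres of a submersion are never made into manifolds. A local diffeomorphism to `N' ×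
FibreModel` that turns the submersion into the first projection parametrizes each fibre by an open
subset of a vector space. A derivative within a fibre is determined only on vertical vectors; there
it is an ordinary derivative in these coordinates (`hasMFDerivWithinAt_apply`), and this gives the
fibrewise bracket principle `mfderivWithin_fibre_mlieBracket`.

An element `(g, h, s)` of `G_β ⋆ G_α` is determined locally by `h` and the fibre coordinates of `g`
for `β` and of `s` for `α`; this gives the submanifold charts. A vector of its Lie algebroid at `(g,
g, g)` is `(0, X, Z)` with `Tβ X = 0` and `Tα X = Tα Z`, so `(X, Z - X)` lies in `Vβ ⊕ Vα`. The map
`Ψ` is injective and the ranks agree, so it is an isomorphism; `Θ` is treated in the same way. A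
smooth fibrewise injection reflects smoothness of sections, so the inverses are smooth.

The structure on `Vβ ⊕ Vα` is transported along `Ψ`. The left-invariant field on `G_β ⋆ G_α` that
corresponds to `(→X, ←Y)` is related to `→X` by the middle projection and to `→X + ←Y` by the last
one. Its brackets thus project to `-→⟦X, X'⟧` and `-→⟦X, X'⟧ + ←⟦Y, Y'⟧`, and the difference of the
two is the second component of the bracket relation.

For uniqueness, two brackets with the same anchor differ by a tensor, since their Leibniz terms
cancel. The invariant sections take every value at every point, so agreement on them suffices
(`LieAlgebroid.eq_of_bracket_eq`). -/

/-- The Lie bracket in the preferred chart at the base point. -/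
theorem mlieBracket_eq_lieBracket_chart (V W : ∀ y : N, TangentSpace 𝓘(ℝ, E) y) (x : N)
    [IsManifold 𝓘(ℝ, E) 1 N] :
    (show E from mlieBracket 𝓘(ℝ, E) V W x) =
      lieBracket ℝ (mpullbackWithin 𝓘(ℝ, E) 𝓘(ℝ, E) (extChartAt 𝓘(ℝ, E) x).symm V univ)
        (mpullbackWithin 𝓘(ℝ, E) 𝓘(ℝ, E) (extChartAt 𝓘(ℝ, E) x).symm W univ)
        (extChartAt 𝓘(ℝ, E) x x) := by
  -- The bracket is defined by pulling the chart bracket back along the derivative of the chart; at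
  -- the base point of its own chart this derivative is the identity.
  have aux : ∀ (A : E →L[ℝ] E) (v : E), A = ContinuousLinearMap.id ℝ E → A.inverse v = v := by
    rintro A v rfl
    simp
  refine (aux _ _ mfderiv_extChartAt_self).trans ?_
  simp only [preimage_univ, univ_inter, modelWithCornersSelf_coe, range_id]
  exact congrFun lieBracketWithin_univ _

/-- The derivatives of a chart and of its inverse are mutually inverse, so pulling back by the
inverse chart is pushing forward by the chart. This removes `inverse` from the chart formula for the
bracket. -/
theorem mpullbackWithin_extChartAt_symm_apply [IsManifold 𝓘(ℝ, E) 1 N]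
    (V : ∀ y : N, TangentSpace 𝓘(ℝ, E) y) (x : N) {z : E}
    (hz : z ∈ (extChartAt 𝓘(ℝ, E) x).target) :
    mpullbackWithin 𝓘(ℝ, E) 𝓘(ℝ, E) (extChartAt 𝓘(ℝ, E) x).symm V univ z =
      mfderiv 𝓘(ℝ, E) 𝓘(ℝ, E) (extChartAt 𝓘(ℝ, E) x) ((extChartAt 𝓘(ℝ, E) x).symm z)
        (V ((extChartAt 𝓘(ℝ, E) x).symm z)) := by
  have h1 := mfderivWithin_extChartAt_symm_comp_mfderiv_extChartAt (I := 𝓘(ℝ, E)) hz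
  have h2 := mfderiv_extChartAt_comp_mfderivWithin_extChartAt_symm (I := 𝓘(ℝ, E)) hz
  simp only [modelWithCornersSelf_coe, range_id] at h1 h2
  rw [mpullbackWithin_apply]
  rw [ContinuousLinearMap.inverse_eq h1 h2]
  rfl

/-- Smooth vector fields which are related by a map have related Lie brackets. -/
theorem mfderiv_mlieBracket_of_related [CompleteSpace E] [CompleteSpace E']
    [IsManifold 𝓘(ℝ, E) 2 N] [IsManifold 𝓘(ℝ, E') 2 N'] {f : N → N'} {x : N}
    (hf : ContMDiffAt 𝓘(ℝ, E) 𝓘(ℝ, E') 2 f x)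
    {V W : ∀ y : N, TangentSpace 𝓘(ℝ, E) y} {V' W' : ∀ y : N', TangentSpace 𝓘(ℝ, E') y}
    (hV : MDifferentiableAt 𝓘(ℝ, E) 𝓘(ℝ, E).tangent (fun y => (⟨y, V y⟩ : TangentBundle _ N)) x)
    (hW : MDifferentiableAt 𝓘(ℝ, E) 𝓘(ℝ, E).tangent (fun y => (⟨y, W y⟩ : TangentBundle _ N)) x)
    (hV' : MDifferentiableAt 𝓘(ℝ, E') 𝓘(ℝ, E').tangent
      (fun y => (⟨y, V' y⟩ : TangentBundle _ N')) (f x))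
    (hW' : MDifferentiableAt 𝓘(ℝ, E') 𝓘(ℝ, E').tangent
      (fun y => (⟨y, W' y⟩ : TangentBundle _ N')) (f x))
    (hVV' : ∀ᶠ y in 𝓝 x, mfderiv 𝓘(ℝ, E) 𝓘(ℝ, E') f y (V y) = V' (f y))
    (hWW' : ∀ᶠ y in 𝓝 x, mfderiv 𝓘(ℝ, E) 𝓘(ℝ, E') f y (W y) = W' (f y)) :
    mfderiv 𝓘(ℝ, E) 𝓘(ℝ, E') f x (mlieBracket 𝓘(ℝ, E) V W x) =
      mlieBracket 𝓘(ℝ, E') V' W' (f x) := by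
  have : IsManifold 𝓘(ℝ, E) 1 N := .of_le (n := 2) one_le_two
  have : IsManifold 𝓘(ℝ, E') 1 N' := .of_le (n := 2) one_le_two
  set φ := extChartAt 𝓘(ℝ, E) x with hφ
  set φ' := extChartAt 𝓘(ℝ, E') (f x) with hφ'
  set F : E → E' := φ' ∘ f ∘ φ.symm with hF
  have hFc : ContDiffAt ℝ 2 F (φ x) := by
    have := (contMDiffAt_iff.1 hf).2
    simp only [modelWithCornersSelf_coe, range_id, contDiffWithinAt_univ] at this
    exact this
  have hmf : mfderiv 𝓘(ℝ, E) 𝓘(ℝ, E') f x = fderiv ℝ F (φ x) := by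
    rw [(hf.mdifferentiableAt two_ne_zero).mfderiv]
    simp only [modelWithCornersSelf_coe, range_id, fderivWithin_univ]
    rfl
  have hcont : ContinuousAt φ.symm (φ x) := continuousAt_extChartAt_symm x
  have hsx : φ.symm (φ x) = x := extChartAt_to_inv x
  -- Relatedness by `f` becomes relatedness of the coordinate fields by `F`, through the chain rule
  -- for `F = φ' ∘ f ∘ φ.symm` near `φ x`.
  have hrel : ∀ (V : ∀ y : N, TangentSpace 𝓘(ℝ, E) y) (V' : ∀ y : N', TangentSpace 𝓘(ℝ, E') y),
      (∀ᶠ y in 𝓝 x, mfderiv 𝓘(ℝ, E) 𝓘(ℝ, E') f y (V y) = V' (f y)) →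
      ∀ᶠ z in 𝓝 (φ x), fderiv ℝ F z (mpullbackWithin 𝓘(ℝ, E) 𝓘(ℝ, E) φ.symm V univ z) =
        mpullbackWithin 𝓘(ℝ, E') 𝓘(ℝ, E') φ'.symm V' univ (F z) := by
    intro V V' hVV'
    have e1 : ∀ᶠ z in 𝓝 (φ x), z ∈ φ.target := extChartAt_target_mem_nhds x
    have hc' : Tendsto φ.symm (𝓝 (φ x)) (𝓝 x) := by simpa [ContinuousAt, hsx] using hcont
    have e2 := hc'.eventually hVV'
    have e3 : ∀ᶠ y in 𝓝 x, ContMDiffAt 𝓘(ℝ, E) 𝓘(ℝ, E') 2 f y := by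
      simpa using contMDiffAt_iff_contMDiffAt_nhds (by simp) |>.1 hf
    have e3 := hc'.eventually e3
    have e4 : ∀ᶠ y in 𝓝 x, f y ∈ φ'.source :=
      hf.continuousAt.eventually (extChartAt_source_mem_nhds (f x))
    have e4 := hc'.eventually e4
    filter_upwards [e1, e2, e3, e4] with z h1 h2 h3 h4
    have hFz : F z = φ' (f (φ.symm z)) := rfl
    have hFt : F z ∈ φ'.target := φ'.map_source h4
    have hback : φ'.symm (F z) = f (φ.symm z) := φ'.left_inv h4
    rw [mpullbackWithin_extChartAt_symm_apply V x h1,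
      mpullbackWithin_extChartAt_symm_apply V' (f x) hFt]
    have hchain : fderiv ℝ F z =
        (mfderiv 𝓘(ℝ, E') 𝓘(ℝ, E') φ' (f (φ.symm z))).comp
          ((mfderiv 𝓘(ℝ, E) 𝓘(ℝ, E') f (φ.symm z)).comp
            (mfderiv 𝓘(ℝ, E) 𝓘(ℝ, E) φ.symm z)) := by
      rw [← mfderiv_eq_fderiv]
      have hd1 : MDifferentiableAt 𝓘(ℝ, E) 𝓘(ℝ, E) φ.symm z := by
        have := mdifferentiableWithinAt_extChartAt_symm (I := 𝓘(ℝ, E)) h1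
        simpa only [modelWithCornersSelf_coe, range_id, mdifferentiableWithinAt_univ] using this
      have hd2 : MDifferentiableAt 𝓘(ℝ, E) 𝓘(ℝ, E') f (φ.symm z) :=
        h3.mdifferentiableAt two_ne_zero
      have hd3 : MDifferentiableAt 𝓘(ℝ, E') 𝓘(ℝ, E') φ' (f (φ.symm z)) :=
        mdifferentiableAt_extChartAt (by simpa [hφ'] using h4)
      rw [hF, mfderiv_comp (I' := 𝓘(ℝ, E')) z hd3 (hd2.comp z hd1),
        mfderiv_comp (I' := 𝓘(ℝ, E)) z hd2 hd1]
      rfl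
    have h5 := mfderivWithin_extChartAt_symm_comp_mfderiv_extChartAt (I := 𝓘(ℝ, E)) h1
    simp only [modelWithCornersSelf_coe, range_id, mfderivWithin_univ] at h5
    rw [hchain]
    have h6 := DFunLike.congr_fun h5 (V (φ.symm z))
    change mfderiv 𝓘(ℝ, E') 𝓘(ℝ, E') φ' (f (φ.symm z)) (mfderiv 𝓘(ℝ, E) 𝓘(ℝ, E') f (φ.symm z)
      (mfderiv 𝓘(ℝ, E) 𝓘(ℝ, E) φ.symm z (mfderiv 𝓘(ℝ, E) 𝓘(ℝ, E) φ (φ.symm z) (V (φ.symm z))))) = _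
    have h7 : mfderiv 𝓘(ℝ, E) 𝓘(ℝ, E) φ.symm z
        (mfderiv 𝓘(ℝ, E) 𝓘(ℝ, E) φ (φ.symm z) (V (φ.symm z))) = V (φ.symm z) := h6
    rw [h7, h2, hback]
  have hFx : F (φ x) = φ' (f x) := by simp [hF, hsx]
  have hdiff : ∀ (V : ∀ y : N, TangentSpace 𝓘(ℝ, E) y), MDifferentiableAt 𝓘(ℝ, E) 𝓘(ℝ, E).tangent
      (fun y => (⟨y, V y⟩ : TangentBundle _ N)) x →
      DifferentiableAt ℝ (mpullbackWithin 𝓘(ℝ, E) 𝓘(ℝ, E) φ.symm V univ) (φ x) := by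
    intro V hV
    have := MDifferentiableWithinAt.differentiableWithinAt_mpullbackWithin_vectorField
      (s := univ) (mdifferentiableWithinAt_univ.2 hV)
    simp only [modelWithCornersSelf_coe, range_id, preimage_univ, univ_inter] at this
    exact differentiableWithinAt_univ.1 this
  have hdiff' : ∀ (V : ∀ y : N', TangentSpace 𝓘(ℝ, E') y),
      MDifferentiableAt 𝓘(ℝ, E') 𝓘(ℝ, E').tangent
      (fun y => (⟨y, V y⟩ : TangentBundle _ N')) (f x) →
      DifferentiableAt ℝ (mpullbackWithin 𝓘(ℝ, E') 𝓘(ℝ, E') φ'.symm V univ) (F (φ x)) := by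
    intro V hV
    have := MDifferentiableWithinAt.differentiableWithinAt_mpullbackWithin_vectorField
      (s := univ) (mdifferentiableWithinAt_univ.2 hV)
    simp only [modelWithCornersSelf_coe, range_id, preimage_univ, univ_inter] at this
    rw [hFx]
    exact differentiableWithinAt_univ.1 this
  have hFd : DifferentiableAt ℝ F (φ x) := hFc.differentiableAt two_ne_zero
  have aux : ∀ A B : E → E, ∀ A' B' : E' → E', DifferentiableAt ℝ A (φ x) →
      DifferentiableAt ℝ B (φ x) → DifferentiableAt ℝ A' (F (φ x)) →
      DifferentiableAt ℝ B' (F (φ x)) → (∀ᶠ z in 𝓝 (φ x), fderiv ℝ F z (A z) = A' (F z)) →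
      (∀ᶠ z in 𝓝 (φ x), fderiv ℝ F z (B z) = B' (F z)) →
      fderiv ℝ F (φ x) (lieBracket ℝ A B (φ x)) = lieBracket ℝ A' B' (F (φ x)) := by
    intro A B A' B' hA hB hA' hB' rA rB
    -- By symmetry of the second derivative, the terms with `D²F` cancel in the difference of the
    -- derivatives of `DF · B` and `DF · A`. Near `φ x` these two functions are `B' ∘ F` and `A' ∘
    -- F`.
    have key := fderiv_apply_lieBracket hFc (by simp) hB hA
    rw [EventuallyEq.fderiv_eq rA, EventuallyEq.fderiv_eq rB, fderiv_fun_comp _ hA' hFd,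
      fderiv_fun_comp _ hB' hFd, ContinuousLinearMap.comp_apply, ContinuousLinearMap.comp_apply,
      rA.self_of_nhds, rB.self_of_nhds] at key
    exact key
  have key := aux _ _ _ _ (hdiff V hV) (hdiff W hW) (hdiff' V' hV') (hdiff' W' hW')
    (hrel V V' hVV') (hrel W W' hWW')
  rw [hFx] at key
  have t1 := mlieBracket_eq_lieBracket_chart V W x
  have t2 := mlieBracket_eq_lieBracket_chart V' W' (f x)
  rw [hmf]
  exact (congrArg (fderiv ℝ F (φ x)) t1).trans (key.trans t2.symm)

end RelatedVectorFields

/-! ### Submersions and immersions from the inverse function theorem. -/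

section InverseFunction

open Filter Set
open scoped Topology

/-- The inverse function theorem for smooth maps, with a smooth inverse on an open set. -/
theorem exists_openPartialHomeomorph_of_contDiffOn {E E' : Type*} [NormedAddCommGroup E]
    [NormedSpace ℝ E] [CompleteSpace E] [NormedAddCommGroup E'] [NormedSpace ℝ E']
    {F : E → E'} {U : Set E} (hU : IsOpen U) (hF : ContDiffOn ℝ ∞ F U) {a : E} (ha : a ∈ U)
    (L : E ≃L[ℝ] E') (hL : fderiv ℝ F a = L) :
    ∃ e : OpenPartialHomeomorph E E', a ∈ e.source ∧ e.source ⊆ U ∧ (∀ z, e z = F z) ∧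
      ContDiffOn ℝ ∞ e.symm e.target := by
  have hFa : ContDiffAt ℝ ∞ F a := hF.contDiffAt (hU.mem_nhds ha)
  have hd : HasFDerivAt F (L : E →L[ℝ] E') a := by
    rw [← hL]; exact (hFa.differentiableAt (by simp)).hasFDerivAt
  let e₀ := hFa.toOpenPartialHomeomorph F hd (by simp)
  have he₀ : ∀ z, e₀ z = F z := fun z => rfl
  -- The local inverse is smooth at the images of points where the derivative is invertible. This is
  -- an open condition, so shrinking the source to it makes the inverse smooth on the whole target.
  let S : Set E := U ∩ fderiv ℝ F ⁻¹' range ((↑) : (E ≃L[ℝ] E') → E →L[ℝ] E')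
  have hS : IsOpen S :=
    (hF.continuousOn_fderiv_of_isOpen hU (by simp)).isOpen_inter_preimage hU
      ContinuousLinearEquiv.isOpen
  refine ⟨e₀.restrOpen S hS, ⟨?_, ha, L, hL.symm⟩, fun z hz => hz.2.1, he₀, ?_⟩
  · exact hFa.mem_toOpenPartialHomeomorph_source hd (by simp)
  · intro y hy
    have hmem := (e₀.restrOpen S hS).map_target hy
    obtain ⟨L', hL'⟩ := hmem.2.2
    refine ((e₀.restrOpen S hS).contDiffAt_symm hy (f₀' := L') ?_ ?_).contDiffWithinAt
    · rw [hL']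
      exact ((hF.contDiffAt (hU.mem_nhds hmem.2.1)).differentiableAt (by simp)).hasFDerivAt
    · exact hF.contDiffAt (hU.mem_nhds hmem.2.1)

variable {E E' N N' : Type*} [NormedAddCommGroup E] [NormedSpace ℝ E]
  [NormedAddCommGroup E'] [NormedSpace ℝ E']
  [TopologicalSpace N] [ChartedSpace E N] [TopologicalSpace N'] [ChartedSpace E' N']

theorem mfderiv_eq_fderiv_charts {f : N → N'} (hf : ContMDiff 𝓘(ℝ, E) 𝓘(ℝ, E') ∞ f) (x : N) :
    mfderiv 𝓘(ℝ, E) 𝓘(ℝ, E') f x =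
      fderiv ℝ (chartAt E' (f x) ∘ f ∘ (chartAt E x).symm) (chartAt E x x) := by
  rw [(hf.mdifferentiableAt (by simp)).mfderiv]
  simp only [modelWithCornersSelf_coe, range_id, fderivWithin_univ]
  simp only [writtenInExtChartAt, extChartAt, mfld_simps]
  rfl

variable [IsManifold 𝓘(ℝ, E) ∞ N] [IsManifold 𝓘(ℝ, E') ∞ N']

/-- The domain on which a map is written in the preferred charts. -/
theorem contDiffOn_written_in_charts {f : N → N'} (hf : ContMDiff 𝓘(ℝ, E) 𝓘(ℝ, E') ∞ f) (x : N) :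
    ∃ U : Set E, IsOpen U ∧ chartAt E x x ∈ U ∧ U ⊆ (chartAt E x).target ∧
      (∀ z ∈ U, f ((chartAt E x).symm z) ∈ (chartAt E' (f x)).source) ∧
      ContDiffOn ℝ ∞ (chartAt E' (f x) ∘ f ∘ (chartAt E x).symm) U := by
  refine ⟨(chartAt E x).target ∩ (chartAt E x).symm ⁻¹' (f ⁻¹' (chartAt E' (f x)).source),
    (chartAt E x).isOpen_inter_preimage_symm ((chartAt E' (f x)).open_source.preimage
      hf.continuous), ⟨mem_chart_target E x, ?_⟩, fun z hz => hz.1, fun z hz => hz.2, ?_⟩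
  · simp
  · rw [← contMDiffOn_iff_contDiffOn]
    refine (contMDiffOn_chart (I := 𝓘(ℝ, E')) (n := ∞)).comp (hf.comp_contMDiffOn
      ((contMDiffOn_chart_symm (I := 𝓘(ℝ, E)) (n := ∞) (x := x)).mono fun z hz => hz.1))
      fun z hz => hz.2

variable [FiniteDimensional ℝ E] [FiniteDimensional ℝ E']

/-- A smooth map between finite-dimensional manifolds with surjective tangent map is a
submersion. -/
theorem isSubmersionAtOfComplement_of_surjective_mfderiv {f : N → N'}
    (hf : ContMDiff 𝓘(ℝ, E) 𝓘(ℝ, E') ∞ f) (x : N)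
    (hs : Function.Surjective (mfderiv 𝓘(ℝ, E) 𝓘(ℝ, E') f x)) (C : Type*)
    [NormedAddCommGroup C] [NormedSpace ℝ C] [FiniteDimensional ℝ C]
    (hC : Module.finrank ℝ E = Module.finrank ℝ E' + Module.finrank ℝ C) :
    IsSubmersionAtOfComplement C 𝓘(ℝ, E) 𝓘(ℝ, E') ∞ f x := by
  obtain ⟨U, hU, hxU, hUt, hUs, hFU⟩ := contDiffOn_written_in_charts hf x
  rw [mfderiv_eq_fderiv_charts hf x] at hs
  set F := chartAt E' (f x) ∘ f ∘ (chartAt E x).symm with hF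
  set a := chartAt E x x
  set A : E →L[ℝ] E' := fderiv ℝ F a with hA
  have hs' : Function.Surjective A.toLinearMap := hs
  have hk : Module.finrank ℝ (LinearMap.ker A.toLinearMap) = Module.finrank ℝ C := by
    have := LinearMap.finrank_range_add_finrank_ker A.toLinearMap
    rw [LinearMap.range_eq_top.2 hs', finrank_top] at this
    omega
  obtain ⟨P, hP⟩ := (LinearMap.ker A.toLinearMap).exists_isCompl
  let pr : E →ₗ[ℝ] LinearMap.ker A.toLinearMap := Submodule.projectionOnto _ P hP
  let κ := ContinuousLinearEquiv.ofFinrankEq hk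
  -- `Q` projects to the kernel of `A`, which is identified with `C` by dimension. Hence `(F, Q)`
  -- has invertible derivative at `a`, and its first component is `f` in charts.
  let Q : E →L[ℝ] C := (κ : _ →L[ℝ] C).comp pr.toContinuousLinearMap
  have hinj : Function.Injective (A.prod Q) := by
    rw [injective_iff_map_eq_zero]
    intro v hv
    have h1 : A v = 0 := congrArg Prod.fst hv
    have h2 : κ (pr v) = 0 := congrArg Prod.snd hv
    have h3 : pr v = 0 := by simpa using h2
    have h4 : pr v = ⟨v, h1⟩ := Submodule.projectionOnto_apply_left hP ⟨v, h1⟩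
    rw [h4] at h3
    exact congrArg Subtype.val h3
  have hdim : Module.finrank ℝ E = Module.finrank ℝ (E' × C) := by
    rw [Module.finrank_prod, ← hk]
    have := LinearMap.finrank_range_add_finrank_ker A.toLinearMap
    rw [LinearMap.range_eq_top.2 hs', finrank_top] at this
    omega
  let L : E ≃L[ℝ] (E' × C) :=
    (LinearEquiv.ofInjectiveOfFinrankEq (A.prod Q).toLinearMap hinj hdim).toContinuousLinearEquiv
  have hLA : ∀ v, L v = (A v, Q v) := fun v => rfl
  have hΦ : ContDiffOn ℝ ∞ (fun z => (F z, Q z)) U := hFU.prodMk Q.contDiff.contDiffOn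
  have hder : fderiv ℝ (fun z => (F z, Q z)) a = L := by
    have hd : DifferentiableAt ℝ F a := (hFU.contDiffAt (hU.mem_nhds hxU)).differentiableAt (by simp)
    rw [(hd.hasFDerivAt.prodMk Q.hasFDerivAt).fderiv]
    ext v <;> simp [hLA, hA]
  obtain ⟨e, hae, heU, heF, hes⟩ := exists_openPartialHomeomorph_of_contDiffOn hU hΦ hxU L hder
  -- In the chart `χ` the map `f` is the first component of `L`, which is the normal form of a
  -- submersion.
  let χ : OpenPartialHomeomorph N E :=
    ((chartAt E x).trans e).trans L.symm.toHomeomorph.toOpenPartialHomeomorph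
  have hχs : ∀ y ∈ χ.source, y ∈ (chartAt E x).source ∧ chartAt E x y ∈ e.source := by
    intro y hy
    simpa [χ] using hy
  have hχ : χ ∈ IsManifold.maximalAtlas 𝓘(ℝ, E) ∞ N := by
    apply OpenPartialHomeomorph.mem_maximalAtlas_of_contMDiffOn
    · have h1 : ContMDiffOn 𝓘(ℝ, E) 𝓘(ℝ, E) ∞ (fun z => L.symm (F z, Q z)) U := by
        rw [contMDiffOn_iff_contDiffOn]
        exact L.symm.contDiff.comp_contDiffOn hΦ
      refine (h1.comp (contMDiffOn_chart (I := 𝓘(ℝ, E)) (n := ∞) (x := x) |>.mono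
        fun y hy => (hχs y hy).1) fun y hy => heU (hχs y hy).2).congr fun y hy => ?_
      simp [χ, heF]
    · have h1 : ContMDiffOn 𝓘(ℝ, E) 𝓘(ℝ, E) ∞ (fun w => e.symm (L w)) (L ⁻¹' e.target) := by
        rw [contMDiffOn_iff_contDiffOn]
        exact hes.comp L.contDiff.contDiffOn fun w hw => hw
      have ht : ∀ w ∈ χ.target, L w ∈ e.target ∧ e.symm (L w) ∈ (chartAt E x).target := by
        intro w hw
        simpa [χ] using hw
      refine ((contMDiffOn_chart_symm (I := 𝓘(ℝ, E)) (n := ∞) (x := x)).comp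
        (h1.mono fun w hw => (ht w hw).1) fun w hw => (ht w hw).2).congr fun w hw => ?_
      simp [χ]
  refine IsSubmersionAtOfComplement.mk_of_continuousAt hf.continuous.continuousAt L χ
    (chartAt E' (f x)) ?_ (mem_chart_source _ _) hχ (IsManifold.chart_mem_maximalAtlas _) ?_
  · simp [χ, hae, a]
  · intro w hw
    have hw' : w ∈ χ.target := by simpa using hw
    have h1 : L w ∈ e.target := by
      have : L w ∈ e.target ∧ e.symm (L w) ∈ (chartAt E x).target := by simpa [χ] using hw'
      exact this.1
    have h2 := e.right_inv h1
    rw [heF] at h2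
    have h3 := congrArg Prod.fst h2
    simpa [χ, hF] using h3

/-- A smooth map between finite-dimensional manifolds with injective tangent map is an
immersion. -/
theorem isImmersionAtOfComplement_of_injective_mfderiv {f : N → N'}
    (hf : ContMDiff 𝓘(ℝ, E) 𝓘(ℝ, E') ∞ f) (x : N)
    (hs : Function.Injective (mfderiv 𝓘(ℝ, E) 𝓘(ℝ, E') f x)) (C : Type*)
    [NormedAddCommGroup C] [NormedSpace ℝ C] [FiniteDimensional ℝ C]
    (hC : Module.finrank ℝ E' = Module.finrank ℝ E + Module.finrank ℝ C) :
    IsImmersionAtOfComplement C 𝓘(ℝ, E) 𝓘(ℝ, E') ∞ f x := by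
  obtain ⟨U, hU, hxU, hUt, hUs, hFU⟩ := contDiffOn_written_in_charts hf x
  rw [mfderiv_eq_fderiv_charts hf x] at hs
  set F := chartAt E' (f x) ∘ f ∘ (chartAt E x).symm with hF
  set a := chartAt E x x
  set A : E →L[ℝ] E' := fderiv ℝ F a with hA
  have hs' : Function.Injective A.toLinearMap := hs
  obtain ⟨W, hW⟩ := (LinearMap.range A.toLinearMap).exists_isCompl
  have hr : Module.finrank ℝ (LinearMap.range A.toLinearMap) = Module.finrank ℝ E :=
    LinearMap.finrank_range_of_inj hs'
  have hsum := Submodule.finrank_add_eq_of_isCompl hW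
  have hk : Module.finrank ℝ C = Module.finrank ℝ W := by
    omega
  let κ := ContinuousLinearEquiv.ofFinrankEq hk
  -- `C` is identified with a complement of the range of `A`, so that `(z, c) ↦ F z + Q c` is a
  -- local diffeomorphism at `(a, 0)` and extends `F` from the slice `c = 0`.
  let Q : C →L[ℝ] E' := W.subtypeL.comp (κ : C →L[ℝ] W)
  have hinj : Function.Injective (A.coprod Q) := by
    rw [injective_iff_map_eq_zero]
    rintro ⟨v, c⟩ hv
    have h0 : A v + κ c = 0 := hv
    have h1 : A v ∈ LinearMap.range A.toLinearMap := ⟨v, rfl⟩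
    have h2 : A v ∈ W := by
      rw [eq_neg_of_add_eq_zero_left h0]
      exact W.neg_mem (κ c).2
    have h3 : A v = 0 := (Submodule.disjoint_def.1 hW.disjoint) _ h1 h2
    have h4 : v = 0 := hs' (by simpa using h3)
    have h5 : κ c = 0 := by
      rw [h3, zero_add] at h0
      exact_mod_cast h0
    have h6 : c = 0 := by simpa using h5
    rw [h4, h6]; rfl
  have hdim : Module.finrank ℝ (E × C) = Module.finrank ℝ E' := by
    rw [Module.finrank_prod]
    omega
  let L : (E × C) ≃L[ℝ] E' :=
    (LinearEquiv.ofInjectiveOfFinrankEq (A.coprod Q).toLinearMap hinj hdim).toContinuousLinearEquiv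
  have hLA : ∀ v, L v = A v.1 + Q v.2 := fun v => rfl
  have hΦ : ContDiffOn ℝ ∞ (fun p : E × C => F p.1 + Q p.2) (U ×ˢ univ) :=
    (hFU.comp contDiff_fst.contDiffOn fun p hp => hp.1).add
      (Q.contDiff.comp contDiff_snd).contDiffOn
  have hder : fderiv ℝ (fun p : E × C => F p.1 + Q p.2) (a, 0) = L := by
    have hd : DifferentiableAt ℝ F a := (hFU.contDiffAt (hU.mem_nhds hxU)).differentiableAt (by simp)
    have h1 : HasFDerivAt (fun p : E × C => F p.1) (A.comp (ContinuousLinearMap.fst ℝ E C)) (a, 0) :=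
      HasFDerivAt.comp (g := F) (a, (0 : C)) hd.hasFDerivAt hasFDerivAt_fst
    have h2 : HasFDerivAt (fun p : E × C => Q p.2) (Q.comp (ContinuousLinearMap.snd ℝ E C)) (a, 0) :=
      HasFDerivAt.comp (g := Q) (a, (0 : C)) Q.hasFDerivAt hasFDerivAt_snd
    rw [(h1.fun_add h2).fderiv]
    ext v <;> simp [hLA]
  obtain ⟨e, hae, heU, heF, hes⟩ := exists_openPartialHomeomorph_of_contDiffOn
    (hU.prod isOpen_univ) hΦ (a := (a, 0)) ⟨hxU, mem_univ _⟩ L hder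
  let ψ : OpenPartialHomeomorph N' E' :=
    ((chartAt E' (f x)).trans e.symm).trans L.toHomeomorph.toOpenPartialHomeomorph
  have hψs : ∀ y ∈ ψ.source, y ∈ (chartAt E' (f x)).source ∧ chartAt E' (f x) y ∈ e.target := by
    intro y hy
    simpa [ψ] using hy
  have hψ : ψ ∈ IsManifold.maximalAtlas 𝓘(ℝ, E') ∞ N' := by
    apply OpenPartialHomeomorph.mem_maximalAtlas_of_contMDiffOn
    · have h1 : ContMDiffOn 𝓘(ℝ, E') 𝓘(ℝ, E') ∞ (fun z => L (e.symm z)) e.target := by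
        rw [contMDiffOn_iff_contDiffOn]
        exact L.contDiff.comp_contDiffOn hes
      refine (h1.comp (contMDiffOn_chart (I := 𝓘(ℝ, E')) (n := ∞) (x := f x) |>.mono
        fun y hy => (hψs y hy).1) fun y hy => (hψs y hy).2).congr fun y hy => ?_
      simp [ψ]
    · have h1 : ContMDiffOn 𝓘(ℝ, E') 𝓘(ℝ, E') ∞ (fun w => e (L.symm w)) (L.symm ⁻¹' e.source) := by
        rw [contMDiffOn_iff_contDiffOn]
        exact ((hΦ.mono heU).congr fun z _ => heF z).comp L.symm.contDiff.contDiffOn fun w hw => hw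
      have ht : ∀ w ∈ ψ.target, L.symm w ∈ e.source ∧
          e (L.symm w) ∈ (chartAt E' (f x)).target := by
        intro w hw
        simpa [ψ] using hw
      refine ((contMDiffOn_chart_symm (I := 𝓘(ℝ, E')) (n := ∞) (x := f x)).comp
        (h1.mono fun w hw => (ht w hw).1) fun w hw => (ht w hw).2).congr fun w hw => ?_
      simp [ψ]
  -- The domain chart is shrunk so that its slice `c = 0` stays in the source of `e`, where `e.symm`
  -- undoes `F`.
  have hS : IsOpen ((chartAt E x).source ∩ chartAt E x ⁻¹' {z | (z, (0 : C)) ∈ e.source}) :=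
    (chartAt E x).isOpen_inter_preimage (e.open_source.preimage (by fun_prop))
  have hFx : e (a, 0) = chartAt E' (f x) (f x) := by simp [heF, hF, a]
  refine IsImmersionAtOfComplement.mk_of_continuousAt hf.continuous.continuousAt L
    ((chartAt E x).restrOpen _ hS) ψ ?_ ?_ ?_ hψ ?_
  · simp [hae, a]
  · have := e.map_source hae
    rw [hFx] at this
    simp [ψ, this]
  · have := restr_mem_maximalAtlas (contDiffGroupoid ∞ 𝓘(ℝ, E))
      (IsManifold.chart_mem_maximalAtlas (I := 𝓘(ℝ, E)) (n := ∞) x) hS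
    simp only [OpenPartialHomeomorph.restr, hS.interior_eq] at this
    exact this
  · intro w hw
    have hw1 : w ∈ ((chartAt E x).restrOpen _ hS).target := by simpa using hw
    have hw2 := ((chartAt E x).restrOpen _ hS).map_target hw1
    have hw3 : (chartAt E x) ((chartAt E x).symm w) = w :=
      ((chartAt E x).restrOpen _ hS).right_inv hw1
    have hw4 : ((chartAt E x) ((chartAt E x).symm w), (0 : C)) ∈ e.source := hw2.2.2
    rw [hw3] at hw4
    have h5 := e.left_inv hw4
    rw [heF] at h5
    have h6 : F w = chartAt E' (f x) (f ((chartAt E x).symm w)) := rfl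
    simp only [map_zero, add_zero, h6] at h5
    simp [ψ, h5]

end InverseFunction

/-! ### Product charts adapted to a submersion. -/

section SubmersionCharts

open Set

variable {E E' N N' : Type*} [NormedAddCommGroup E] [NormedSpace ℝ E]
  [NormedAddCommGroup E'] [NormedSpace ℝ E']
  [TopologicalSpace N] [ChartedSpace E N] [TopologicalSpace N'] [ChartedSpace E' N']

/-- The model space of the fibres of a submersion. -/
abbrev FibreModel (E E' : Type*) [NormedAddCommGroup E] [NormedSpace ℝ E]
    [NormedAddCommGroup E'] [NormedSpace ℝ E'] : Type :=
  EuclideanSpace ℝ (Fin (Module.finrank ℝ E - Module.finrank ℝ E'))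

/-- A local diffeomorphism to a product which turns `f` into the first projection. -/
structure IsSubmersionChart (f : N → N')
    (e : OpenPartialHomeomorph N (N' × FibreModel E E')) : Prop where
  contMDiffOn : ContMDiffOn 𝓘(ℝ, E) (𝓘(ℝ, E').prod 𝓘(ℝ, FibreModel E E')) ∞ e e.source
  contMDiffOn_symm : ContMDiffOn (𝓘(ℝ, E').prod 𝓘(ℝ, FibreModel E E')) 𝓘(ℝ, E) ∞ e.symm e.target
  fst_eq : ∀ y ∈ e.source, (e y).1 = f y

/-- The complement in the definition of a submersion may depend on the point; counting dimensions
replaces it by one Euclidean model. The inequality of dimensions ensures that the subtraction in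
`FibreModel` is not truncated. -/
theorem exists_isSubmersionChart [FiniteDimensional ℝ E] [FiniteDimensional ℝ E'] {f : N → N'} {x : N}
    (h : IsSubmersionAt 𝓘(ℝ, E) 𝓘(ℝ, E') ∞ f x) :
    Module.finrank ℝ E' ≤ Module.finrank ℝ E ∧
      ∃ e : OpenPartialHomeomorph N (N' × FibreModel E E'), x ∈ e.source ∧
        IsSubmersionChart f e := by
  obtain ⟨C, _, _, hC⟩ := h
  have hfd : FiniteDimensional ℝ C := by
    have : FiniteDimensional ℝ (E' × C) := hC.equiv.toLinearEquiv.finiteDimensional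
    exact FiniteDimensional.of_surjective (LinearMap.snd ℝ E' C) Prod.snd_surjective
  have hdim : Module.finrank ℝ E = Module.finrank ℝ E' + Module.finrank ℝ C := by
    rw [← Module.finrank_prod]
    exact hC.equiv.toLinearEquiv.finrank_eq
  have hdim' : Module.finrank ℝ C = Module.finrank ℝ (FibreModel E E') := by
    rw [finrank_euclideanSpace, Fintype.card_fin]
    omega
  replace hC := hC.trans_F (ContinuousLinearEquiv.ofFinrankEq hdim')
  refine ⟨by omega, ?_⟩
  set φ := hC.domChart
  set ψ := hC.codChart
  set L := hC.equiv
  have hφ : φ ∈ IsManifold.maximalAtlas 𝓘(ℝ, E) ∞ N := hC.domChart_mem_maximalAtlas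
  have hψ : ψ ∈ IsManifold.maximalAtlas 𝓘(ℝ, E') ∞ N' := hC.codChart_mem_maximalAtlas
  have hw : ∀ y ∈ φ.source, (L (φ y)).1 = ψ (f y) := by
    intro y hy
    have hm : φ y ∈ (hC.domChart.extend 𝓘(ℝ, E)).target := by
      rw [OpenPartialHomeomorph.extend_target]
      simpa using φ.map_source hy
    have h2 : ψ (f (φ.symm (φ y))) = (L (φ y)).1 := hC.writtenInCharts hm
    rw [← h2, φ.left_inv hy]
  have hψs : ∀ y ∈ φ.source, f y ∈ ψ.source := fun y hy => hC.source_subset_preimage_source hy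
  -- Undoing the codomain chart `ψ` on the first factor turns the coordinate form of the submersion
  -- into the equation that the first component is `f` itself.
  let e : OpenPartialHomeomorph N (N' × FibreModel E E') :=
    (φ.trans L.toHomeomorph.toOpenPartialHomeomorph).trans
      (ψ.symm.prod (OpenPartialHomeomorph.refl _))
  have hes : ∀ y ∈ e.source, y ∈ φ.source := fun y hy => hy.1.1
  have he : ∀ y, e y = (ψ.symm (L (φ y)).1, (L (φ y)).2) := fun y => rfl
  have hesymm : ∀ p, e.symm p = φ.symm (L.symm (ψ p.1, p.2)) := fun p => rfl
  have het : ∀ p ∈ e.target, p.1 ∈ ψ.source ∧ L.symm (ψ p.1, p.2) ∈ φ.target := by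
    intro p hp
    simpa [e] using hp
  refine ⟨e, ?_, ?_, ?_, ?_⟩
  · have h1 := hC.mem_domChart_source
    simp [e, hw x h1, h1, ψ.map_source (hψs x h1), φ]
  · have h1 : ContMDiffOn 𝓘(ℝ, E) 𝓘(ℝ, E') ∞ (fun y => (L (φ y)).1) e.source :=
      (contMDiff_iff_contDiff.2 (contDiff_fst.comp L.contDiff)).comp_contMDiffOn
        ((contMDiffOn_of_mem_maximalAtlas hφ).mono hes)
    have h2 : ContMDiffOn 𝓘(ℝ, E) 𝓘(ℝ, FibreModel E E') ∞ (fun y => (L (φ y)).2) e.source :=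
      (contMDiff_iff_contDiff.2 (contDiff_snd.comp L.contDiff)).comp_contMDiffOn
        ((contMDiffOn_of_mem_maximalAtlas hφ).mono hes)
    have h3 : ∀ y ∈ e.source, (L (φ y)).1 ∈ ψ.target := fun y hy => by
      rw [hw y (hes y hy)]
      exact ψ.map_source (hψs y (hes y hy))
    exact ContMDiffOn.prodMk ((contMDiffOn_symm_of_mem_maximalAtlas hψ).comp h1 h3) h2
  · have h1 : ContMDiffOn (𝓘(ℝ, E').prod 𝓘(ℝ, FibreModel E E')) 𝓘(ℝ, E') ∞
        (fun p : N' × FibreModel E E' => ψ p.1) e.target :=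
      (contMDiffOn_of_mem_maximalAtlas hψ).comp contMDiff_fst.contMDiffOn fun p hp => (het p hp).1
    have h2 : ContMDiffOn (𝓘(ℝ, E').prod 𝓘(ℝ, FibreModel E E')) 𝓘(ℝ, E) ∞
        (fun p : N' × FibreModel E E' => L.symm (ψ p.1, p.2)) e.target :=
      (contMDiff_iff_contDiff.2 L.symm.contDiff).comp_contMDiffOn
        (h1.prodMk_space contMDiff_snd.contMDiffOn)
    exact (contMDiffOn_symm_of_mem_maximalAtlas hφ).comp h2 fun p hp => (het p hp).2
  · intro y hy
    rw [he, hw y (hes y hy)]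
    exact ψ.left_inv (hψs y (hes y hy))

end SubmersionCharts

/-! ### Local frames and smoothness of coefficients. -/

section Frames

open Filter Set
open scoped Topology

variable {EB B F : Type*} [NormedAddCommGroup EB] [NormedSpace ℝ EB]
  [TopologicalSpace B] [ChartedSpace EB B] [NormedAddCommGroup F] [NormedSpace ℝ F]
  {V : B → Type*} [TopologicalSpace (TotalSpace F V)] [∀ x, TopologicalSpace (V x)]
  [FiberBundle F V] [∀ x, AddCommGroup (V x)] [∀ x, Module ℝ (V x)] [VectorBundle ℝ F V]

theorem trivializationAt_sum_smul {k : ℕ} (x₀ : B) {x : B}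
    (hx : x ∈ (trivializationAt F V x₀).baseSet) (c : Fin k → ℝ) (v : Fin k → V x) :
    (trivializationAt F V x₀ ⟨x, ∑ i, c i • v i⟩).2 =
      ∑ i, c i • (trivializationAt F V x₀ ⟨x, v i⟩).2 := by
  have h : ∀ w : V x, (trivializationAt F V x₀ ⟨x, w⟩).2 =
      (trivializationAt F V x₀).linearMapAt ℝ x w := fun w => by
    rw [Trivialization.coe_linearMapAt_of_mem _ hx]
  simp only [h, map_sum, map_smul]

/-- The coefficients of a smooth section with respect to linearly independent smooth sections are
smooth. -/
theorem contMDiffOn_coeff_of_linearIndependent [FiniteDimensional ℝ F] {U : Set B} (hU : IsOpen U)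
    {k : ℕ} {s : Fin k → ∀ x, V x} (hs : ∀ i, SmoothSectionOn EB F (s i) U)
    (hli : ∀ x ∈ U, LinearIndependent ℝ fun i => s i x) {t : ∀ x, V x}
    (ht : SmoothSectionOn EB F t U) {c : Fin k → B → ℝ}
    (hc : ∀ x ∈ U, t x = ∑ i, c i x • s i x) (i : Fin k) :
    ContMDiffOn 𝓘(ℝ, EB) 𝓘(ℝ, ℝ) ∞ (c i) U := by
  intro x₀ hx₀
  refine ContMDiffAt.contMDiffWithinAt ?_
  have hUx : U ∈ 𝓝 x₀ := hU.mem_nhds hx₀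
  let e := trivializationAt F V x₀
  have hex₀ : x₀ ∈ e.baseSet := mem_baseSet_trivializationAt F V x₀
  have hs' : ∀ i, ContMDiffAt 𝓘(ℝ, EB) 𝓘(ℝ, F) ∞ (fun x => (e ⟨x, s i x⟩).2) x₀ := fun i =>
    (contMDiffAt_section x₀).1 ((hs i).contMDiffAt hUx)
  have ht' : ContMDiffAt 𝓘(ℝ, EB) 𝓘(ℝ, F) ∞ (fun x => (e ⟨x, t x⟩).2) x₀ :=
    (contMDiffAt_section x₀).1 (ht.contMDiffAt hUx)
  let S₀ : (Fin k → ℝ) →ₗ[ℝ] F := Fintype.linearCombination ℝ fun i => (e ⟨x₀, s i x₀⟩).2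
  have hS₀ : Function.Injective S₀ := by
    rw [injective_iff_map_eq_zero]
    intro a ha
    have h1 : (e ⟨x₀, ∑ i, a i • s i x₀⟩).2 = 0 := by
      rw [trivializationAt_sum_smul x₀ hex₀]
      simpa [S₀, Fintype.linearCombination_apply] using ha
    have h2 : e.linearMapAt ℝ x₀ (∑ i, a i • s i x₀) = 0 := by
      rw [Trivialization.coe_linearMapAt_of_mem _ hex₀]; exact h1
    have h3 : ∑ i, a i • s i x₀ = 0 := by
      have := e.symmₗ_linearMapAt (R := ℝ) hex₀ (∑ i, a i • s i x₀)
      rw [h2, map_zero] at this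
      exact this.symm
    exact funext (Fintype.linearIndependent_iff.1 (hli x₀ hx₀) a h3)
  obtain ⟨L, hL⟩ := S₀.exists_leftInverse_of_injective (LinearMap.ker_eq_bot.2 hS₀)
  let L' : F →L[ℝ] (Fin k → ℝ) := L.toContinuousLinearMap
  -- `A x` composes the frame map at `x` with a left inverse of the frame map at `x₀`. It is the
  -- identity at `x₀`, hence invertible nearby with smooth inverse, and the coefficients of `t` are
  -- `(A x)⁻¹ L' t`.
  let A : B → (Fin k → ℝ) →L[ℝ] (Fin k → ℝ) := fun x =>
    ∑ i, (ContinuousLinearMap.proj (R := ℝ) (φ := fun _ : Fin k => ℝ) i).smulRight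
      (L' (e ⟨x, s i x⟩).2)
  have hAapp : ∀ x a, A x a = L' (∑ i, a i • (e ⟨x, s i x⟩).2) := by
    intro x a
    simp [A]
  have hA : ContMDiffAt 𝓘(ℝ, EB) 𝓘(ℝ, (Fin k → ℝ) →L[ℝ] (Fin k → ℝ)) ∞ A x₀ := by
    refine contMDiffAt_finsetSum fun i _ => ?_
    have h1 : ContDiff ℝ ∞ fun v : F =>
        (ContinuousLinearMap.proj (R := ℝ) (φ := fun _ : Fin k => ℝ) i).smulRight (L' v) :=
      ContDiff.comp ((ContinuousLinearMap.smulRightL ℝ (Fin k → ℝ) (Fin k → ℝ)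
        (ContinuousLinearMap.proj i)).contDiff) L'.contDiff
    exact h1.contMDiff.contMDiffAt.comp x₀ (hs' i)
  have hA₀ : A x₀ = ContinuousLinearMap.id ℝ _ := by
    ext1 a
    rw [hAapp]
    exact LinearMap.congr_fun hL a
  have hinv : ContMDiffAt 𝓘(ℝ, EB) 𝓘(ℝ, (Fin k → ℝ) →L[ℝ] (Fin k → ℝ)) ∞
      (fun x => (A x).inverse) x₀ := by
    have h1 : ContDiffAt ℝ ∞ (ContinuousLinearMap.inverse :
        ((Fin k → ℝ) →L[ℝ] (Fin k → ℝ)) → _) (A x₀) := by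
      rw [hA₀]
      exact contDiffAt_map_inverse (ContinuousLinearEquiv.refl ℝ (Fin k → ℝ))
    exact h1.contMDiffAt.comp x₀ hA
  have hfin : ContMDiffAt 𝓘(ℝ, EB) 𝓘(ℝ, Fin k → ℝ) ∞
      (fun x => (A x).inverse (L' (e ⟨x, t x⟩).2)) x₀ :=
    hinv.clm_apply (L'.contDiff.contMDiff.contMDiffAt.comp x₀ ht')
  have hev : ∀ᶠ x in 𝓝 x₀, c i x = (A x).inverse (L' (e ⟨x, t x⟩).2) i := by
    have h1 : ∀ᶠ x in 𝓝 x₀, A x ∈ range ((↑) : ((Fin k → ℝ) ≃L[ℝ] (Fin k → ℝ)) → _) :=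
      hA.continuousAt.eventually (ContinuousLinearEquiv.isOpen.mem_nhds
        ⟨ContinuousLinearEquiv.refl ℝ _, hA₀.symm⟩)
    filter_upwards [h1, hUx, e.open_baseSet.mem_nhds hex₀] with x ⟨M, hM⟩ hxU hxe
    rw [hc x hxU, trivializationAt_sum_smul x₀ hxe, ← hAapp x (fun j => c j x), ← hM,
      ContinuousLinearMap.inverse_equiv]
    simp
  have hpi : ContMDiffAt 𝓘(ℝ, EB) 𝓘(ℝ, ℝ) ∞
      (fun x => (A x).inverse (L' (e ⟨x, t x⟩).2) i) x₀ :=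
    (contMDiffAt_pi_space.1 hfin) i
  exact hpi.congr_of_eventuallyEq hev

theorem SmoothSectionOn.sum_smul {U : Set B} {k : ℕ} {s : Fin k → ∀ x, V x}
    (hs : ∀ i, SmoothSectionOn EB F (s i) U) {c : Fin k → B → ℝ}
    (hc : ∀ i, ContMDiffOn 𝓘(ℝ, EB) 𝓘(ℝ, ℝ) ∞ (c i) U) :
    SmoothSectionOn EB F (fun x => ∑ i, c i x • s i x) U :=
  ContMDiffOn.sum_section fun i _ => (hc i).smul_section (hs i)

variable {K : ∀ x, Submodule ℝ (V x)}

/-- A smooth local section of a subbundle has smooth coefficients in a frame. -/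
theorem exists_coeff_of_frame [FiniteDimensional ℝ F] {U : Set B} (hU : IsOpen U)
    {k : ℕ} {s : Fin k → ∀ x, V x} (hs : ∀ i, SmoothSectionOn EB F (s i) U)
    (hli : ∀ x ∈ U, LinearIndependent ℝ (fun i => s i x) ∧
      Submodule.span ℝ (Set.range fun i => s i x) = K x) (t : ∀ x, K x) :
    ∃ c : Fin k → B → ℝ, (∀ x ∈ U, (t x : V x) = ∑ i, c i x • s i x) ∧
      (SmoothSectionOn EB F (fun x => (t x : V x)) U →
        ∀ i, ContMDiffOn 𝓘(ℝ, EB) 𝓘(ℝ, ℝ) ∞ (c i) U) := by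
  have h1 : ∀ x, ∃ a : Fin k → ℝ, x ∈ U → (t x : V x) = ∑ i, a i • s i x := by
    intro x
    by_cases hx : x ∈ U
    · have h2 : (t x : V x) ∈ Submodule.span ℝ (Set.range fun i => s i x) := by
        rw [(hli x hx).2]; exact (t x).2
      obtain ⟨a, ha⟩ := (Submodule.mem_span_range_iff_exists_fun ℝ).1 h2
      exact ⟨a, fun _ => ha.symm⟩
    · exact ⟨0, fun h => absurd h hx⟩
  choose a ha using h1
  refine ⟨fun i x => a x i, fun x hx => ha x hx, fun ht i => ?_⟩
  exact contMDiffOn_coeff_of_linearIndependent hU hs (fun x hx => (hli x hx).1) ht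
    (c := fun i x => a x i) (fun x hx => ha x hx) i

variable {F' : Type*} [NormedAddCommGroup F'] [NormedSpace ℝ F']
  {V' : B → Type*} [TopologicalSpace (TotalSpace F' V')] [∀ x, TopologicalSpace (V' x)]
  [FiberBundle F' V'] [∀ x, AddCommGroup (V' x)] [∀ x, Module ℝ (V' x)] [VectorBundle ℝ F' V']

/-- A section of a subbundle which is mapped to a smooth section by a smooth injective bundle map
is smooth. -/
theorem SmoothBundleMap.smoothSectionOn_of_comp [FiniteDimensional ℝ F]
    [FiniteDimensional ℝ F']
    (hK : IsSmoothSubbundle EB F K) {Φ : ∀ x, K x →ₗ[ℝ] V' x}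
    (hΦ : SmoothBundleMap EB F F' Φ) (hinj : ∀ x, Function.Injective (Φ x)) {W : Set B}
    (hW : IsOpen W) {t : ∀ x, K x} (ht : SmoothSectionOn EB F' (fun x => Φ x (t x)) W) :
    SmoothSectionOn EB F (fun x => (t x : V x)) W := by
  classical
  intro x₀ hx₀
  obtain ⟨U, hU, hxU, k, s, hs, hli⟩ := hK x₀
  have hUW : IsOpen (U ∩ W) := hU.inter hW
  have hmem : ∀ x ∈ U, ∀ i, s i x ∈ K x := fun x hx i => by
    rw [← (hli x hx).2]; exact Submodule.subset_span ⟨i, rfl⟩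
  let s' : Fin k → ∀ x, K x := fun i x => if h : x ∈ U then ⟨s i x, hmem x h i⟩ else 0
  have hs' : ∀ i, ∀ x ∈ U, (s' i x : V x) = s i x := fun i x hx => by simp [s', hx]
  have hs'sm : ∀ i, SmoothSectionOn EB F (fun x => (s' i x : V x)) (U ∩ W) := fun i =>
    ((hs i).mono inter_subset_left).congr fun x hx => by simp only [hs' i x hx.1]
  obtain ⟨c, hc, -⟩ := exists_coeff_of_frame (EB := EB) hU hs hli t
  have hct : ∀ x ∈ U, t x = ∑ i, c i x • s' i x := fun x hx => by
    apply Subtype.ext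
    rw [hc x hx]
    simp [hs' _ x hx]
  -- By injectivity the images `Φ (s' i)` remain linearly independent, and `Φ t` has the same
  -- coefficients in them as `t` has in the frame. The smoothness of `Φ t` thus makes these
  -- coefficients smooth.
  have hcs : ∀ i, ContMDiffOn 𝓘(ℝ, EB) 𝓘(ℝ, ℝ) ∞ (c i) (U ∩ W) := by
    refine contMDiffOn_coeff_of_linearIndependent (V := V') hUW
      (fun i => hΦ (U ∩ W) (s' i) hUW (hs'sm i)) (fun x hx => ?_) (ht.mono inter_subset_right)
      (fun x hx => ?_)
    · have h1 : LinearIndependent ℝ fun i => s' i x := by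
        refine LinearIndependent.of_comp (K x).subtype ?_
        convert (hli x hx.1).1 using 2 with i
        exact hs' _ x hx.1
      exact h1.map' (Φ x) (LinearMap.ker_eq_bot.2 (hinj x))
    · rw [hct x hx.1]
      simp
  have hfin : SmoothSectionOn EB F (fun x => (t x : V x)) (U ∩ W) :=
    (SmoothSectionOn.sum_smul (fun i => (hs i).mono inter_subset_left) hcs).congr fun x hx => by
      simp only [hc x hx.1]
  exact (hfin.contMDiffAt (hUW.mem_nhds ⟨hxU, hx₀⟩)).contMDiffWithinAt

end Frames

/-! ### Global sections, tensoriality and uniqueness of algebroid structures. -/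

section GlobalSections

open Filter Set
open scoped Topology

variable {EB B F : Type*} [NormedAddCommGroup EB] [NormedSpace ℝ EB]
  [TopologicalSpace B] [ChartedSpace EB B] [NormedAddCommGroup F] [NormedSpace ℝ F]
  {V : B → Type*} [TopologicalSpace (TotalSpace F V)] [∀ x, TopologicalSpace (V x)]
  [FiberBundle F V] [∀ x, AddCommGroup (V x)] [∀ x, Module ℝ (V x)] [VectorBundle ℝ F V]
  {K : ∀ x, Submodule ℝ (V x)}

theorem sectionVal_ext {X Y : SubbundleSection EB F K}
    (h : ∀ x, (sectionVal X x : V x) = sectionVal Y x) : X = Y :=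
  Subtype.ext (ContMDiffSection.ext h)

theorem sectionVal_add (X Y : SubbundleSection EB F K) (x : B) :
    sectionVal (X + Y) x = sectionVal X x + sectionVal Y x := rfl

theorem sectionVal_zero (x : B) : sectionVal (0 : SubbundleSection EB F K) x = 0 := rfl

theorem sectionVal_sectionSMul (f : C^∞⟮𝓘(ℝ, EB), B; ℝ⟯) (X : SubbundleSection EB F K) (x : B) :
    sectionVal (sectionSMul f X) x = f x • sectionVal X x := rfl

theorem sectionVal_sub (X Y : SubbundleSection EB F K) (x : B) :
    sectionVal (X - Y) x = sectionVal X x - sectionVal Y x := rfl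

theorem sectionVal_sum {ι : Type*} (s : Finset ι) (X : ι → SubbundleSection EB F K) (x : B) :
    sectionVal (∑ i ∈ s, X i) x = ∑ i ∈ s, sectionVal (X i) x := by
  classical
  induction s using Finset.induction_on with
  | empty => simp [sectionVal_zero]
  | insert a s ha ih => rw [Finset.sum_insert ha, Finset.sum_insert ha, sectionVal_add, ih]

/-- The product of a bump function and a local section is a global section. -/
theorem exists_section_bump_smul {U : Set B} (hU : IsOpen U) (χ : C^∞⟮𝓘(ℝ, EB), B; ℝ⟯)
    (hχ : tsupport χ ⊆ U) {s : ∀ x, V x} (hs : SmoothSectionOn EB F s U) (hK : ∀ x ∈ U, s x ∈ K x) :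
    ∃ X : SubbundleSection EB F K, ∀ x, (sectionVal X x : V x) = χ x • s x := by
  refine ⟨⟨⟨fun x => χ x • s x, ContMDiffOn.smul_section_of_tsupport χ.contMDiff.contMDiffOn hU hχ
    hs⟩, fun x => ?_⟩, fun x => rfl⟩
  change χ x • s x ∈ K x
  by_cases hx : x ∈ U
  · exact (K x).smul_mem _ (hK x hx)
  · rw [image_eq_zero_of_notMem_tsupport fun h => hx (hχ h), zero_smul]
    exact (K x).zero_mem

theorem LieAlgebroid.bracket_swap [IsManifold 𝓘(ℝ, EB) ∞ B]
    (ℬ : LieAlgebroid EB F K) (X Y : SubbundleSection EB F K) :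
    ℬ.bracket X Y = -ℬ.bracket Y X := by
  have h := ℬ.bracket_self (X + Y)
  simp only [map_add, LinearMap.add_apply, ℬ.bracket_self, zero_add, add_zero] at h
  rw [add_comm] at h
  exact eq_neg_of_add_eq_zero_left h

variable [FiniteDimensional ℝ EB] [T2Space B] [IsManifold 𝓘(ℝ, EB) ∞ B]

/-- A smooth function supported in a neighbourhood of a point, equal to one at the point. -/
theorem exists_bump {U : Set B} (hU : IsOpen U) {x₀ : B} (hx₀ : x₀ ∈ U) :
    ∃ χ : C^∞⟮𝓘(ℝ, EB), B; ℝ⟯, χ x₀ = 1 ∧ tsupport χ ⊆ U := by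
  obtain ⟨f, -, hf⟩ := (SmoothBumpFunction.nhds_basis_tsupport (I := 𝓘(ℝ, EB)) x₀).mem_iff.1
    (hU.mem_nhds hx₀)
  exact ⟨⟨f, f.contMDiff⟩, f.eq_one, hf⟩

/-- Every vector of a smooth subbundle is the value of a global section. -/
theorem IsSmoothSubbundle.exists_section (hK : IsSmoothSubbundle EB F K) (x₀ : B) (v : K x₀) :
    ∃ X : SubbundleSection EB F K, sectionVal X x₀ = v := by
  obtain ⟨U, hU, hxU, k, s, hs, hli⟩ := hK x₀
  have hv : (v : V x₀) ∈ Submodule.span ℝ (range fun i => s i x₀) := by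
    rw [(hli x₀ hxU).2]; exact v.2
  obtain ⟨a, ha⟩ := (Submodule.mem_span_range_iff_exists_fun ℝ).1 hv
  obtain ⟨χ, hχ1, hχ⟩ := exists_bump (EB := EB) hU hxU
  obtain ⟨X, hX⟩ := exists_section_bump_smul (K := K) hU χ hχ
    (SmoothSectionOn.sum_smul hs (c := fun i _ => a i) fun i => contMDiffOn_const) fun x hx => by
      rw [← (hli x hx).2]
      exact Submodule.sum_mem _ fun i _ => Submodule.smul_mem _ _ (Submodule.subset_span ⟨i, rfl⟩)
  refine ⟨X, Subtype.ext ?_⟩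
  rw [hX, hχ1, one_smul, ha]

variable [FiniteDimensional ℝ F]

/-- An operator on sections which is linear over the smooth functions is tensorial. -/
theorem IsSmoothSubbundle.sectionVal_eq_zero_of_tensorial (hK : IsSmoothSubbundle EB F K)
    (D : SubbundleSection EB F K →ₗ[ℝ] SubbundleSection EB F K)
    (hD : ∀ f X x, sectionVal (D (sectionSMul f X)) x = f x • sectionVal (D X) x)
    {x₀ : B} {Y : SubbundleSection EB F K} (hY : sectionVal Y x₀ = 0) :
    sectionVal (D Y) x₀ = 0 := by
  obtain ⟨U, hU, hxU, k, s, hs, hli⟩ := hK x₀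
  obtain ⟨χ, hχ1, hχ⟩ := exists_bump (EB := EB) hU hxU
  obtain ⟨c, hc, hcs⟩ := exists_coeff_of_frame hU hs hli (sectionVal Y)
  have hcs := hcs Y.1.contMDiff.contMDiffOn
  have hmem : ∀ i, ∀ x ∈ U, s i x ∈ K x := fun i x hx => by
    rw [← (hli x hx).2]; exact Submodule.subset_span ⟨i, rfl⟩
  choose S hS using fun i => exists_section_bump_smul (K := K) hU χ hχ (hs i) (hmem i)
  have hfs : ∀ i, ContMDiff 𝓘(ℝ, EB) 𝓘(ℝ, ℝ) ∞ fun x => χ x • c i x := fun i =>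
    contMDiff_of_tsupport (fun x hx => by
      have hxU : x ∈ U := hχ (closure_mono (Function.support_smul_subset_left _ _) hx)
      exact (χ.contMDiff.contMDiffAt).smul ((hcs i).contMDiffAt (hU.mem_nhds hxU)))
  let f : Fin k → C^∞⟮𝓘(ℝ, EB), B; ℝ⟯ := fun i => ⟨fun x => χ x • c i x, hfs i⟩
  have hc0 : ∀ i, c i x₀ = 0 := by
    have h1 := hc x₀ hxU
    rw [hY] at h1
    exact Fintype.linearIndependent_iff.1 (hli x₀ hxU).1 (fun i => c i x₀) h1.symm
  -- Two factors `χ` are used: one makes the coefficients global functions, the other makes the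
  -- frame global sections. Since `χ x₀ = 1`, the value of `D Y` at `x₀` is unchanged, and every
  -- coefficient vanishes there.
  have hsum : sectionSMul χ (sectionSMul χ Y) = ∑ i, sectionSMul (f i) (S i) := by
    refine sectionVal_ext fun x => ?_
    rw [sectionVal_sum]
    simp only [sectionVal_sectionSMul, Submodule.coe_smul, Submodule.coe_sum, hS]
    by_cases hx : x ∈ U
    · rw [hc x hx, Finset.smul_sum, Finset.smul_sum]
      refine Finset.sum_congr rfl fun i _ => ?_
      change _ = (χ x • c i x) • χ x • s i x
      simp only [smul_smul, smul_eq_mul]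
      congr 1
      ring
    · have h0 : χ x = 0 := image_eq_zero_of_notMem_tsupport fun h => hx (hχ h)
      simp [h0]
  have h1 := congrArg (fun Z => sectionVal (D Z) x₀) hsum
  simp only [hD, hχ1, one_smul, map_sum, sectionVal_sum] at h1
  rw [h1]
  refine Finset.sum_eq_zero fun i _ => ?_
  have : f i x₀ = 0 := by
    change χ x₀ • c i x₀ = 0
    rw [hc0, smul_zero]
  rw [this, zero_smul]

/-- Two Lie algebroid structures with the same anchor coincide if their brackets agree on sections
which span the bundle pointwise. -/
theorem LieAlgebroid.eq_of_bracket_eq {ℬ ℬ' : LieAlgebroid EB F K}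
    (hanchor : ∀ x v, ℬ.anchor x v = ℬ'.anchor x v) {S : Set (SubbundleSection EB F K)}
    (hS : ∀ x (v : K x), ∃ X ∈ S, sectionVal X x = v)
    (hbr : ∀ X ∈ S, ∀ Y ∈ S, ℬ.bracket X Y = ℬ'.bracket X Y) : ℬ = ℬ' := by
  -- The derivative terms in the two Leibniz rules depend only on the common anchor, so they cancel
  -- in the difference, which is then linear over functions in the second argument.
  have hten : ∀ X f Y x, sectionVal ((ℬ.bracket X - ℬ'.bracket X) (sectionSMul f Y)) x =
      f x • sectionVal ((ℬ.bracket X - ℬ'.bracket X) Y) x := by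
    intro X f Y x
    rw [LinearMap.sub_apply, LinearMap.sub_apply, sectionVal_sub, sectionVal_sub, ℬ.leibniz,
      ℬ'.leibniz, hanchor, smul_sub]
    abel
  have key : ∀ X Y Y' x, sectionVal Y x = sectionVal Y' x →
      sectionVal (ℬ.bracket X Y) x = sectionVal (ℬ'.bracket X Y) x +
        sectionVal ((ℬ.bracket X - ℬ'.bracket X) Y') x := by
    intro X Y Y' x h
    have h1 := ℬ.isSmoothSubbundle.sectionVal_eq_zero_of_tensorial _ (hten X)
      (Y := Y - Y') (x₀ := x) (by rw [sectionVal_sub, h, sub_self])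
    rw [map_sub, sectionVal_sub, sub_eq_zero] at h1
    rw [← h1, LinearMap.sub_apply, sectionVal_sub]
    abel
  -- Tensoriality allows the second argument to be replaced by a section in `S` with the same value
  -- at `x`. Antisymmetry then treats the first argument in the same way.
  have key2 : ∀ X ∈ S, ∀ Y, ℬ.bracket X Y = ℬ'.bracket X Y := by
    intro X hX Y
    refine sectionVal_ext fun x => ?_
    obtain ⟨Y', hY', h⟩ := hS x (sectionVal Y x)
    rw [key X Y Y' x h.symm, LinearMap.sub_apply, hbr X hX Y' hY', sub_self, sectionVal_zero,
      add_zero]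
  have key3 : ∀ X Y, ℬ.bracket X Y = ℬ'.bracket X Y := by
    intro X Y
    refine sectionVal_ext fun x => ?_
    obtain ⟨Y', hY', h⟩ := hS x (sectionVal Y x)
    rw [key X Y Y' x h.symm, LinearMap.sub_apply, ℬ.bracket_swap X Y', ℬ'.bracket_swap X Y',
      key2 Y' hY' X, sub_self, sectionVal_zero, add_zero]
  refine LieAlgebroid.ext ?_ ?_
  · funext x; exact LinearMap.ext fun v => hanchor x v
  · exact LinearMap.ext₂ key3

end GlobalSections

/-! ### Transport of Lie algebroid structures along bundle isomorphisms. -/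

section Transport

variable {EB B F F' : Type*} [NormedAddCommGroup EB] [NormedSpace ℝ EB]
  [TopologicalSpace B] [ChartedSpace EB B] [NormedAddCommGroup F] [NormedSpace ℝ F] [NormedAddCommGroup F'] [NormedSpace ℝ F']
  {V : B → Type*} [TopologicalSpace (TotalSpace F V)] [∀ x, TopologicalSpace (V x)]
  [FiberBundle F V] [∀ x, AddCommGroup (V x)] [∀ x, Module ℝ (V x)]
  {V' : B → Type*} [TopologicalSpace (TotalSpace F' V')] [∀ x, TopologicalSpace (V' x)]
  [FiberBundle F' V'] [∀ x, AddCommGroup (V' x)] [∀ x, Module ℝ (V' x)]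
  {K : ∀ x, Submodule ℝ (V x)} {K' : ∀ x, Submodule ℝ (V' x)}

/-- A smooth isomorphism maps a smooth subbundle to a smooth subbundle. -/
theorem IsSmoothSubbundle.of_equiv (hK : IsSmoothSubbundle EB F K) (T : ∀ x, K x ≃ₗ[ℝ] K' x)
    (hT : SmoothBundleMap EB F F' (V' := V') fun x => (K' x).subtype ∘ₗ (T x).toLinearMap) :
    IsSmoothSubbundle EB F' K' := by
  classical
  intro x₀
  obtain ⟨U, hU, hxU, k, s, hs, hli⟩ := hK x₀
  have hmem : ∀ x ∈ U, ∀ i, s i x ∈ K x := fun x hx i => by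
    rw [← (hli x hx).2]; exact Submodule.subset_span ⟨i, rfl⟩
  let s' : Fin k → ∀ x, K x := fun i x => if h : x ∈ U then ⟨s i x, hmem x h i⟩ else 0
  have hs' : ∀ i, ∀ x ∈ U, (s' i x : V x) = s i x := fun i x hx => by simp [s', hx]
  have hs'sm : ∀ i, SmoothSectionOn EB F (fun x => (s' i x : V x)) U := fun i =>
    (hs i).congr fun x hx => by simp only [hs' i x hx]
  refine ⟨U, hU, hxU, k, fun i x => (T x (s' i x) : V' x), fun i => hT U (s' i) hU (hs'sm i),
    fun x hx => ?_⟩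
  have h1 : LinearIndependent ℝ fun i => s' i x := by
    refine LinearIndependent.of_comp (K x).subtype ?_
    convert (hli x hx).1 using 2 with i
    exact hs' _ x hx
  have h2 : Submodule.span ℝ (Set.range fun i => s' i x) = ⊤ := by
    apply Submodule.map_injective_of_injective (K x).injective_subtype
    rw [Submodule.map_span, ← Set.range_comp, Submodule.map_top, Submodule.range_subtype]
    exact (congrArg (fun r => Submodule.span ℝ (Set.range r))
      (funext fun i => hs' i x hx)).trans (hli x hx).2
  constructor
  · exact (h1.map' (T x).toLinearMap (LinearMap.ker_eq_bot.2 (T x).injective)).map'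
      (K' x).subtype (LinearMap.ker_eq_bot.2 (K' x).injective_subtype)
  · have h3 := congrArg (Submodule.map ((K' x).subtype ∘ₗ (T x).toLinearMap)) h2
    rw [Submodule.map_span, ← Set.range_comp, Submodule.map_top, LinearMap.range_comp,
      LinearEquiv.range, Submodule.map_top, Submodule.range_subtype] at h3
    exact h3

variable [VectorBundle ℝ F V] [VectorBundle ℝ F' V']

/-- The action of a smooth bundle isomorphism on sections. -/
noncomputable def sectionEquiv (T : ∀ x, K x ≃ₗ[ℝ] K' x)
    (hT : SmoothBundleMap EB F F' (V' := V') fun x => (K' x).subtype ∘ₗ (T x).toLinearMap)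
    (hT' : SmoothBundleMap EB F' F (V' := V) fun x => (K x).subtype ∘ₗ (T x).symm.toLinearMap) :
    SubbundleSection EB F K ≃ₗ[ℝ] SubbundleSection EB F' K' where
  toFun X := ⟨⟨fun x => (T x (sectionVal X x) : V' x), contMDiffOn_univ.1
    (hT Set.univ (sectionVal X) isOpen_univ X.1.contMDiff.contMDiffOn)⟩, fun x => (T x _).2⟩
  invFun X := ⟨⟨fun x => ((T x).symm (sectionVal X x) : V x), contMDiffOn_univ.1
    (hT' Set.univ (sectionVal X) isOpen_univ X.1.contMDiff.contMDiffOn)⟩,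
    fun x => ((T x).symm _).2⟩
  map_add' X Y := sectionVal_ext fun x => congrArg Subtype.val
    ((T x).map_add (sectionVal X x) (sectionVal Y x))
  map_smul' a X := sectionVal_ext fun x => congrArg Subtype.val
    ((T x).map_smul a (sectionVal X x))
  left_inv X := sectionVal_ext fun x => congrArg Subtype.val
    ((T x).symm_apply_apply (sectionVal X x))
  right_inv X := sectionVal_ext fun x => congrArg Subtype.val
    ((T x).apply_symm_apply (sectionVal X x))

theorem sectionVal_sectionEquiv (T : ∀ x, K x ≃ₗ[ℝ] K' x)
    (hT : SmoothBundleMap EB F F' (V' := V') fun x => (K' x).subtype ∘ₗ (T x).toLinearMap)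
    (hT' : SmoothBundleMap EB F' F (V' := V) fun x => (K x).subtype ∘ₗ (T x).symm.toLinearMap)
    (X : SubbundleSection EB F K) (x : B) :
    sectionVal (sectionEquiv T hT hT' X) x = T x (sectionVal X x) := rfl

theorem sectionVal_sectionEquiv_symm (T : ∀ x, K x ≃ₗ[ℝ] K' x)
    (hT : SmoothBundleMap EB F F' (V' := V') fun x => (K' x).subtype ∘ₗ (T x).toLinearMap)
    (hT' : SmoothBundleMap EB F' F (V' := V) fun x => (K x).subtype ∘ₗ (T x).symm.toLinearMap)
    (X : SubbundleSection EB F' K') (x : B) :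
    sectionVal ((sectionEquiv T hT hT').symm X) x = (T x).symm (sectionVal X x) := rfl

theorem sectionEquiv_symm_sectionSMul (T : ∀ x, K x ≃ₗ[ℝ] K' x)
    (hT : SmoothBundleMap EB F F' (V' := V') fun x => (K' x).subtype ∘ₗ (T x).toLinearMap)
    (hT' : SmoothBundleMap EB F' F (V' := V) fun x => (K x).subtype ∘ₗ (T x).symm.toLinearMap)
    (f : C^∞⟮𝓘(ℝ, EB), B; ℝ⟯) (X : SubbundleSection EB F' K') :
    (sectionEquiv T hT hT').symm (sectionSMul f X) =
      sectionSMul f ((sectionEquiv T hT hT').symm X) :=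
  sectionVal_ext fun x => by
    rw [sectionVal_sectionEquiv_symm, sectionVal_sectionSMul, map_smul, sectionVal_sectionSMul,
      sectionVal_sectionEquiv_symm]

/-- A bracket of sections transported along a smooth bundle isomorphism. -/
noncomputable def sectionEquivBracket (T : ∀ x, K x ≃ₗ[ℝ] K' x)
    (hT : SmoothBundleMap EB F F' (V' := V') fun x => (K' x).subtype ∘ₗ (T x).toLinearMap)
    (hT' : SmoothBundleMap EB F' F (V' := V) fun x => (K x).subtype ∘ₗ (T x).symm.toLinearMap)
    (b : SubbundleSection EB F K →ₗ[ℝ] SubbundleSection EB F K →ₗ[ℝ] SubbundleSection EB F K) :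
    SubbundleSection EB F' K' →ₗ[ℝ] SubbundleSection EB F' K' →ₗ[ℝ] SubbundleSection EB F' K' :=
  LinearMap.mk₂ ℝ (fun X Y => sectionEquiv T hT hT'
      (b ((sectionEquiv T hT hT').symm X) ((sectionEquiv T hT hT').symm Y)))
    (fun X X' Y => by simp only [map_add, LinearMap.add_apply])
    (fun a X Y => by simp only [map_smul, LinearMap.smul_apply])
    (fun X Y Y' => by simp only [map_add]) (fun a X Y => by simp only [map_smul])

theorem sectionEquivBracket_apply (T : ∀ x, K x ≃ₗ[ℝ] K' x)
    (hT : SmoothBundleMap EB F F' (V' := V') fun x => (K' x).subtype ∘ₗ (T x).toLinearMap)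
    (hT' : SmoothBundleMap EB F' F (V' := V) fun x => (K x).subtype ∘ₗ (T x).symm.toLinearMap)
    (b : SubbundleSection EB F K →ₗ[ℝ] SubbundleSection EB F K →ₗ[ℝ] SubbundleSection EB F K)
    (X Y : SubbundleSection EB F' K') :
    sectionEquivBracket T hT hT' b X Y = sectionEquiv T hT hT'
      (b ((sectionEquiv T hT hT').symm X) ((sectionEquiv T hT hT').symm Y)) := rfl

variable [IsManifold 𝓘(ℝ, EB) ∞ B]

/-- The Lie algebroid structure transported along an isomorphism of vector bundles. -/
noncomputable def LieAlgebroid.transport (𝒜 : LieAlgebroid EB F K) (T : ∀ x, K x ≃ₗ[ℝ] K' x)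
    (hT : SmoothBundleMap EB F F' (V' := V') fun x => (K' x).subtype ∘ₗ (T x).toLinearMap)
    (hT' : SmoothBundleMap EB F' F (V' := V) fun x => (K x).subtype ∘ₗ (T x).symm.toLinearMap) :
    LieAlgebroid EB F' K' where
  isSmoothSubbundle := 𝒜.isSmoothSubbundle.of_equiv T hT
  anchor x := 𝒜.anchor x ∘ₗ (T x).symm.toLinearMap
  smooth_anchor U s hU hs := 𝒜.smooth_anchor U (fun x => (T x).symm (s x)) hU (hT' U s hU hs)
  bracket := sectionEquivBracket T hT hT' 𝒜.bracket
  bracket_self X := by rw [sectionEquivBracket_apply, 𝒜.bracket_self, map_zero]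
  jacobi X Y Z := by
    -- The inner brackets end with `sectionEquiv` and the outer ones begin with its inverse, so
    -- these cancel and only the original Jacobi identity remains.
    simp only [sectionEquivBracket_apply, LinearEquiv.symm_apply_apply, ← map_add]
    exact congrArg _ (𝒜.jacobi _ _ _)
  leibniz X Y f x := by
    rw [sectionEquivBracket_apply, sectionEquivBracket_apply, sectionVal_sectionEquiv,
      sectionVal_sectionEquiv, sectionEquiv_symm_sectionSMul, 𝒜.leibniz, map_add, map_smul,
      map_smul, sectionVal_sectionEquiv_symm T hT hT' Y x, LinearEquiv.apply_symm_apply,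
      sectionVal_sectionEquiv_symm T hT hT' X x]
    rfl

theorem LieAlgebroid.transport_anchor (𝒜 : LieAlgebroid EB F K) (T : ∀ x, K x ≃ₗ[ℝ] K' x)
    (hT : SmoothBundleMap EB F F' (V' := V') fun x => (K' x).subtype ∘ₗ (T x).toLinearMap)
    (hT' : SmoothBundleMap EB F' F (V' := V) fun x => (K x).subtype ∘ₗ (T x).symm.toLinearMap)
    (x : B) (v : K x) : (𝒜.transport T hT hT').anchor x (T x v) = 𝒜.anchor x v := by
  change 𝒜.anchor x ((T x).symm (T x v)) = _
  rw [LinearEquiv.symm_apply_apply]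

theorem LieAlgebroid.transport_bracket (𝒜 : LieAlgebroid EB F K) (T : ∀ x, K x ≃ₗ[ℝ] K' x)
    (hT : SmoothBundleMap EB F F' (V' := V') fun x => (K' x).subtype ∘ₗ (T x).toLinearMap)
    (hT' : SmoothBundleMap EB F' F (V' := V) fun x => (K x).subtype ∘ₗ (T x).symm.toLinearMap)
    (X Y : SubbundleSection EB F' K') (x : B) :
    sectionVal ((𝒜.transport T hT hT').bracket X Y) x = T x (sectionVal (𝒜.bracket
      ((sectionEquiv T hT hT').symm X) ((sectionEquiv T hT hT').symm Y)) x) := rfl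

/-- The transported structure is isomorphic to the original one. -/
noncomputable def LieAlgebroid.transportIso (𝒜 : LieAlgebroid EB F K) (T : ∀ x, K x ≃ₗ[ℝ] K' x)
    (hT : SmoothBundleMap EB F F' (V' := V') fun x => (K' x).subtype ∘ₗ (T x).toLinearMap)
    (hT' : SmoothBundleMap EB F' F (V' := V) fun x => (K x).subtype ∘ₗ (T x).symm.toLinearMap) :
    LieAlgebroidIso 𝒜 (𝒜.transport T hT hT') where
  toEquiv := T
  smooth_toFun := hT
  smooth_invFun := hT'
  map_anchor := 𝒜.transport_anchor T hT hT'
  map_bracket X Y X' Y' hX hY x := by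
    have h : ∀ (X : SubbundleSection EB F K) (X' : SubbundleSection EB F' K'),
        (∀ x, sectionVal X' x = T x (sectionVal X x)) → (sectionEquiv T hT hT').symm X' = X :=
      fun X X' hX => sectionVal_ext fun x => by
        rw [sectionVal_sectionEquiv_symm, hX, LinearEquiv.symm_apply_apply]
    change sectionVal (sectionEquivBracket T hT hT' 𝒜.bracket X' Y') x = _
    rw [sectionEquivBracket_apply, sectionVal_sectionEquiv]
    rw [h X X' hX, h Y Y' hY]

/-- The inverse of an isomorphism of Lie algebroids. -/
noncomputable def LieAlgebroidIso.symm {𝒜 : LieAlgebroid EB F K} {𝒜' : LieAlgebroid EB F' K'}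
    (Φ : LieAlgebroidIso 𝒜 𝒜') : LieAlgebroidIso 𝒜' 𝒜 where
  toEquiv x := (Φ.toEquiv x).symm
  smooth_toFun := Φ.smooth_invFun
  smooth_invFun := Φ.smooth_toFun
  map_anchor x v := by
    rw [← Φ.map_anchor, LinearEquiv.apply_symm_apply]
  map_bracket X Y X' Y' hX hY x := by
    rw [LinearEquiv.eq_symm_apply]
    exact (Φ.map_bracket X' Y' X Y (fun x => by rw [hX, LinearEquiv.apply_symm_apply])
      (fun x => by rw [hY, LinearEquiv.apply_symm_apply]) x).symm

end Transport

/-! ### Sections of pullbacks and products; smooth families of tangent vectors. -/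

section SectionsOfConstructions

open Filter Set
open scoped Topology

variable {EB B F : Type*} [NormedAddCommGroup EB] [NormedSpace ℝ EB]
  [TopologicalSpace B] [ChartedSpace EB B] [NormedAddCommGroup F] [NormedSpace ℝ F]
  {V : B → Type*} [TopologicalSpace (TotalSpace F V)] [∀ x, TopologicalSpace (V x)]
  [FiberBundle F V]

/-- The smooth sections of a pulled back bundle are the smooth maps to the total space over the
given map. -/
theorem smoothSectionOn_pullback {EB' B' : Type*} [NormedAddCommGroup EB'] [NormedSpace ℝ EB']
    [TopologicalSpace B'] [ChartedSpace EB' B'] [∀ x, Zero (V x)]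
    (f : C^∞⟮𝓘(ℝ, EB'), B'; 𝓘(ℝ, EB), B⟯)
    (s : ∀ x, ((f : B' → B) *ᵖ V) x) (U : Set B') :
    SmoothSectionOn EB' F s U ↔ ContMDiffOn 𝓘(ℝ, EB') (𝓘(ℝ, EB).prod 𝓘(ℝ, F)) ∞
      (fun x => (⟨f x, s x⟩ : TotalSpace F V)) U := by
  refine forall₂_congr fun x hx => ?_
  rw [contMDiffWithinAt_totalSpace, contMDiffWithinAt_totalSpace]
  -- The trivializations of the pullback are those of `V` read at `f x`, so the fibre conditions
  -- coincide; the base conditions hold on both sides because `f` is smooth.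
  refine and_congr ?_ Iff.rfl
  exact ⟨fun _ => (f.contMDiff x).contMDiffWithinAt, fun _ => contMDiffWithinAt_id⟩

theorem smoothSectionOn_prod {F' : Type*} [NormedAddCommGroup F'] [NormedSpace ℝ F']
    {V' : B → Type*} [TopologicalSpace (TotalSpace F' V')] [∀ x, TopologicalSpace (V' x)]
    [FiberBundle F' V'] [∀ x, Zero (V x)] [∀ x, Zero (V' x)] (s : ∀ x, (V ×ᵇ V') x) (U : Set B) :
    SmoothSectionOn EB (F × F') s U ↔
      SmoothSectionOn EB F (fun x => (s x).1) U ∧ SmoothSectionOn EB F' (fun x => (s x).2) U := by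
  refine (forall₂_congr fun x hx => ?_).trans forall₂_and
  rw [contMDiffWithinAt_section, contMDiffWithinAt_section, contMDiffWithinAt_section]
  exact contMDiffWithinAt_prod_module_iff _

end SectionsOfConstructions

section TangentMaps

open Filter Set
open scoped Topology

variable {E E' N N' EB B : Type*} [NormedAddCommGroup E] [NormedSpace ℝ E]
  [NormedAddCommGroup E'] [NormedSpace ℝ E'] [NormedAddCommGroup EB] [NormedSpace ℝ EB]
  [TopologicalSpace N] [ChartedSpace E N] [TopologicalSpace N'] [ChartedSpace E' N']
  [TopologicalSpace B] [ChartedSpace EB B]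
  [IsManifold 𝓘(ℝ, E) ∞ N] [IsManifold 𝓘(ℝ, E') ∞ N']

/-- A smooth map on an open set maps smooth families of tangent vectors to such families. -/
theorem ContMDiffOn.tangentMap_comp {H P : Type*} [TopologicalSpace H] {I : ModelWithCorners ℝ E H}
    [TopologicalSpace P] [ChartedSpace H P] [IsManifold I ∞ P] {f : P → N'} {O : Set P}
    (hO : IsOpen O) (hf : ContMDiffOn I 𝓘(ℝ, E') ∞ f O) {ξ : B → TangentBundle I P} {U : Set B}
    (hξ : ContMDiffOn 𝓘(ℝ, EB) I.tangent ∞ ξ U) (hU : ∀ b ∈ U, (ξ b).1 ∈ O) :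
    ContMDiffOn 𝓘(ℝ, EB) 𝓘(ℝ, E').tangent ∞ (fun b => tangentMap I 𝓘(ℝ, E') f (ξ b)) U := by
  have h1 := hf.contMDiffOn_tangentMapWithin (m := ∞) (by simp) hO.uniqueMDiffOn
  refine (h1.comp hξ hU).congr fun b hb => ?_
  simp only [Function.comp_apply, tangentMapWithin, tangentMap]
  rw [mfderivWithin_of_isOpen hO (hU b hb)]

/-- Pairs of smooth families of tangent vectors. -/
theorem ContMDiffOn.tangent_prodMk {ξ : B → TangentBundle 𝓘(ℝ, E) N}
    {ξ' : B → TangentBundle 𝓘(ℝ, E') N'} {U : Set B}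
    (hξ : ContMDiffOn 𝓘(ℝ, EB) 𝓘(ℝ, E).tangent ∞ ξ U)
    (hξ' : ContMDiffOn 𝓘(ℝ, EB) 𝓘(ℝ, E').tangent ∞ ξ' U) :
    ContMDiffOn 𝓘(ℝ, EB) (𝓘(ℝ, E).prod 𝓘(ℝ, E')).tangent ∞
      (fun b => (⟨((ξ b).1, (ξ' b).1), ((ξ b).2, (ξ' b).2)⟩ :
        TangentBundle (𝓘(ℝ, E).prod 𝓘(ℝ, E')) (N × N'))) U := by
  have : IsManifold 𝓘(ℝ, E) 1 N := .of_le (n := ∞) (by simp)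
  have : IsManifold 𝓘(ℝ, E') 1 N' := .of_le (n := ∞) (by simp)
  exact contMDiff_equivTangentBundleProd_symm.comp_contMDiffOn (hξ.prodMk hξ')

/-- Smooth families of tangent vectors of a vector space. -/
theorem contMDiffOn_tangent_vectorSpace {c : B → E} {w : B → E} {U : Set B}
    (hc : ContMDiffOn 𝓘(ℝ, EB) 𝓘(ℝ, E) ∞ c U) (hw : ContMDiffOn 𝓘(ℝ, EB) 𝓘(ℝ, E) ∞ w U) :
    ContMDiffOn 𝓘(ℝ, EB) 𝓘(ℝ, E).tangent ∞
      (fun b => (⟨c b, w b⟩ : TangentBundle 𝓘(ℝ, E) E)) U := by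
  intro b hb
  rw [contMDiffWithinAt_totalSpace]
  refine ⟨hc b hb, ?_⟩
  simp only [TangentBundle.trivializationAt_apply, fderivWithin_univ, modelWithCornersSelf_coe,
    range_id, mfld_simps]
  refine (hw b hb).congr (fun y _ => ?_) ?_ <;> · change fderiv ℝ id _ _ = _; simp

end TangentMaps

/-! ### Differential calculus along the fibres of a submersion. -/

section FibreCalculus

open Filter Set
open scoped Topology

theorem eventually_fibre_mem_target {N N' C : Type*} [TopologicalSpace N] [TopologicalSpace N']
    [TopologicalSpace C] (e : OpenPartialHomeomorph N (N' × C)) {x : N'} {z : C}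
    (hz : (x, z) ∈ e.target) : ∀ᶠ z' in 𝓝 z, (x, z') ∈ e.target := by
  have h : Continuous fun z' : C => (x, z') := by fun_prop
  exact h.continuousAt.eventually (e.open_target.mem_nhds hz)

variable {E E' E'' N N' N'' : Type*} [NormedAddCommGroup E] [NormedSpace ℝ E]
  [NormedAddCommGroup E'] [NormedSpace ℝ E'] [NormedAddCommGroup E''] [NormedSpace ℝ E'']
  [TopologicalSpace N] [ChartedSpace E N] [TopologicalSpace N'] [ChartedSpace E' N']
  [TopologicalSpace N''] [ChartedSpace E'' N'']
  {f : N → N'} {e : OpenPartialHomeomorph N (N' × FibreModel E E')}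

namespace IsSubmersionChart

theorem apply_eq (he : IsSubmersionChart f e) {y : N} (hy : y ∈ e.source) :
    e y = (f y, (e y).2) :=
  Prod.ext (he.fst_eq y hy) rfl

theorem apply_symm (he : IsSubmersionChart f e) {z : N' × FibreModel E E'} (hz : z ∈ e.target) :
    f (e.symm z) = z.1 := by
  rw [← he.fst_eq _ (e.map_target hz), e.right_inv hz]

theorem mem_target (he : IsSubmersionChart f e) {y : N} (hy : y ∈ e.source) :
    (f y, (e y).2) ∈ e.target := by
  rw [← he.apply_eq hy]; exact e.map_source hy

theorem symm_apply (he : IsSubmersionChart f e) {y : N} (hy : y ∈ e.source) :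
    e.symm (f y, (e y).2) = y := by
  rw [← he.apply_eq hy, e.left_inv hy]

theorem contMDiffOn_snd (he : IsSubmersionChart f e) :
    ContMDiffOn 𝓘(ℝ, E) 𝓘(ℝ, FibreModel E E') ∞ (fun y => (e y).2) e.source :=
  contMDiff_snd.comp_contMDiffOn he.contMDiffOn

theorem contMDiffAt_snd (he : IsSubmersionChart f e) {y : N} (hy : y ∈ e.source) :
    ContMDiffAt 𝓘(ℝ, E) 𝓘(ℝ, FibreModel E E') ∞ (fun y => (e y).2) y :=
  he.contMDiffOn_snd.contMDiffAt (e.open_source.mem_nhds hy)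

theorem contMDiffAt_symm (he : IsSubmersionChart f e) {z : N' × FibreModel E E'}
    (hz : z ∈ e.target) :
    ContMDiffAt (𝓘(ℝ, E').prod 𝓘(ℝ, FibreModel E E')) 𝓘(ℝ, E) ∞ e.symm z :=
  he.contMDiffOn_symm.contMDiffAt (e.open_target.mem_nhds hz)

/-- The parametrization of the fibre over `x` is smooth. -/
theorem contMDiffAt_fibre (he : IsSubmersionChart f e) {x : N'} {z : FibreModel E E'}
    (hz : (x, z) ∈ e.target) :
    ContMDiffAt 𝓘(ℝ, FibreModel E E') 𝓘(ℝ, E) ∞ (fun z => e.symm (x, z)) z :=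
  (he.contMDiffAt_symm hz).comp z (contMDiffAt_const.prodMk contMDiffAt_id)

/-- A vertical vector is the image of its fibre component under the parametrization of the
fibre. -/
theorem mfderiv_fibre_apply (he : IsSubmersionChart f e) (hf : ContMDiff 𝓘(ℝ, E) 𝓘(ℝ, E') ∞ f)
    {p : N} (hp : p ∈ e.source) {x : N'} (hx : f p = x)
    {v : TangentSpace 𝓘(ℝ, E) p} (hv : mfderiv 𝓘(ℝ, E) 𝓘(ℝ, E') f p v = 0) :
    mfderiv 𝓘(ℝ, FibreModel E E') 𝓘(ℝ, E) (fun z => e.symm (x, z)) (e p).2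
      (mfderiv 𝓘(ℝ, E) 𝓘(ℝ, FibreModel E E') (fun y => (e y).2) p v) = v := by
  subst hx
  have h1 : HasMFDerivAt (𝓘(ℝ, E').prod 𝓘(ℝ, FibreModel E E')) 𝓘(ℝ, E) e.symm (f p, (e p).2) _ :=
    ((he.contMDiffAt_symm (he.mem_target hp)).mdifferentiableAt (by simp)).hasMFDerivAt
  have h2 := ((hf p).mdifferentiableAt (by simp)).hasMFDerivAt
  have h3 := ((he.contMDiffAt_snd hp).mdifferentiableAt (by simp)).hasMFDerivAt
  -- Differentiating `e.symm (f y, (e y).2) = y` in the direction `v` leaves only the fibre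
  -- component, because `v` is vertical.
  have h4 := (HasMFDerivAt.comp p h1 (h2.prodMk h3)).mfderiv
  have h5 : (e.symm ∘ fun y => (f y, (e y).2)) =ᶠ[𝓝 p] id := by
    filter_upwards [e.open_source.mem_nhds hp] with y hy
    exact he.symm_apply hy
  rw [h5.mfderiv_eq, mfderiv_id] at h4
  have h6 := DFunLike.congr_fun h4 v
  have h7 : HasMFDerivAt 𝓘(ℝ, FibreModel E E') (𝓘(ℝ, E').prod 𝓘(ℝ, FibreModel E E'))
      (fun z : FibreModel E E' => (f p, z)) (e p).2 _ :=
    (hasMFDerivAt_const (f p) (e p).2).prodMk (hasMFDerivAt_id (e p).2)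
  have h8 := (HasMFDerivAt.comp (e p).2 h1 h7).mfderiv
  have h9 := DFunLike.congr_fun h8
    (mfderiv 𝓘(ℝ, E) 𝓘(ℝ, FibreModel E E') (fun y => (e y).2) p v)
  refine h9.trans (Eq.trans ?_ h6.symm)
  change mfderiv (𝓘(ℝ, E').prod 𝓘(ℝ, FibreModel E E')) 𝓘(ℝ, E) e.symm (f p, (e p).2)
    ((0 : E'), _) = mfderiv (𝓘(ℝ, E').prod 𝓘(ℝ, FibreModel E E')) 𝓘(ℝ, E) e.symm (f p, (e p).2)
    (mfderiv 𝓘(ℝ, E) 𝓘(ℝ, E') f p v, _)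
  rw [hv]
  rfl

/-- A derivative within a fibre is determined on vertical vectors. -/
theorem hasMFDerivWithinAt_apply (he : IsSubmersionChart f e) (hf : ContMDiff 𝓘(ℝ, E) 𝓘(ℝ, E') ∞ f)
    {p : N} (hp : p ∈ e.source) {x : N'} (hx : f p = x)
    {φ : N → N''} {D : TangentSpace 𝓘(ℝ, E) p →L[ℝ] TangentSpace 𝓘(ℝ, E'') (φ p)}
    (hD : HasMFDerivWithinAt 𝓘(ℝ, E) 𝓘(ℝ, E'') φ {y | f y = x} p D)
    {v : TangentSpace 𝓘(ℝ, E) p} (hv : mfderiv 𝓘(ℝ, E) 𝓘(ℝ, E') f p v = 0) :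
    D v = mfderiv 𝓘(ℝ, FibreModel E E') 𝓘(ℝ, E'') (fun z => φ (e.symm (x, z))) (e p).2
      (mfderiv 𝓘(ℝ, E) 𝓘(ℝ, FibreModel E E') (fun y => (e y).2) p v) := by
  have hmem : (x, (e p).2) ∈ e.target := hx ▸ he.mem_target hp
  have hcp : e.symm (x, (e p).2) = p := hx ▸ he.symm_apply hp
  have h1 := ((he.contMDiffAt_fibre hmem).mdifferentiableAt (by simp)).hasMFDerivAt
  -- The parametrization of the fibre passes through `e.symm (x, (e p).2)`, which equals `p` but not
  -- definitionally. Stating the derivative for every `y = p` moves it to this base point while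
  -- keeping the same linear map.
  have h2 : ∀ y, y = p → HasMFDerivWithinAt 𝓘(ℝ, E) 𝓘(ℝ, E'') φ {y | f y = x} y
      (show TangentSpace 𝓘(ℝ, E) y →L[ℝ] TangentSpace 𝓘(ℝ, E'') (φ y) from D) := by
    rintro y rfl; exact hD
  have h3 := HasMFDerivWithinAt.comp (u := {y | f y = x}) (s := {z | (x, z) ∈ e.target}) (e p).2
    (h2 _ hcp) h1.hasMFDerivWithinAt (fun z hz => he.apply_symm hz)
  have h4 := (h3.hasMFDerivAt (eventually_fibre_mem_target e hmem)).mfderiv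
  have h5 := DFunLike.congr_fun h4
    (mfderiv 𝓘(ℝ, E) 𝓘(ℝ, FibreModel E E') (fun y => (e y).2) p v)
  refine (h5.trans ?_).symm
  exact congrArg D (he.mfderiv_fibre_apply hf hp hx hv)

/-- Holding the fibre coordinate of `p` fixed gives the local section `x ↦ e.symm (x, (e p).2)` of
`f` through `p`. -/
theorem mfderiv_surjective (he : IsSubmersionChart f e) (hf : ContMDiff 𝓘(ℝ, E) 𝓘(ℝ, E') ∞ f)
    {p : N} (hp : p ∈ e.source) :
    Function.Surjective (mfderiv 𝓘(ℝ, E) 𝓘(ℝ, E') f p) := by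
  intro w
  have hmem := he.mem_target hp
  have h1 : HasMFDerivAt 𝓘(ℝ, E') 𝓘(ℝ, E) (fun x => e.symm (x, (e p).2)) (f p) _ :=
    (((he.contMDiffAt_symm hmem).comp (f p)
      (contMDiffAt_id.prodMk contMDiffAt_const)).mdifferentiableAt (by simp)).hasMFDerivAt
  have h2 : ∀ y, y = p → HasMFDerivAt 𝓘(ℝ, E) 𝓘(ℝ, E') f y
      (show TangentSpace 𝓘(ℝ, E) y →L[ℝ] TangentSpace 𝓘(ℝ, E') (f y) from
        mfderiv 𝓘(ℝ, E) 𝓘(ℝ, E') f p) := by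
    rintro y rfl; exact ((hf y).mdifferentiableAt (by simp)).hasMFDerivAt
  have h3 := (HasMFDerivAt.comp (f p) (h2 _ (he.symm_apply hp)) h1).mfderiv
  have h4 : (f ∘ fun x => e.symm (x, (e p).2)) =ᶠ[𝓝 (f p)] id := by
    have hc : Continuous fun x : N' => (x, (e p).2) := by fun_prop
    filter_upwards [hc.continuousAt.eventually (e.open_target.mem_nhds hmem)] with x hx
    exact he.apply_symm hx
  rw [h4.mfderiv_eq, mfderiv_id] at h3
  exact ⟨_, (DFunLike.congr_fun h3 w).symm⟩

end IsSubmersionChart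

variable [FiniteDimensional ℝ E] [FiniteDimensional ℝ E']

theorem exists_chart_of_isSubmersionAt {p : N} (h : IsSubmersionAt 𝓘(ℝ, E) 𝓘(ℝ, E') ∞ f p) :
    ∃ e : OpenPartialHomeomorph N (N' × FibreModel E E'), p ∈ e.source ∧ IsSubmersionChart f e :=
  (exists_isSubmersionChart h).2

/-- Two derivatives within a fibre of a submersion agree on vertical vectors. -/
theorem hasMFDerivWithinAt_fibre_unique {p : N}
    (h : IsSubmersionAt 𝓘(ℝ, E) 𝓘(ℝ, E') ∞ f p)
    (hf : ContMDiff 𝓘(ℝ, E) 𝓘(ℝ, E') ∞ f) {x : N'} (hx : f p = x) {φ : N → N''}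
    {D D' : TangentSpace 𝓘(ℝ, E) p →L[ℝ] TangentSpace 𝓘(ℝ, E'') (φ p)}
    (hD : HasMFDerivWithinAt 𝓘(ℝ, E) 𝓘(ℝ, E'') φ {y | f y = x} p D)
    (hD' : HasMFDerivWithinAt 𝓘(ℝ, E) 𝓘(ℝ, E'') φ {y | f y = x} p D')
    {v : TangentSpace 𝓘(ℝ, E) p} (hv : mfderiv 𝓘(ℝ, E) 𝓘(ℝ, E') f p v = 0) : D v = D' v := by
  obtain ⟨e, hp, he⟩ := exists_chart_of_isSubmersionAt h
  rw [he.hasMFDerivWithinAt_apply hf hp hx hD hv, he.hasMFDerivWithinAt_apply hf hp hx hD' hv]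

end FibreCalculus

section ParametrizedDerivative

open Filter Set
open scoped Topology

variable {E C EB N B : Type*} [NormedAddCommGroup E] [NormedSpace ℝ E]
  [NormedAddCommGroup C] [NormedSpace ℝ C] [NormedAddCommGroup EB] [NormedSpace ℝ EB]
  [TopologicalSpace N] [ChartedSpace E N] [TopologicalSpace B] [ChartedSpace EB B]

theorem ContMDiffOn.snd_tangent_vectorSpace {ξ : B → TangentBundle 𝓘(ℝ, E) E} {U : Set B}
    (hξ : ContMDiffOn 𝓘(ℝ, EB) 𝓘(ℝ, E).tangent ∞ ξ U) :
    ContMDiffOn 𝓘(ℝ, EB) 𝓘(ℝ, E) ∞ (fun b => (show E from (ξ b).2)) U :=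
  (contMDiff_snd_tangentBundle_modelSpace E 𝓘(ℝ, E)).comp_contMDiffOn hξ

theorem mfderiv_comp_prodMk_right {μ : B × C → N} {b : B} {z : C}
    (hμ : MDifferentiableAt (𝓘(ℝ, EB).prod 𝓘(ℝ, C)) 𝓘(ℝ, E) μ (b, z)) (w : C) :
    mfderiv 𝓘(ℝ, C) 𝓘(ℝ, E) (fun c => μ (b, c)) z w =
      mfderiv (𝓘(ℝ, EB).prod 𝓘(ℝ, C)) 𝓘(ℝ, E) μ (b, z) ((0 : EB), w) := by
  have h7 : HasMFDerivAt 𝓘(ℝ, C) (𝓘(ℝ, EB).prod 𝓘(ℝ, C)) (fun z : C => (b, z)) z _ :=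
    (hasMFDerivAt_const b z).prodMk (hasMFDerivAt_id z)
  exact DFunLike.congr_fun (HasMFDerivAt.comp z hμ.hasMFDerivAt h7).mfderiv w

variable [IsManifold 𝓘(ℝ, E) ∞ N] [IsManifold 𝓘(ℝ, EB) ∞ B]

/-- Partial derivatives of a smooth map in the direction of a vector space form a smooth family of
tangent vectors. -/
theorem ContMDiffOn.partial_mfderiv {μ : B × C → N} {O : Set (B × C)} (hO : IsOpen O)
    (hμ : ContMDiffOn (𝓘(ℝ, EB).prod 𝓘(ℝ, C)) 𝓘(ℝ, E) ∞ μ O) {z w : B → C} {U : Set B}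
    (hz : ContMDiffOn 𝓘(ℝ, EB) 𝓘(ℝ, C) ∞ z U) (hw : ContMDiffOn 𝓘(ℝ, EB) 𝓘(ℝ, C) ∞ w U)
    (hU : ∀ b ∈ U, (b, z b) ∈ O) :
    ContMDiffOn 𝓘(ℝ, EB) 𝓘(ℝ, E).tangent ∞ (fun b => (⟨μ (b, z b),
      mfderiv 𝓘(ℝ, C) 𝓘(ℝ, E) (fun c => μ (b, c)) (z b) (w b)⟩ : TangentBundle 𝓘(ℝ, E) N)) U := by
  -- The partial derivative in the direction `w` is the full derivative of `μ` on the vector `(0,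
  -- w)`, so the zero section of `TB` is paired with the family `(z, w)`.
  have h0 : ContMDiffOn 𝓘(ℝ, EB) 𝓘(ℝ, EB).tangent ∞
      (fun b => (⟨b, 0⟩ : TangentBundle 𝓘(ℝ, EB) B)) U :=
    (contMDiff_zeroSection ℝ (TangentSpace 𝓘(ℝ, EB) : B → Type _)).contMDiffOn
  have h1 := h0.tangent_prodMk (contMDiffOn_tangent_vectorSpace hz hw)
  refine (hμ.tangentMap_comp hO h1 hU).congr fun b hb => ?_
  simp only [tangentMap]
  rw [mfderiv_comp_prodMk_right ((hμ.contMDiffAt (hO.mem_nhds (hU b hb))).mdifferentiableAt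
    (by simp))]
  rfl

end ParametrizedDerivative

section FibreVectors

open Filter Set
open scoped Topology

variable {E E' N N' : Type*} [NormedAddCommGroup E] [NormedSpace ℝ E]
  [NormedAddCommGroup E'] [NormedSpace ℝ E']
  [TopologicalSpace N] [ChartedSpace E N] [TopologicalSpace N'] [ChartedSpace E' N']
  {f : N → N'} {e : OpenPartialHomeomorph N (N' × FibreModel E E')}

namespace IsSubmersionChart

/-- The fibre coordinate of a point on the parametrized fibre is its parameter. With
`mfderiv_fibre_apply` this identifies the vertical vectors at `p` with `FibreModel`. -/
theorem mfderiv_snd_fibre_apply (he : IsSubmersionChart f e) {p : N} (hp : p ∈ e.source) {x : N'}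
    (hx : f p = x) (w : FibreModel E E') :
    mfderiv 𝓘(ℝ, E) 𝓘(ℝ, FibreModel E E') (fun y => (e y).2) p
      (mfderiv 𝓘(ℝ, FibreModel E E') 𝓘(ℝ, E) (fun z => e.symm (x, z)) (e p).2 w) = w := by
  subst hx
  have hmem := he.mem_target hp
  have h1 := ((he.contMDiffAt_fibre hmem).mdifferentiableAt (by simp)).hasMFDerivAt
  have h2 : ∀ y, y = p → HasMFDerivAt 𝓘(ℝ, E) 𝓘(ℝ, FibreModel E E') (fun y => (e y).2) y
      (show TangentSpace 𝓘(ℝ, E) y →L[ℝ] TangentSpace 𝓘(ℝ, FibreModel E E') (e y).2 from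
        mfderiv 𝓘(ℝ, E) 𝓘(ℝ, FibreModel E E') (fun y => (e y).2) p) := by
    rintro y rfl; exact ((he.contMDiffAt_snd hp).mdifferentiableAt (by simp)).hasMFDerivAt
  have h3 := (HasMFDerivAt.comp (e p).2 (h2 _ (he.symm_apply hp)) h1).mfderiv
  have h4 : ((fun y => (e y).2) ∘ fun z => e.symm (f p, z)) =ᶠ[𝓝 (e p).2] id := by
    filter_upwards [eventually_fibre_mem_target e hmem] with z hz
    simp [e.right_inv hz]
  rw [h4.mfderiv_eq, mfderiv_id] at h3
  exact (DFunLike.congr_fun h3 w).symm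

theorem mfderiv_apply_fibre (he : IsSubmersionChart f e) (hf : ContMDiff 𝓘(ℝ, E) 𝓘(ℝ, E') ∞ f)
    {p : N} (hp : p ∈ e.source) {x : N'} (hx : f p = x) (w : FibreModel E E') :
    mfderiv 𝓘(ℝ, E) 𝓘(ℝ, E') f p
      (mfderiv 𝓘(ℝ, FibreModel E E') 𝓘(ℝ, E) (fun z => e.symm (x, z)) (e p).2 w) = 0 := by
  subst hx
  have hmem := he.mem_target hp
  have h1 := ((he.contMDiffAt_fibre hmem).mdifferentiableAt (by simp)).hasMFDerivAt
  have h2 : ∀ y, y = p → HasMFDerivAt 𝓘(ℝ, E) 𝓘(ℝ, E') f y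
      (show TangentSpace 𝓘(ℝ, E) y →L[ℝ] TangentSpace 𝓘(ℝ, E') (f y) from
        mfderiv 𝓘(ℝ, E) 𝓘(ℝ, E') f p) := by
    rintro y rfl; exact ((hf y).mdifferentiableAt (by simp)).hasMFDerivAt
  have h3 := (HasMFDerivAt.comp (e p).2 (h2 _ (he.symm_apply hp)) h1).mfderiv
  have h4 : (f ∘ fun z => e.symm (f p, z)) =ᶠ[𝓝 (e p).2] fun _ => f p := by
    filter_upwards [eventually_fibre_mem_target e hmem] with z hz
    exact he.apply_symm hz
  rw [h4.mfderiv_eq, mfderiv_const] at h3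
  exact (DFunLike.congr_fun h3 w).symm

end IsSubmersionChart

end FibreVectors

theorem two_le_smooth : (2 : WithTop ℕ∞) ≤ ∞ := by
  exact WithTop.coe_le_coe.2 (le_top : (2 : ℕ∞) ≤ ⊤)

/-! ### Brackets of vertical fields along maps of a fibre. -/

section FibreBrackets

open Filter Set VectorField
open scoped Topology

variable {E E' E'' N N' N'' : Type*} [NormedAddCommGroup E] [NormedSpace ℝ E]
  [NormedAddCommGroup E'] [NormedSpace ℝ E'] [NormedAddCommGroup E''] [NormedSpace ℝ E'']
  [TopologicalSpace N] [ChartedSpace E N] [TopologicalSpace N'] [ChartedSpace E' N']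
  [TopologicalSpace N''] [ChartedSpace E'' N'']
  {f : N → N'} {e : OpenPartialHomeomorph N (N' × FibreModel E E')}

namespace IsSubmersionChart

/-- The vector field in the fibre coordinates which is induced by a vertical vector field. -/
noncomputable def fibreField (e : OpenPartialHomeomorph N (N' × FibreModel E E'))
    (V : ∀ y : N, TangentSpace 𝓘(ℝ, E) y) (x : N') (z : FibreModel E E') : FibreModel E E' :=
  mfderiv 𝓘(ℝ, E) 𝓘(ℝ, FibreModel E E') (fun y => (e y).2) (e.symm (x, z)) (V (e.symm (x, z)))

theorem contMDiffOn_fibreField [IsManifold 𝓘(ℝ, E) ∞ N] (he : IsSubmersionChart f e)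
    {V : ∀ y : N, TangentSpace 𝓘(ℝ, E) y}
    (hV : ContMDiff 𝓘(ℝ, E) 𝓘(ℝ, E).tangent ∞ (fun y => (⟨y, V y⟩ : TangentBundle 𝓘(ℝ, E) N)))
    (x : N') : ContMDiffOn 𝓘(ℝ, FibreModel E E') 𝓘(ℝ, FibreModel E E') ∞ (fibreField e V x)
      {z | (x, z) ∈ e.target} := by
  have h1 : ContMDiffOn 𝓘(ℝ, FibreModel E E') 𝓘(ℝ, E).tangent ∞
      (fun z => (⟨e.symm (x, z), V (e.symm (x, z))⟩ : TangentBundle 𝓘(ℝ, E) N))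
      {z | (x, z) ∈ e.target} :=
    hV.comp_contMDiffOn fun z hz => (he.contMDiffAt_fibre hz).contMDiffWithinAt
  exact (he.contMDiffOn_snd.tangentMap_comp e.open_source h1 fun z hz =>
    e.map_target hz).snd_tangent_vectorSpace

theorem mdifferentiableAt_fibreField [IsManifold 𝓘(ℝ, E) ∞ N] (he : IsSubmersionChart f e)
    {V : ∀ y : N, TangentSpace 𝓘(ℝ, E) y}
    (hV : ContMDiff 𝓘(ℝ, E) 𝓘(ℝ, E).tangent ∞ (fun y => (⟨y, V y⟩ : TangentBundle 𝓘(ℝ, E) N)))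
    {x : N'} {z : FibreModel E E'} (hz : (x, z) ∈ e.target) :
    MDifferentiableAt 𝓘(ℝ, FibreModel E E') 𝓘(ℝ, FibreModel E E').tangent
      (fun z => (⟨z, fibreField e V x z⟩ : TangentBundle 𝓘(ℝ, FibreModel E E') (FibreModel E E'))) z := by
  have h0 : ContMDiffOn 𝓘(ℝ, FibreModel E E') 𝓘(ℝ, FibreModel E E') ∞
      (fun z : FibreModel E E' => z) {z | (x, z) ∈ e.target} := contMDiffOn_id
  have h1 := contMDiffOn_tangent_vectorSpace h0 (he.contMDiffOn_fibreField hV x)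
  exact (h1.contMDiffAt (eventually_fibre_mem_target e hz)).mdifferentiableAt (by simp)

/-- The field in the fibre coordinates is related to the vertical field by every map of the
fibre. -/
theorem mfderiv_fibreField (he : IsSubmersionChart f e) (hf : ContMDiff 𝓘(ℝ, E) 𝓘(ℝ, E') ∞ f)
    {V : ∀ y : N, TangentSpace 𝓘(ℝ, E) y} (hV : ∀ y, mfderiv 𝓘(ℝ, E) 𝓘(ℝ, E') f y (V y) = 0)
    {x : N'} {z : FibreModel E E'} (hz : (x, z) ∈ e.target) {φ : N → N''}
    (hφ : MDifferentiableWithinAt 𝓘(ℝ, E) 𝓘(ℝ, E'') φ {y | f y = x} (e.symm (x, z))) :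
    mfderiv 𝓘(ℝ, FibreModel E E') 𝓘(ℝ, E'') (fun z => φ (e.symm (x, z))) z (fibreField e V x z) =
      mfderivWithin 𝓘(ℝ, E) 𝓘(ℝ, E'') φ {y | f y = x} (e.symm (x, z)) (V (e.symm (x, z))) := by
  have h1 := he.hasMFDerivWithinAt_apply hf (e.map_target hz) (he.apply_symm hz)
    hφ.hasMFDerivWithinAt (hV _)
  have h2 : (e (e.symm (x, z))).2 = z := by rw [e.right_inv hz]
  rw [h1, fibreField]
  exact congrArg (fun a => (show FibreModel E E' →L[ℝ] E'' from
    mfderiv 𝓘(ℝ, FibreModel E E') 𝓘(ℝ, E'') (fun z => φ (e.symm (x, z))) a) _) h2.symm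

/-- The case in which the map of the fibre is its inclusion: the coordinate field is related to the
vertical field on the total space. -/
theorem mfderiv_fibreField_id (he : IsSubmersionChart f e) (hf : ContMDiff 𝓘(ℝ, E) 𝓘(ℝ, E') ∞ f)
    {V : ∀ y : N, TangentSpace 𝓘(ℝ, E) y} (hV : ∀ y, mfderiv 𝓘(ℝ, E) 𝓘(ℝ, E') f y (V y) = 0)
    {x : N'} {z : FibreModel E E'} (hz : (x, z) ∈ e.target) :
    mfderiv 𝓘(ℝ, FibreModel E E') 𝓘(ℝ, E) (fun z => e.symm (x, z)) z (fibreField e V x z) =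
      V (e.symm (x, z)) := by
  have h1 := he.mfderiv_fibre_apply hf (e.map_target hz) (he.apply_symm hz) (hV (e.symm (x, z)))
  have h2 : (e (e.symm (x, z))).2 = z := by rw [e.right_inv hz]
  refine Eq.trans ?_ h1
  exact congrArg (fun a => (show FibreModel E E' →L[ℝ] E from
    mfderiv 𝓘(ℝ, FibreModel E E') 𝓘(ℝ, E) (fun z => e.symm (x, z)) a) (fibreField e V x z)) h2.symm

end IsSubmersionChart

/-- A field is vertical exactly when `f` relates it to the zero field, and the bracket of zero with
zero is zero. -/
theorem mfderiv_mlieBracket_eq_zero [CompleteSpace E] [CompleteSpace E'] [IsManifold 𝓘(ℝ, E) ∞ N]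
    [IsManifold 𝓘(ℝ, E') ∞ N'] (hf : ContMDiff 𝓘(ℝ, E) 𝓘(ℝ, E') ∞ f)
    {V W : ∀ y : N, TangentSpace 𝓘(ℝ, E) y}
    (hV : ContMDiff 𝓘(ℝ, E) 𝓘(ℝ, E).tangent ∞ (fun y => (⟨y, V y⟩ : TangentBundle 𝓘(ℝ, E) N)))
    (hW : ContMDiff 𝓘(ℝ, E) 𝓘(ℝ, E).tangent ∞ (fun y => (⟨y, W y⟩ : TangentBundle 𝓘(ℝ, E) N)))
    (hV0 : ∀ y, mfderiv 𝓘(ℝ, E) 𝓘(ℝ, E') f y (V y) = 0)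
    (hW0 : ∀ y, mfderiv 𝓘(ℝ, E) 𝓘(ℝ, E') f y (W y) = 0) (y : N) :
    mfderiv 𝓘(ℝ, E) 𝓘(ℝ, E') f y (mlieBracket 𝓘(ℝ, E) V W y) = 0 := by
  have : IsManifold 𝓘(ℝ, E) 2 N := .of_le (n := ∞) two_le_smooth
  have : IsManifold 𝓘(ℝ, E') 2 N' := .of_le (n := ∞) two_le_smooth
  have h0 : MDifferentiableAt 𝓘(ℝ, E') 𝓘(ℝ, E').tangent
      (fun y => (⟨y, (0 : ∀ y : N', TangentSpace 𝓘(ℝ, E') y) y⟩ : TangentBundle _ N')) (f y) :=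
    (contMDiff_zeroSection ℝ (TangentSpace 𝓘(ℝ, E') : N' → Type _) (n := ∞)
      (f y)).mdifferentiableAt (by simp)
  have h1 := mfderiv_mlieBracket_of_related (V' := 0) (W' := 0) ((hf y).of_le two_le_smooth)
    ((hV y).mdifferentiableAt (by simp)) ((hW y).mdifferentiableAt (by simp)) h0 h0
    (Eventually.of_forall hV0) (Eventually.of_forall hW0)
  rw [h1, mlieBracket_zero_left]
  rfl

variable [FiniteDimensional ℝ E] [FiniteDimensional ℝ E'] [CompleteSpace E'']
  [IsManifold 𝓘(ℝ, E) ∞ N] [IsManifold 𝓘(ℝ, E') ∞ N'] [IsManifold 𝓘(ℝ, E'') ∞ N'']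

/-- Vertical vector fields which are related to vector fields by a map of a fibre have related Lie
brackets. -/
theorem mfderivWithin_fibre_mlieBracket {p : N} (h : IsSubmersionAt 𝓘(ℝ, E) 𝓘(ℝ, E') ∞ f p)
    (hf : ContMDiff 𝓘(ℝ, E) 𝓘(ℝ, E') ∞ f) {x : N'} (hx : f p = x) {φ : N → N''}
    (hφ : ContMDiffOn 𝓘(ℝ, E) 𝓘(ℝ, E'') ∞ φ {y | f y = x})
    {V W : ∀ y : N, TangentSpace 𝓘(ℝ, E) y} {V' W' : ∀ y : N'', TangentSpace 𝓘(ℝ, E'') y}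
    (hV : ContMDiff 𝓘(ℝ, E) 𝓘(ℝ, E).tangent ∞ (fun y => (⟨y, V y⟩ : TangentBundle 𝓘(ℝ, E) N)))
    (hW : ContMDiff 𝓘(ℝ, E) 𝓘(ℝ, E).tangent ∞ (fun y => (⟨y, W y⟩ : TangentBundle 𝓘(ℝ, E) N)))
    (hV' : ContMDiff 𝓘(ℝ, E'') 𝓘(ℝ, E'').tangent ∞
      (fun y => (⟨y, V' y⟩ : TangentBundle 𝓘(ℝ, E'') N'')))
    (hW' : ContMDiff 𝓘(ℝ, E'') 𝓘(ℝ, E'').tangent ∞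
      (fun y => (⟨y, W' y⟩ : TangentBundle 𝓘(ℝ, E'') N'')))
    (hV0 : ∀ y, mfderiv 𝓘(ℝ, E) 𝓘(ℝ, E') f y (V y) = 0)
    (hW0 : ∀ y, mfderiv 𝓘(ℝ, E) 𝓘(ℝ, E') f y (W y) = 0)
    (hVV' : ∀ y, f y = x → mfderivWithin 𝓘(ℝ, E) 𝓘(ℝ, E'') φ {y | f y = x} y (V y) = V' (φ y))
    (hWW' : ∀ y, f y = x → mfderivWithin 𝓘(ℝ, E) 𝓘(ℝ, E'') φ {y | f y = x} y (W y) = W' (φ y)) :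
    mfderivWithin 𝓘(ℝ, E) 𝓘(ℝ, E'') φ {y | f y = x} p (mlieBracket 𝓘(ℝ, E) V W p) =
      mlieBracket 𝓘(ℝ, E'') V' W' (φ p) := by
  have : CompleteSpace E := FiniteDimensional.complete ℝ E
  have : CompleteSpace E' := FiniteDimensional.complete ℝ E'
  have : IsManifold 𝓘(ℝ, E) 2 N := .of_le (n := ∞) two_le_smooth
  have : IsManifold 𝓘(ℝ, E'') 2 N'' := .of_le (n := ∞) two_le_smooth
  obtain ⟨e, hp, he⟩ := exists_chart_of_isSubmersionAt h
  have hmem : (x, (e p).2) ∈ e.target := hx ▸ he.mem_target hp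
  have hcp : e.symm (x, (e p).2) = p := hx ▸ he.symm_apply hp
  have hev := eventually_fibre_mem_target e hmem
  have hd : ∀ {V : ∀ y : N, TangentSpace 𝓘(ℝ, E) y}, ContMDiff 𝓘(ℝ, E) 𝓘(ℝ, E).tangent ∞
      (fun y => (⟨y, V y⟩ : TangentBundle 𝓘(ℝ, E) N)) → ∀ y, MDifferentiableAt 𝓘(ℝ, E)
      𝓘(ℝ, E).tangent (fun y => (⟨y, V y⟩ : TangentBundle 𝓘(ℝ, E) N)) y :=
    fun hV y => (hV y).mdifferentiableAt (by simp)
  have hd' : ∀ {V : ∀ y : N'', TangentSpace 𝓘(ℝ, E'') y}, ContMDiff 𝓘(ℝ, E'') 𝓘(ℝ, E'').tangent ∞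
      (fun y => (⟨y, V y⟩ : TangentBundle 𝓘(ℝ, E'') N'')) → ∀ y, MDifferentiableAt 𝓘(ℝ, E'')
      𝓘(ℝ, E'').tangent (fun y => (⟨y, V y⟩ : TangentBundle 𝓘(ℝ, E'') N'')) y :=
    fun hV y => (hV y).mdifferentiableAt (by simp)
  have hφd : ∀ y, f y = x → MDifferentiableWithinAt 𝓘(ℝ, E) 𝓘(ℝ, E'') φ {y | f y = x} y :=
    fun y hy => (hφ y hy).mdifferentiableWithinAt (by simp)
  have hc : ContMDiffOn 𝓘(ℝ, FibreModel E E') 𝓘(ℝ, E) ∞ (fun z => e.symm (x, z))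
      {z | (x, z) ∈ e.target} := fun z hz => (he.contMDiffAt_fibre hz).contMDiffWithinAt
  have hφc : ContMDiffAt 𝓘(ℝ, FibreModel E E') 𝓘(ℝ, E'') ∞ (fun z => φ (e.symm (x, z))) (e p).2 :=
    (hφ.comp hc fun z hz => he.apply_symm hz).contMDiffAt hev
  -- The coordinate fields are related to `V`, `W` by the parametrization of the fibre and to `V'`,
  -- `W'` by its composite with `φ`. Both brackets are images of the single coordinate bracket `Bz`.
  have k1 := mfderiv_mlieBracket_of_related ((he.contMDiffAt_fibre hmem).of_le
      two_le_smooth)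
    (he.mdifferentiableAt_fibreField hV hmem) (he.mdifferentiableAt_fibreField hW hmem)
    (hd hV _) (hd hW _) (hev.mono fun z hz => he.mfderiv_fibreField_id hf hV0 hz)
    (hev.mono fun z hz => he.mfderiv_fibreField_id hf hW0 hz)
  have k2 := mfderiv_mlieBracket_of_related (hφc.of_le two_le_smooth)
    (he.mdifferentiableAt_fibreField hV hmem) (he.mdifferentiableAt_fibreField hW hmem)
    (hd' hV' _) (hd' hW' _)
    (hev.mono fun z hz => (he.mfderiv_fibreField hf hV0 hz (hφd _ (he.apply_symm hz))).trans
      (hVV' _ (he.apply_symm hz)))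
    (hev.mono fun z hz => (he.mfderiv_fibreField hf hW0 hz (hφd _ (he.apply_symm hz))).trans
      (hWW' _ (he.apply_symm hz)))
  set Bz := mlieBracket 𝓘(ℝ, FibreModel E E') (IsSubmersionChart.fibreField e V x)
    (IsSubmersionChart.fibreField e W x) (e p).2
  have k3 := he.mfderiv_snd_fibre_apply hp hx Bz
  have k4 : mfderiv 𝓘(ℝ, FibreModel E E') 𝓘(ℝ, E) (fun z => e.symm (x, z)) (e p).2 Bz =
      mlieBracket 𝓘(ℝ, E) V W p := by
    refine k1.trans ?_
    exact congrArg (fun y => (show E from mlieBracket 𝓘(ℝ, E) V W y)) hcp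
  rw [k4] at k3
  have k5 := he.hasMFDerivWithinAt_apply hf hp hx (hφd p hx).hasMFDerivWithinAt
    (mfderiv_mlieBracket_eq_zero hf hV hW hV0 hW0 p)
  rw [k3] at k5
  refine k5.trans (k2.trans ?_)
  exact congrArg (fun y => (show E'' from mlieBracket 𝓘(ℝ, E'') V' W' (φ y))) hcp

end FibreBrackets

/-! ### Groupoid algebra and tangent maps of left translations. -/

namespace LieGroupoid

open Filter Set VectorField
open scoped Topology

variable {EG EM G M : Type*} [NormedAddCommGroup EG] [NormedSpace ℝ EG]
    [NormedAddCommGroup EM] [NormedSpace ℝ EM] [TopologicalSpace G] [ChartedSpace EG G]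
    [TopologicalSpace M] [ChartedSpace EM M] (𝒢 : LieGroupoid EG EM G M)

theorem isSubmersionAt_src (g : G) : IsSubmersionAt 𝓘(ℝ, EG) 𝓘(ℝ, EM) ∞ 𝒢.src g :=
  𝒢.isSubmersion_src.isSubmersionAt g

theorem isSubmersionAt_tgt (g : G) : IsSubmersionAt 𝓘(ℝ, EG) 𝓘(ℝ, EM) ∞ 𝒢.tgt g :=
  𝒢.isSubmersion_tgt.isSubmersionAt g

theorem contMDiffOn_mul_left (g : G) :
    ContMDiffOn 𝓘(ℝ, EG) 𝓘(ℝ, EG) ∞ (𝒢.mul g) {h | 𝒢.src h = 𝒢.tgt g} :=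
  𝒢.smooth_mul.comp (contMDiff_const.prodMk contMDiff_id).contMDiffOn fun _ hh => Eq.symm hh

theorem mdifferentiableWithinAt_mul_left {g h : G} (hgh : 𝒢.src h = 𝒢.tgt g) :
    MDifferentiableWithinAt 𝓘(ℝ, EG) 𝓘(ℝ, EG) (𝒢.mul g) {h | 𝒢.src h = 𝒢.tgt g} h :=
  (𝒢.contMDiffOn_mul_left g h hgh).mdifferentiableWithinAt (by simp)

theorem inv_mul_cancel_left {g h : G} (hgh : 𝒢.tgt g = 𝒢.src h) :
    𝒢.mul (𝒢.inv g) (𝒢.mul g h) = h := by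
  rw [𝒢.mul_assoc _ _ _ (𝒢.tgt_inv g) hgh, 𝒢.inv_mul, hgh, 𝒢.unit_mul]

theorem mul_inv_cancel_left {g h : G} (hgh : 𝒢.src g = 𝒢.src h) :
    𝒢.mul g (𝒢.mul (𝒢.inv g) h) = h := by
  rw [𝒢.mul_assoc _ _ _ (𝒢.src_inv g).symm ((𝒢.tgt_inv g).trans hgh), 𝒢.mul_inv, hgh, 𝒢.unit_mul]

theorem mul_inv_cancel_right {g h : G} (hgh : 𝒢.tgt g = 𝒢.src h) :
    𝒢.mul (𝒢.mul g h) (𝒢.inv h) = g := by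
  rw [← 𝒢.mul_assoc _ _ _ hgh (𝒢.src_inv h).symm, 𝒢.mul_inv, ← hgh, 𝒢.mul_unit]

theorem inv_mul_cancel_right {g h : G} (hgh : 𝒢.tgt g = 𝒢.tgt h) :
    𝒢.mul (𝒢.mul g (𝒢.inv h)) h = g := by
  rw [← 𝒢.mul_assoc _ _ _ (hgh.trans (𝒢.src_inv h).symm) (𝒢.tgt_inv h), 𝒢.inv_mul, ← hgh,
    𝒢.mul_unit]

theorem inv_eq_of_mul_eq_unit {g h : G} (hgh : 𝒢.tgt g = 𝒢.src h)
    (h1 : 𝒢.mul g h = 𝒢.unit (𝒢.src g)) : 𝒢.inv g = h := by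
  rw [← 𝒢.inv_mul_cancel_left hgh, h1, ← 𝒢.tgt_inv, 𝒢.mul_unit]

theorem inv_inv (g : G) : 𝒢.inv (𝒢.inv g) = g :=
  𝒢.inv_eq_of_mul_eq_unit (𝒢.tgt_inv g) (by rw [𝒢.inv_mul, 𝒢.src_inv])

theorem inv_mul_rev {g h : G} (hgh : 𝒢.tgt g = 𝒢.src h) :
    𝒢.inv (𝒢.mul g h) = 𝒢.mul (𝒢.inv h) (𝒢.inv g) := by
  have h1 : 𝒢.tgt (𝒢.inv h) = 𝒢.src (𝒢.inv g) := by rw [𝒢.tgt_inv, 𝒢.src_inv, hgh]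
  refine 𝒢.inv_eq_of_mul_eq_unit (by rw [𝒢.tgt_mul _ _ hgh, 𝒢.src_mul _ _ h1, 𝒢.src_inv]) ?_
  rw [𝒢.mul_assoc _ _ _ (by rw [𝒢.tgt_mul _ _ hgh, 𝒢.src_inv]) h1, 𝒢.mul_inv_cancel_right hgh,
    𝒢.mul_inv, 𝒢.src_mul _ _ hgh]

section

variable [FiniteDimensional ℝ EG] [FiniteDimensional ℝ EM]

theorem mfderiv_src_surjective (g : G) :
    Function.Surjective (mfderiv 𝓘(ℝ, EG) 𝓘(ℝ, EM) 𝒢.src g) := by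
  obtain ⟨e, hg, he⟩ := exists_chart_of_isSubmersionAt (𝒢.isSubmersionAt_src g)
  exact he.mfderiv_surjective 𝒢.src.contMDiff hg

theorem mfderiv_tgt_surjective (g : G) :
    Function.Surjective (mfderiv 𝓘(ℝ, EG) 𝓘(ℝ, EM) 𝒢.tgt g) := by
  obtain ⟨e, hg, he⟩ := exists_chart_of_isSubmersionAt (𝒢.isSubmersionAt_tgt g)
  exact he.mfderiv_surjective 𝒢.tgt.contMDiff hg

/-- The chain rule for maps of an `α`-fibre, on vertical vectors. -/
theorem mfderivWithin_leftTangent {E'' N'' : Type*} [NormedAddCommGroup E''] [NormedSpace ℝ E'']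
    [TopologicalSpace N''] [ChartedSpace E'' N''] {k : G} {x : M} (hk : 𝒢.src k = x) {φ : G → N''}
    (hφ : MDifferentiableWithinAt 𝓘(ℝ, EG) 𝓘(ℝ, E'') φ {h | 𝒢.src h = x} k)
    {v : TangentSpace 𝓘(ℝ, EG) (𝒢.unit (𝒢.tgt k))}
    (hv : mfderiv 𝓘(ℝ, EG) 𝓘(ℝ, EM) 𝒢.src (𝒢.unit (𝒢.tgt k)) v = 0) :
    mfderivWithin 𝓘(ℝ, EG) 𝓘(ℝ, E'') φ {h | 𝒢.src h = x} k (𝒢.leftTangent k v) =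
      mfderivWithin 𝓘(ℝ, EG) 𝓘(ℝ, E'') (fun h => φ (𝒢.mul k h)) {h | 𝒢.src h = 𝒢.tgt k}
        (𝒢.unit (𝒢.tgt k)) v := by
  have hu := 𝒢.src_unit (𝒢.tgt k)
  have h1 := (𝒢.mdifferentiableWithinAt_mul_left hu).hasMFDerivWithinAt
  have h2 : ∀ y, y = k → HasMFDerivWithinAt 𝓘(ℝ, EG) 𝓘(ℝ, E'') φ {h | 𝒢.src h = x} y
      (show TangentSpace 𝓘(ℝ, EG) y →L[ℝ] TangentSpace 𝓘(ℝ, E'') (φ y) from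
        mfderivWithin 𝓘(ℝ, EG) 𝓘(ℝ, E'') φ {h | 𝒢.src h = x} k) := by
    rintro y rfl; exact hφ.hasMFDerivWithinAt
  have h3 := HasMFDerivWithinAt.comp (𝒢.unit (𝒢.tgt k)) (h2 _ (𝒢.mul_unit k)) h1
    (fun h hh => (𝒢.src_mul k h (Eq.symm hh)).trans hk)
  exact hasMFDerivWithinAt_fibre_unique (𝒢.isSubmersionAt_src _) 𝒢.src.contMDiff hu h3
    h3.mdifferentiableWithinAt.hasMFDerivWithinAt hv

theorem mfderivWithin_src_const {g : G} {x : M} (hx : 𝒢.src g = x) {E'' N'' : Type*}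
    [NormedAddCommGroup E''] [NormedSpace ℝ E''] [TopologicalSpace N''] [ChartedSpace E'' N'']
    {φ : G → N''} {c : N''} (hφ : ∀ h, 𝒢.src h = x → φ h = c) {v : TangentSpace 𝓘(ℝ, EG) g}
    (hv : mfderiv 𝓘(ℝ, EG) 𝓘(ℝ, EM) 𝒢.src g v = 0) :
    mfderivWithin 𝓘(ℝ, EG) 𝓘(ℝ, E'') φ {h | 𝒢.src h = x} g v = 0 := by
  have h1 : HasMFDerivWithinAt 𝓘(ℝ, EG) 𝓘(ℝ, E'') φ {h | 𝒢.src h = x} g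
      (0 : TangentSpace 𝓘(ℝ, EG) g →L[ℝ] TangentSpace 𝓘(ℝ, E'') (φ g)) := by
    have h2 := hasMFDerivWithinAt_const (I := 𝓘(ℝ, EG)) (I' := 𝓘(ℝ, E'')) c {h | 𝒢.src h = x} g
    exact h2.congr_of_eventuallyEq (eventually_of_mem self_mem_nhdsWithin hφ) (hφ g hx)
  exact (hasMFDerivWithinAt_fibre_unique (𝒢.isSubmersionAt_src _) 𝒢.src.contMDiff hx h1
    h1.mdifferentiableWithinAt.hasMFDerivWithinAt hv).symm

/-- The map `h ↦ α(gh)` is constant, equal to `α(g)`, on the `α`-fibre. -/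
theorem mfderiv_src_leftTangent {g : G} {v : TangentSpace 𝓘(ℝ, EG) (𝒢.unit (𝒢.tgt g))}
    (hv : mfderiv 𝓘(ℝ, EG) 𝓘(ℝ, EM) 𝒢.src (𝒢.unit (𝒢.tgt g)) v = 0) :
    mfderiv 𝓘(ℝ, EG) 𝓘(ℝ, EM) 𝒢.src g (𝒢.leftTangent g v) = 0 := by
  have hu := 𝒢.src_unit (𝒢.tgt g)
  have h1 := (𝒢.mdifferentiableWithinAt_mul_left hu).hasMFDerivWithinAt
  have h2 : ∀ y, y = g → HasMFDerivAt 𝓘(ℝ, EG) 𝓘(ℝ, EM) 𝒢.src y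
      (show TangentSpace 𝓘(ℝ, EG) y →L[ℝ] TangentSpace 𝓘(ℝ, EM) (𝒢.src y) from
        mfderiv 𝓘(ℝ, EG) 𝓘(ℝ, EM) 𝒢.src g) := by
    rintro y rfl
    exact ((𝒢.src.contMDiff y).mdifferentiableAt (by simp)).hasMFDerivAt
  have h3 := HasMFDerivAt.comp_hasMFDerivWithinAt (𝒢.unit (𝒢.tgt g)) (h2 _ (𝒢.mul_unit g)) h1
  refine (hasMFDerivWithinAt_fibre_unique (𝒢.isSubmersionAt_src _) 𝒢.src.contMDiff hu h3
    h3.mdifferentiableWithinAt.hasMFDerivWithinAt hv).trans ?_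
  exact 𝒢.mfderivWithin_src_const hu (fun h hh => 𝒢.src_mul g h (Eq.symm hh)) hv

/-- Left translation by a unit is the identity of the `α`-fibre. The base point `y` is kept as a
variable because `β(ε(x)) = x` holds only propositionally. -/
theorem leftTangent_unit {x y : M} (hxy : 𝒢.tgt (𝒢.unit x) = y)
    {v : TangentSpace 𝓘(ℝ, EG) (𝒢.unit y)}
    (hv : mfderiv 𝓘(ℝ, EG) 𝓘(ℝ, EM) 𝒢.src (𝒢.unit y) v = 0) :
    mfderivWithin 𝓘(ℝ, EG) 𝓘(ℝ, EG) (𝒢.mul (𝒢.unit x)) {h | 𝒢.src h = y} (𝒢.unit y) v = v := by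
  have hyx : x = y := by rw [← hxy, 𝒢.tgt_unit]
  subst hyx
  have hu := 𝒢.src_unit x
  have h1 : HasMFDerivWithinAt 𝓘(ℝ, EG) 𝓘(ℝ, EG) (𝒢.mul (𝒢.unit x)) {h | 𝒢.src h = x} (𝒢.unit x)
      (ContinuousLinearMap.id ℝ (TangentSpace 𝓘(ℝ, EG) (𝒢.unit x))) := by
    have h2 : ∀ h, 𝒢.src h = x → 𝒢.mul (𝒢.unit x) h = h := by
      rintro h rfl; exact 𝒢.unit_mul h
    have h3 : 𝒢.mul (𝒢.unit x) =ᶠ[𝓝[{h | 𝒢.src h = x}] 𝒢.unit x] id :=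
      eventually_of_mem self_mem_nhdsWithin h2
    exact HasMFDerivWithinAt.congr_of_eventuallyEq (hasMFDerivWithinAt_id _ _) h3 (h2 _ hu)
  exact (hasMFDerivWithinAt_fibre_unique (𝒢.isSubmersionAt_src _) 𝒢.src.contMDiff hu h1
    h1.mdifferentiableWithinAt.hasMFDerivWithinAt hv).symm

end

end LieGroupoid

/-! ### Left-invariant vector fields. -/

namespace LieGroupoid

open Filter Set VectorField
open scoped Topology

variable {EG EM G M : Type*} [NormedAddCommGroup EG] [NormedSpace ℝ EG]
    [NormedAddCommGroup EM] [NormedSpace ℝ EM] [TopologicalSpace G] [ChartedSpace EG G]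
    [TopologicalSpace M] [ChartedSpace EM M] (𝒢 : LieGroupoid EG EM G M)
    [IsManifold 𝓘(ℝ, EG) ∞ G]

/-- A section of `AG`, as a smooth family of tangent vectors of `G`. -/
theorem contMDiff_algebroidSection (X : 𝒢.AlgebroidSection) :
    ContMDiff 𝓘(ℝ, EM) 𝓘(ℝ, EG).tangent ∞
      (fun x => (⟨𝒢.unit x, (sectionVal X x).1⟩ : TangentBundle 𝓘(ℝ, EG) G)) :=
  contMDiffOn_univ.1 ((smoothSectionOn_pullback 𝒢.unit (fun x => (sectionVal X x).1) univ).1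
    X.1.contMDiff.contMDiffOn)

/-- A form of the definition with a free base point, for use where the target of `g` is known only
up to a propositional equality. -/
theorem leftInvariant_eq (X : 𝒢.AlgebroidSection) {g : G} {x : M} (hx : 𝒢.tgt g = x) :
    𝒢.leftInvariant X g = mfderivWithin 𝓘(ℝ, EG) 𝓘(ℝ, EG) (𝒢.mul g) {h | 𝒢.src h = x} (𝒢.unit x)
      (show TangentSpace 𝓘(ℝ, EG) (𝒢.unit x) from (sectionVal X x).1) := by
  subst hx; rfl

variable [FiniteDimensional ℝ EG] [FiniteDimensional ℝ EM]

theorem mfderiv_src_leftInvariant (X : 𝒢.AlgebroidSection) (g : G) :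
    mfderiv 𝓘(ℝ, EG) 𝓘(ℝ, EM) 𝒢.src g (𝒢.leftInvariant X g) = 0 :=
  𝒢.mfderiv_src_leftTangent (sectionVal X (𝒢.tgt g)).2

/-- The derivatives within the `α`-fibres of a family of maps, on a smooth family of vertical
vectors at the units. -/
theorem contMDiffOn_fibreDerivative {EB B E'' N'' : Type*} [NormedAddCommGroup EB]
    [NormedSpace ℝ EB] [TopologicalSpace B] [ChartedSpace EB B] [IsManifold 𝓘(ℝ, EB) ∞ B]
    [NormedAddCommGroup E''] [NormedSpace ℝ E''] [TopologicalSpace N''] [ChartedSpace E'' N'']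
    [IsManifold 𝓘(ℝ, E'') ∞ N'']
    {κ : B → M} (hκ : ContMDiff 𝓘(ℝ, EB) 𝓘(ℝ, EM) ∞ κ) {ψ : B → G → N''}
    (hψ : ContMDiffOn (𝓘(ℝ, EB).prod 𝓘(ℝ, EG)) 𝓘(ℝ, E'') ∞ (fun p : B × G => ψ p.1 p.2)
      {p | κ p.1 = 𝒢.src p.2}) {U : Set B} (hU : IsOpen U)
    {ξ : ∀ b, TangentSpace 𝓘(ℝ, EG) (𝒢.unit (κ b))}
    (hv : ∀ b ∈ U, mfderiv 𝓘(ℝ, EG) 𝓘(ℝ, EM) 𝒢.src (𝒢.unit (κ b)) (ξ b) = 0)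
    (hξ : ContMDiffOn 𝓘(ℝ, EB) 𝓘(ℝ, EG).tangent ∞
      (fun b => (⟨𝒢.unit (κ b), ξ b⟩ : TangentBundle 𝓘(ℝ, EG) G)) U) :
    ContMDiffOn 𝓘(ℝ, EB) 𝓘(ℝ, E'').tangent ∞ (fun b => (⟨ψ b (𝒢.unit (κ b)),
      mfderivWithin 𝓘(ℝ, EG) 𝓘(ℝ, E'') (ψ b) {h | 𝒢.src h = κ b} (𝒢.unit (κ b)) (ξ b)⟩ :
      TangentBundle 𝓘(ℝ, E'') N'')) U := by
  intro b₀ hb₀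
  obtain ⟨e, hp, he⟩ := exists_chart_of_isSubmersionAt (𝒢.isSubmersionAt_src (𝒢.unit (κ b₀)))
  have hεκ : ContMDiff 𝓘(ℝ, EB) 𝓘(ℝ, EG) ∞ fun b => 𝒢.unit (κ b) := 𝒢.unit.contMDiff.comp hκ
  have hW : IsOpen (U ∩ {b | 𝒢.unit (κ b) ∈ e.source}) :=
    hU.inter (e.open_source.preimage hεκ.continuous)
  set W := U ∩ {b | 𝒢.unit (κ b) ∈ e.source}
  refine ContMDiffAt.contMDiffWithinAt (ContMDiffOn.contMDiffAt ?_ (hW.mem_nhds ⟨hb₀, hp⟩))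
  let O : Set (B × FibreModel EG EM) := {p | (κ p.1, p.2) ∈ e.target}
  have hκ' : ContMDiff (𝓘(ℝ, EB).prod 𝓘(ℝ, FibreModel EG EM)) (𝓘(ℝ, EM).prod
      𝓘(ℝ, FibreModel EG EM)) ∞ fun p : B × FibreModel EG EM => (κ p.1, p.2) :=
    (hκ.comp contMDiff_fst).prodMk contMDiff_snd
  have hO : IsOpen O := e.open_target.preimage hκ'.continuous
  -- In the fibre coordinates the family is defined on an open set of `B × FibreModel`, so
  -- derivatives within the varying fibres become ordinary partial derivatives.
  have hμ : ContMDiffOn (𝓘(ℝ, EB).prod 𝓘(ℝ, FibreModel EG EM)) 𝓘(ℝ, E'') ∞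
      (fun p : B × FibreModel EG EM => ψ p.1 (e.symm (κ p.1, p.2))) O :=
    hψ.comp (contMDiffOn_fst.prodMk (he.contMDiffOn_symm.comp hκ'.contMDiffOn fun p hp => hp))
      fun p hp => (he.apply_symm hp).symm
  have hz : ContMDiffOn 𝓘(ℝ, EB) 𝓘(ℝ, FibreModel EG EM) ∞ (fun b => (e (𝒢.unit (κ b))).2) W :=
    he.contMDiffOn_snd.comp hεκ.contMDiffOn fun b hb => hb.2
  have hw := (he.contMDiffOn_snd.tangentMap_comp e.open_source (hξ.mono (inter_subset_left (s := U)
    (t := {b | 𝒢.unit (κ b) ∈ e.source}))) fun b hb => hb.2).snd_tangent_vectorSpace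
  have hmem : ∀ b ∈ W, (b, (e (𝒢.unit (κ b))).2) ∈ O := fun b hb => by
    have := he.mem_target hb.2
    rwa [𝒢.src_unit] at this
  refine (hμ.partial_mfderiv hO hz hw hmem).congr fun b hb => ?_
  have h2 : e.symm (κ b, (e (𝒢.unit (κ b))).2) = 𝒢.unit (κ b) := by
    have := he.symm_apply hb.2
    rwa [𝒢.src_unit] at this
  have hψb : MDifferentiableWithinAt 𝓘(ℝ, EG) 𝓘(ℝ, E'') (ψ b) {h | 𝒢.src h = κ b}
      (𝒢.unit (κ b)) :=
    ((hψ.comp (contMDiff_const.prodMk contMDiff_id).contMDiffOn fun _ hh => Eq.symm hh)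
      (𝒢.unit (κ b)) (𝒢.src_unit _)).mdifferentiableWithinAt (by simp)
  have h3 := he.hasMFDerivWithinAt_apply 𝒢.src.contMDiff hb.2 (𝒢.src_unit (κ b))
    hψb.hasMFDerivWithinAt (hv b hb.1)
  exact TotalSpace.ext (congrArg (ψ b) h2.symm) (heq_of_eq h3)

/-- A section is recovered from its left-invariant field along the units; this is why brackets of
sections can be read off there. -/
theorem leftInvariant_unit (X : 𝒢.AlgebroidSection) (x : M) :
    𝒢.leftInvariant X (𝒢.unit x) = (sectionVal X x).1 := by
  rw [𝒢.leftInvariant_eq X (𝒢.tgt_unit x)]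
  exact 𝒢.leftTangent_unit (𝒢.tgt_unit x) (sectionVal X x).2

/-- Left-invariant vector fields are related by left translations. -/
theorem mfderivWithin_mul_leftInvariant (X : 𝒢.AlgebroidSection) {g k : G}
    (hgk : 𝒢.src k = 𝒢.tgt g) :
    mfderivWithin 𝓘(ℝ, EG) 𝓘(ℝ, EG) (𝒢.mul g) {h | 𝒢.src h = 𝒢.tgt g} k (𝒢.leftInvariant X k) =
      𝒢.leftInvariant X (𝒢.mul g k) := by
  rw [leftInvariant, 𝒢.mfderivWithin_leftTangent hgk (𝒢.mdifferentiableWithinAt_mul_left hgk)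
    (sectionVal X (𝒢.tgt k)).2, 𝒢.leftInvariant_eq X (𝒢.tgt_mul g k hgk.symm)]
  have h1 : ∀ h ∈ {h | 𝒢.src h = 𝒢.tgt k}, 𝒢.mul g (𝒢.mul k h) = 𝒢.mul (𝒢.mul g k) h :=
    fun h hh => 𝒢.mul_assoc g k h hgk.symm (Eq.symm hh)
  exact congrArg (fun D => (show EG →L[ℝ] EG from D) (sectionVal X (𝒢.tgt k)).1)
    (mfderivWithin_congr h1 (h1 _ (𝒢.src_unit _)))

theorem contMDiffOn_leftTangent {EB B : Type*} [NormedAddCommGroup EB]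
    [NormedSpace ℝ EB] [TopologicalSpace B] [ChartedSpace EB B] [IsManifold 𝓘(ℝ, EB) ∞ B]
    {γ : B → G} (hγ : ContMDiff 𝓘(ℝ, EB) 𝓘(ℝ, EG) ∞ γ) {U : Set B} (hU : IsOpen U)
    {ξ : ∀ b, TangentSpace 𝓘(ℝ, EG) (𝒢.unit (𝒢.tgt (γ b)))}
    (hv : ∀ b ∈ U, mfderiv 𝓘(ℝ, EG) 𝓘(ℝ, EM) 𝒢.src (𝒢.unit (𝒢.tgt (γ b))) (ξ b) = 0)
    (hξ : ContMDiffOn 𝓘(ℝ, EB) 𝓘(ℝ, EG).tangent ∞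
      (fun b => (⟨𝒢.unit (𝒢.tgt (γ b)), ξ b⟩ : TangentBundle 𝓘(ℝ, EG) G)) U) :
    ContMDiffOn 𝓘(ℝ, EB) 𝓘(ℝ, EG).tangent ∞
      (fun b => (⟨γ b, 𝒢.leftTangent (γ b) (ξ b)⟩ : TangentBundle 𝓘(ℝ, EG) G)) U := by
  have h1 : ContMDiffOn (𝓘(ℝ, EB).prod 𝓘(ℝ, EG)) 𝓘(ℝ, EG) ∞
      (fun p : B × G => 𝒢.mul (γ p.1) p.2) {p | 𝒢.tgt (γ p.1) = 𝒢.src p.2} :=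
    𝒢.smooth_mul.comp ((hγ.comp contMDiff_fst).prodMk contMDiff_snd).contMDiffOn fun p hp => hp
  refine (𝒢.contMDiffOn_fibreDerivative (𝒢.tgt.contMDiff.comp hγ) (ψ := fun b => 𝒢.mul (γ b))
    h1 hU hv hξ).congr fun b _ => ?_
  exact TotalSpace.ext (𝒢.mul_unit _).symm HEq.rfl

variable [IsManifold 𝓘(ℝ, EM) ∞ M]

/-- In a product chart for `α` around `ε(x₀)`, the coordinate vectors of the fibre direction, taken
along the units, form a local frame. -/
theorem isSmoothSubbundle_algebroidFiber : IsSmoothSubbundle EM EG 𝒢.algebroidFiber := by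
  intro x₀
  obtain ⟨e, hp, he⟩ := exists_chart_of_isSubmersionAt (𝒢.isSubmersionAt_src (𝒢.unit x₀))
  let b := Module.finBasis ℝ (FibreModel EG EM)
  have hO : IsOpen {x | 𝒢.unit x ∈ e.source} := e.open_source.preimage 𝒢.unit.contMDiff.continuous
  let s : Fin _ → ∀ x, 𝒢.AmbientBundle x := fun i x =>
    mfderiv 𝓘(ℝ, FibreModel EG EM) 𝓘(ℝ, EG) (fun z => e.symm (x, z)) (e (𝒢.unit x)).2 (b i)
  refine ⟨{x | 𝒢.unit x ∈ e.source}, hO, hp, _, s, fun i => ?_, fun x hx => ?_⟩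
  · refine (smoothSectionOn_pullback 𝒢.unit (s i) _).2 ?_
    have h1 : ContMDiffOn 𝓘(ℝ, EM) 𝓘(ℝ, FibreModel EG EM) ∞ (fun x => (e (𝒢.unit x)).2)
        {x | 𝒢.unit x ∈ e.source} :=
      he.contMDiffOn_snd.comp 𝒢.unit.contMDiff.contMDiffOn fun x hx => hx
    have hmem : ∀ x, 𝒢.unit x ∈ e.source → (x, (e (𝒢.unit x)).2) ∈ e.target := fun x hx => by
      have := he.mem_target hx
      rwa [𝒢.src_unit] at this
    refine (he.contMDiffOn_symm.partial_mfderiv e.open_target h1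
      (contMDiffOn_const (c := b i)) hmem).congr fun x hx => ?_
    have h2 : e.symm (x, (e (𝒢.unit x)).2) = 𝒢.unit x := by
      have := he.symm_apply hx
      rwa [𝒢.src_unit] at this
    exact TotalSpace.ext h2.symm HEq.rfl
  · have hu := 𝒢.src_unit x
    let T : FibreModel EG EM →ₗ[ℝ] 𝒢.AmbientBundle x :=
      (mfderiv 𝓘(ℝ, FibreModel EG EM) 𝓘(ℝ, EG) (fun z => e.symm (x, z)) (e (𝒢.unit x)).2).toLinearMap
    have hT : Function.Injective T := fun w w' hw => by
      have h1 := he.mfderiv_snd_fibre_apply hx hu w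
      have h2 := he.mfderiv_snd_fibre_apply hx hu w'
      refine h1.symm.trans (Eq.trans ?_ h2)
      exact congrArg (fun a => (show FibreModel EG EM from
        mfderiv 𝓘(ℝ, EG) 𝓘(ℝ, FibreModel EG EM) (fun y => (e y).2) (𝒢.unit x) a)) hw
    have hr : Submodule.map T ⊤ = 𝒢.algebroidFiber x := by
      apply le_antisymm
      · rintro _ ⟨w, -, rfl⟩
        exact he.mfderiv_apply_fibre 𝒢.src.contMDiff hx hu w
      · intro v hv
        exact ⟨_, Submodule.mem_top, he.mfderiv_fibre_apply 𝒢.src.contMDiff hx hu hv⟩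
    constructor
    · exact b.linearIndependent.map' T (LinearMap.ker_eq_bot.2 hT)
    · rw [← b.span_eq, Submodule.map_span, ← range_comp] at hr
      exact hr

theorem contMDiff_leftInvariant (X : 𝒢.AlgebroidSection) :
    ContMDiff 𝓘(ℝ, EG) 𝓘(ℝ, EG).tangent ∞
      (fun g => (⟨g, 𝒢.leftInvariant X g⟩ : TangentBundle 𝓘(ℝ, EG) G)) :=
  contMDiffOn_univ.1 (𝒢.contMDiffOn_leftTangent contMDiff_id isOpen_univ
    (fun g _ => (sectionVal X (𝒢.tgt g)).2)
    ((𝒢.contMDiff_algebroidSection X).comp 𝒢.tgt.contMDiff).contMDiffOn)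

/-- Each `l_g` relates `←X` and `←Y` to themselves, hence also their bracket. Evaluated at
`ε(β(g))`, this says that the bracket is the left-invariant extension of its values at the units. -/
theorem leftTangent_mlieBracket_leftInvariant (X Y : 𝒢.AlgebroidSection) (g : G) :
    𝒢.leftTangent g (mlieBracket 𝓘(ℝ, EG) (𝒢.leftInvariant X) (𝒢.leftInvariant Y)
      (𝒢.unit (𝒢.tgt g))) =
      mlieBracket 𝓘(ℝ, EG) (𝒢.leftInvariant X) (𝒢.leftInvariant Y) g := by
  have : CompleteSpace EG := FiniteDimensional.complete ℝ EG
  refine (mfderivWithin_fibre_mlieBracket (𝒢.isSubmersionAt_src _) 𝒢.src.contMDiff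
    (𝒢.src_unit (𝒢.tgt g)) (𝒢.contMDiffOn_mul_left g) (𝒢.contMDiff_leftInvariant X)
    (𝒢.contMDiff_leftInvariant Y) (𝒢.contMDiff_leftInvariant X)
    (𝒢.contMDiff_leftInvariant Y) (𝒢.mfderiv_src_leftInvariant X) (𝒢.mfderiv_src_leftInvariant Y)
    (fun k hk => 𝒢.mfderivWithin_mul_leftInvariant X hk)
    (fun k hk => 𝒢.mfderivWithin_mul_leftInvariant Y hk)).trans ?_
  exact congrArg (fun y => (show EG from mlieBracket 𝓘(ℝ, EG) (𝒢.leftInvariant X)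
    (𝒢.leftInvariant Y) y)) (𝒢.mul_unit g)

end LieGroupoid

theorem minSmoothness_real (n : WithTop ℕ∞) : minSmoothness ℝ n = n :=
  minSmoothness_of_isRCLikeNormedField

/-! ### The Lie algebroid of a Lie groupoid. -/

namespace LieGroupoid

open Filter Set VectorField
open scoped Topology

variable {EG EM G M : Type*} [NormedAddCommGroup EG] [NormedSpace ℝ EG]
    [NormedAddCommGroup EM] [NormedSpace ℝ EM] [TopologicalSpace G] [ChartedSpace EG G]
    [TopologicalSpace M] [ChartedSpace EM M] (𝒢 : LieGroupoid EG EM G M)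
    [IsManifold 𝓘(ℝ, EG) ∞ G]

theorem leftInvariant_add (X Y : 𝒢.AlgebroidSection) :
    𝒢.leftInvariant (X + Y) = 𝒢.leftInvariant X + 𝒢.leftInvariant Y :=
  funext fun g => (𝒢.leftTangent g).map_add _ _

theorem leftInvariant_smul (a : ℝ) (X : 𝒢.AlgebroidSection) :
    𝒢.leftInvariant (a • X) = a • 𝒢.leftInvariant X :=
  funext fun g => (𝒢.leftTangent g).map_smul _ _

theorem leftInvariant_sectionSMul (f : C^∞⟮𝓘(ℝ, EM), M; ℝ⟯) (X : 𝒢.AlgebroidSection) :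
    𝒢.leftInvariant (sectionSMul f X) = (fun g => f (𝒢.tgt g)) • 𝒢.leftInvariant X :=
  funext fun g => (𝒢.leftTangent g).map_smul _ _

/-- The anchor of the Lie algebroid of a Lie groupoid. -/
noncomputable def anchorMap (x : M) : 𝒢.algebroidFiber x →ₗ[ℝ] TangentSpace 𝓘(ℝ, EM) x :=
  (show TangentSpace 𝓘(ℝ, EG) (𝒢.unit x) →ₗ[ℝ] TangentSpace 𝓘(ℝ, EM) x from
    (show EG →L[ℝ] EM from mfderiv 𝓘(ℝ, EG) 𝓘(ℝ, EM) 𝒢.tgt (𝒢.unit x)).toLinearMap) ∘ₗ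
    (𝒢.algebroidFiber x).subtype

variable [IsManifold 𝓘(ℝ, EM) ∞ M]

theorem smoothBundleMap_anchorMap : SmoothBundleMap EM EG EM 𝒢.anchorMap := by
  intro U s hU hs
  have h1 := (smoothSectionOn_pullback 𝒢.unit (fun x => (s x).1) U).1 hs
  refine (𝒢.tgt.contMDiff.contMDiffOn.tangentMap_comp isOpen_univ h1 fun _ _ => mem_univ _).congr
    fun x _ => ?_
  exact TotalSpace.ext (𝒢.tgt_unit x).symm HEq.rfl

variable [FiniteDimensional ℝ EG] [FiniteDimensional ℝ EM]

theorem mdifferentiableAt_leftInvariant (X : 𝒢.AlgebroidSection) (g : G) :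
    MDifferentiableAt 𝓘(ℝ, EG) 𝓘(ℝ, EG).tangent
      (fun g => (⟨g, 𝒢.leftInvariant X g⟩ : TangentBundle 𝓘(ℝ, EG) G)) g :=
  (𝒢.contMDiff_leftInvariant X g).mdifferentiableAt (by simp)

theorem contMDiff_mlieBracket {E N : Type*} [NormedAddCommGroup E] [NormedSpace ℝ E]
    [CompleteSpace E] [TopologicalSpace N] [ChartedSpace E N] [IsManifold 𝓘(ℝ, E) ∞ N]
    {V W : ∀ y : N, TangentSpace 𝓘(ℝ, E) y}
    (hV : ContMDiff 𝓘(ℝ, E) 𝓘(ℝ, E).tangent ∞ (fun y => (⟨y, V y⟩ : TangentBundle 𝓘(ℝ, E) N)))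
    (hW : ContMDiff 𝓘(ℝ, E) 𝓘(ℝ, E).tangent ∞ (fun y => (⟨y, W y⟩ : TangentBundle 𝓘(ℝ, E) N))) :
    ContMDiff 𝓘(ℝ, E) 𝓘(ℝ, E).tangent ∞
      (fun y => (⟨y, mlieBracket 𝓘(ℝ, E) V W y⟩ : TangentBundle 𝓘(ℝ, E) N)) := by
  have : IsManifold 𝓘(ℝ, E) (((⊤ : ℕ∞) : WithTop ℕ∞) + 1) N := by
    simpa using (inferInstance : IsManifold 𝓘(ℝ, E) ∞ N)
  have : IsManifold 𝓘(ℝ, E) (minSmoothness ℝ 2) N := by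
    rw [minSmoothness_real]
    exact .of_le (n := ∞) two_le_smooth
  exact ContDiff.mlieBracket_vectorField (m := ⊤) (n := ⊤) hV hW (by simp)

/-- The bracket of sections of `AG`: the value of the bracket of the left-invariant vector fields
along the units. -/
noncomputable def leftBracket (X Y : 𝒢.AlgebroidSection) : 𝒢.AlgebroidSection :=
  have : CompleteSpace EG := FiniteDimensional.complete ℝ EG
  have : CompleteSpace EM := FiniteDimensional.complete ℝ EM
  ⟨⟨fun x => (mlieBracket 𝓘(ℝ, EG) (𝒢.leftInvariant X) (𝒢.leftInvariant Y) (𝒢.unit x) :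
      TangentSpace 𝓘(ℝ, EG) (𝒢.unit x)), contMDiffOn_univ.1
        ((smoothSectionOn_pullback 𝒢.unit _ univ).2
        ((contMDiff_mlieBracket (𝒢.contMDiff_leftInvariant X) (𝒢.contMDiff_leftInvariant Y)).comp
          𝒢.unit.contMDiff).contMDiffOn)⟩,
    fun x => mfderiv_mlieBracket_eq_zero 𝒢.src.contMDiff (𝒢.contMDiff_leftInvariant X)
      (𝒢.contMDiff_leftInvariant Y) (𝒢.mfderiv_src_leftInvariant X)
      (𝒢.mfderiv_src_leftInvariant Y) (𝒢.unit x)⟩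

theorem sectionVal_leftBracket (X Y : 𝒢.AlgebroidSection) (x : M) :
    (sectionVal (𝒢.leftBracket X Y) x).1 =
      mlieBracket 𝓘(ℝ, EG) (𝒢.leftInvariant X) (𝒢.leftInvariant Y) (𝒢.unit x) := rfl

theorem leftInvariant_leftBracket (X Y : 𝒢.AlgebroidSection) :
    𝒢.leftInvariant (𝒢.leftBracket X Y) =
      mlieBracket 𝓘(ℝ, EG) (𝒢.leftInvariant X) (𝒢.leftInvariant Y) :=
  funext fun g => 𝒢.leftTangent_mlieBracket_leftInvariant X Y g

/-- The identity for vector fields, evaluated at the units: by `leftInvariant_leftBracket` the inner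
brackets of fields are again left-invariant fields of sections. -/
theorem leftBracket_jacobi (X Y Z : 𝒢.AlgebroidSection) :
    𝒢.leftBracket X (𝒢.leftBracket Y Z) =
      𝒢.leftBracket (𝒢.leftBracket X Y) Z + 𝒢.leftBracket Y (𝒢.leftBracket X Z) := by
  have : CompleteSpace EG := FiniteDimensional.complete ℝ EG
  have : IsManifold 𝓘(ℝ, EG) (minSmoothness ℝ 3) G := by
    rw [minSmoothness_real]
    exact .of_le (n := ∞) (WithTop.coe_le_coe.2 (le_top : (3 : ℕ∞) ≤ ⊤))
  refine sectionVal_ext fun x => ?_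
  have hs : ∀ X, ContMDiffAt 𝓘(ℝ, EG) 𝓘(ℝ, EG).tangent (minSmoothness ℝ 2)
      (fun g => (⟨g, 𝒢.leftInvariant X g⟩ : TangentBundle 𝓘(ℝ, EG) G)) (𝒢.unit x) := fun X => by
    rw [minSmoothness_real]
    exact (𝒢.contMDiff_leftInvariant X _).of_le two_le_smooth
  have h1 := leibniz_identity_mlieBracket_apply (hs X) (hs Y) (hs Z)
  rw [← 𝒢.leftInvariant_leftBracket Y Z, ← 𝒢.leftInvariant_leftBracket X Y,
    ← 𝒢.leftInvariant_leftBracket X Z] at h1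
  exact h1

/-- Since `←(fY) = (f ∘ β) ←Y`, the Leibniz rule for vector fields produces the derivative of `f ∘
β` along `←X`. At `ε(x)` this is the derivative of `f` along the anchor of `X`. -/
theorem leftBracket_sectionSMul (X Y : 𝒢.AlgebroidSection) (f : C^∞⟮𝓘(ℝ, EM), M; ℝ⟯) (x : M) :
    sectionVal (𝒢.leftBracket X (sectionSMul f Y)) x = f x • sectionVal (𝒢.leftBracket X Y) x +
      (show ℝ from mfderiv 𝓘(ℝ, EM) 𝓘(ℝ, ℝ) f x (𝒢.anchorMap x (sectionVal X x))) •
        sectionVal Y x := by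
  have : IsManifold 𝓘(ℝ, EG) 1 G := .of_le (n := ∞) (by simp)
  have hu := 𝒢.tgt_unit x
  have hf : ∀ y, y = x → HasMFDerivAt 𝓘(ℝ, EM) 𝓘(ℝ, ℝ) f y
      (show TangentSpace 𝓘(ℝ, EM) y →L[ℝ] TangentSpace 𝓘(ℝ, ℝ) (f y) from
        mfderiv 𝓘(ℝ, EM) 𝓘(ℝ, ℝ) f x) := by
    rintro y rfl; exact ((f.contMDiff _).mdifferentiableAt (by simp)).hasMFDerivAt
  have ht : HasMFDerivAt 𝓘(ℝ, EG) 𝓘(ℝ, EM) 𝒢.tgt (𝒢.unit x) _ :=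
    ((𝒢.tgt.contMDiff _).mdifferentiableAt (by simp)).hasMFDerivAt
  have hft := HasMFDerivAt.comp (𝒢.unit x) (hf _ hu) ht
  have h1 := mlieBracket_smul_right (V := 𝒢.leftInvariant X) hft.mdifferentiableAt
    (𝒢.mdifferentiableAt_leftInvariant Y (𝒢.unit x))
  have h3 : mfderiv 𝓘(ℝ, EG) 𝓘(ℝ, ℝ) (f ∘ 𝒢.tgt) (𝒢.unit x) (𝒢.leftInvariant X (𝒢.unit x)) =
      mfderiv 𝓘(ℝ, EM) 𝓘(ℝ, ℝ) f x (𝒢.anchorMap x (sectionVal X x)) := by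
    rw [hft.mfderiv, leftInvariant_unit]
    rfl
  have h4 : (f ∘ 𝒢.tgt) (𝒢.unit x) = f x := congrArg f hu
  apply Subtype.ext
  rw [sectionVal_leftBracket, 𝒢.leftInvariant_sectionSMul]
  refine h1.trans ((add_comm _ _).trans ?_)
  exact congrArg₂ (fun a b : EG => a + b)
    (congrArg (fun a : ℝ => a • (show EG from mlieBracket 𝓘(ℝ, EG) (𝒢.leftInvariant X)
      (𝒢.leftInvariant Y) (𝒢.unit x))) h4)
    (congrArg₂ (fun (a : ℝ) (b : EG) => a • b) h3 (𝒢.leftInvariant_unit Y x))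

/-- The Lie algebroid of a Lie groupoid. -/
noncomputable def lieAlgebroid : LieAlgebroid EM EG 𝒢.algebroidFiber where
  isSmoothSubbundle := 𝒢.isSmoothSubbundle_algebroidFiber
  anchor := 𝒢.anchorMap
  smooth_anchor := 𝒢.smoothBundleMap_anchorMap
  bracket :=
    have : IsManifold 𝓘(ℝ, EG) 1 G := .of_le (n := ∞) (by simp)
    LinearMap.mk₂ ℝ 𝒢.leftBracket
    (fun X X' Y => sectionVal_ext fun x => by
      rw [sectionVal_leftBracket, leftInvariant_add]
      exact mlieBracket_add_left (𝒢.mdifferentiableAt_leftInvariant X _)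
        (𝒢.mdifferentiableAt_leftInvariant X' _))
    (fun a X Y => sectionVal_ext fun x => by
      rw [sectionVal_leftBracket, leftInvariant_smul]
      exact mlieBracket_const_smul_left (𝒢.mdifferentiableAt_leftInvariant X _))
    (fun X Y Y' => sectionVal_ext fun x => by
      rw [sectionVal_leftBracket, leftInvariant_add]
      exact mlieBracket_add_right (𝒢.mdifferentiableAt_leftInvariant Y _)
        (𝒢.mdifferentiableAt_leftInvariant Y' _))
    (fun a X Y => sectionVal_ext fun x => by
      rw [sectionVal_leftBracket, leftInvariant_smul]
      exact mlieBracket_const_smul_right (𝒢.mdifferentiableAt_leftInvariant Y _))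
  bracket_self X := sectionVal_ext fun x => by
    rw [LinearMap.mk₂_apply, sectionVal_leftBracket, mlieBracket_self]
    rfl
  jacobi := 𝒢.leftBracket_jacobi
  leibniz := 𝒢.leftBracket_sectionSMul

theorem isLieAlgebroid_lieAlgebroid : 𝒢.IsLieAlgebroid 𝒢.lieAlgebroid where
  leftInvariant_bracket X Y g := congrFun (𝒢.leftInvariant_leftBracket X Y) g
  anchor_eq _ _ := rfl

end LieGroupoid

/-! ### Inversion, right translations and right-invariant fields. -/

section ProductFields

open Filter Set VectorField
open scoped Topology

variable {C C' : Type*} [NormedAddCommGroup C] [NormedSpace ℝ C] [NormedAddCommGroup C']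
  [NormedSpace ℝ C']

/-- Vector fields on the two factors of a product of vector spaces commute. -/
theorem lieBracket_prod_eq_zero {a : C → C} {b : C' → C'} {p : C × C'}
    (ha : DifferentiableAt ℝ a p.1) (hb : DifferentiableAt ℝ b p.2) :
    lieBracket ℝ (fun q : C × C' => (a q.1, (0 : C'))) (fun q : C × C' => ((0 : C), b q.2)) p =
      0 := by
  have h1 : HasFDerivAt (fun q : C × C' => (a q.1, (0 : C'))) _ p :=
    (ha.hasFDerivAt.comp p hasFDerivAt_fst).prodMk (hasFDerivAt_const 0 p)
  have h2 : HasFDerivAt (fun q : C × C' => ((0 : C), b q.2)) _ p :=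
    (hasFDerivAt_const 0 p).prodMk (hb.hasFDerivAt.comp p hasFDerivAt_snd)
  simp [lieBracket_eq, h1.fderiv, h2.fderiv]

end ProductFields

namespace LieGroupoid

open Filter Set VectorField
open scoped Topology

variable {EG EM G M : Type*} [NormedAddCommGroup EG] [NormedSpace ℝ EG]
    [NormedAddCommGroup EM] [NormedSpace ℝ EM] [TopologicalSpace G] [ChartedSpace EG G]
    [TopologicalSpace M] [ChartedSpace EM M] (𝒢 : LieGroupoid EG EM G M)

theorem hasMFDerivAt_inv (g : G) : HasMFDerivAt 𝓘(ℝ, EG) 𝓘(ℝ, EG) 𝒢.inv g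
    (mfderiv 𝓘(ℝ, EG) 𝓘(ℝ, EG) 𝒢.inv g) :=
  ((𝒢.inv.contMDiff g).mdifferentiableAt (by simp)).hasMFDerivAt

theorem mfderiv_inv_inv (g : G) (v : TangentSpace 𝓘(ℝ, EG) g) :
    mfderiv 𝓘(ℝ, EG) 𝓘(ℝ, EG) 𝒢.inv (𝒢.inv g) (mfderiv 𝓘(ℝ, EG) 𝓘(ℝ, EG) 𝒢.inv g v) = v := by
  have h1 := (HasMFDerivAt.comp g (𝒢.hasMFDerivAt_inv (𝒢.inv g)) (𝒢.hasMFDerivAt_inv g)).mfderiv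
  have h2 : 𝒢.inv ∘ 𝒢.inv = id := funext 𝒢.inv_inv
  rw [mfderiv_congr h2, mfderiv_id] at h1
  exact (DFunLike.congr_fun h1 v).symm

theorem mfderiv_tgt_inv (g : G) (v : TangentSpace 𝓘(ℝ, EG) g) :
    mfderiv 𝓘(ℝ, EG) 𝓘(ℝ, EM) 𝒢.tgt (𝒢.inv g) (mfderiv 𝓘(ℝ, EG) 𝓘(ℝ, EG) 𝒢.inv g v) =
      mfderiv 𝓘(ℝ, EG) 𝓘(ℝ, EM) 𝒢.src g v := by
  have h0 : HasMFDerivAt 𝓘(ℝ, EG) 𝓘(ℝ, EM) 𝒢.tgt (𝒢.inv g) _ :=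
    ((𝒢.tgt.contMDiff _).mdifferentiableAt (by simp)).hasMFDerivAt
  have h1 := (HasMFDerivAt.comp g h0 (𝒢.hasMFDerivAt_inv g)).mfderiv
  have h2 : 𝒢.tgt ∘ 𝒢.inv = 𝒢.src := funext 𝒢.tgt_inv
  rw [mfderiv_congr h2] at h1
  exact (DFunLike.congr_fun h1 v).symm

/-- This expresses right translation through inversion and left translation, so that facts about
right-invariant fields follow from those about left-invariant ones. -/
theorem inv_mul_eq_inv {h w : G} (hw : 𝒢.src h = 𝒢.src w) :
    𝒢.mul (𝒢.inv h) w = 𝒢.inv (𝒢.mul (𝒢.inv w) h) := by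
  rw [𝒢.inv_mul_rev ((𝒢.tgt_inv w).trans hw.symm), 𝒢.inv_inv]

theorem inv_unit (x : M) : 𝒢.inv (𝒢.unit x) = 𝒢.unit x :=
  𝒢.inv_eq_of_mul_eq_unit (by rw [𝒢.tgt_unit, 𝒢.src_unit]) (by
    rw [𝒢.src_unit]
    have := 𝒢.unit_mul (𝒢.unit x)
    rwa [𝒢.src_unit] at this)

variable [FiniteDimensional ℝ EG] [FiniteDimensional ℝ EM]

/-- Maps `k ↦ k⁻¹ w` of an `α`-fibre, on vertical vectors. -/
theorem mfderivWithin_inv_mul {k w : G} {x : M} (hk : 𝒢.src k = x) (hw : 𝒢.src w = x)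
    {v : TangentSpace 𝓘(ℝ, EG) k} (hv : mfderiv 𝓘(ℝ, EG) 𝓘(ℝ, EM) 𝒢.src k v = 0) :
    mfderivWithin 𝓘(ℝ, EG) 𝓘(ℝ, EG) (fun h => 𝒢.mul (𝒢.inv h) w) {h | 𝒢.src h = x} k v =
      mfderiv 𝓘(ℝ, EG) 𝓘(ℝ, EG) 𝒢.inv (𝒢.mul (𝒢.inv w) k)
        (mfderivWithin 𝓘(ℝ, EG) 𝓘(ℝ, EG) (𝒢.mul (𝒢.inv w)) {h | 𝒢.src h = x} k v) := by
  have hx : 𝒢.tgt (𝒢.inv w) = x := (𝒢.tgt_inv w).trans hw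
  have h1 : MDifferentiableWithinAt 𝓘(ℝ, EG) 𝓘(ℝ, EG) (𝒢.mul (𝒢.inv w)) {h | 𝒢.src h = x} k := by
    have := 𝒢.mdifferentiableWithinAt_mul_left (g := 𝒢.inv w) (h := k) (hk.trans hx.symm)
    rwa [hx] at this
  have h2 := HasMFDerivAt.comp_hasMFDerivWithinAt k (𝒢.hasMFDerivAt_inv _) h1.hasMFDerivWithinAt
  have h3 : ∀ h ∈ {h | 𝒢.src h = x}, 𝒢.mul (𝒢.inv h) w = (𝒢.inv ∘ 𝒢.mul (𝒢.inv w)) h :=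
    fun h hh => 𝒢.inv_mul_eq_inv (Eq.trans hh hw.symm)
  refine Eq.trans ?_ (hasMFDerivWithinAt_fibre_unique (𝒢.isSubmersionAt_src _) 𝒢.src.contMDiff hk
    h2.mdifferentiableWithinAt.hasMFDerivWithinAt h2 hv)
  exact congrArg (fun D => (show EG →L[ℝ] EG from D) v) (mfderivWithin_congr h3 (h3 k hk))

/-- Because `h⁻¹ g = (g⁻¹ h)⁻¹`, on vectors of `A_{α(g)} G` the map `T(r_g ∘ i)` is left translation
by `g⁻¹` followed by the tangent map of inversion. -/
theorem rightInvTangent_eq {g : G} {v : TangentSpace 𝓘(ℝ, EG) (𝒢.unit (𝒢.src g))}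
    (hv : mfderiv 𝓘(ℝ, EG) 𝓘(ℝ, EM) 𝒢.src (𝒢.unit (𝒢.src g)) v = 0) :
    𝒢.rightInvTangent g v = mfderiv 𝓘(ℝ, EG) 𝓘(ℝ, EG) 𝒢.inv (𝒢.inv g)
      (mfderivWithin 𝓘(ℝ, EG) 𝓘(ℝ, EG) (𝒢.mul (𝒢.inv g)) {h | 𝒢.src h = 𝒢.src g}
        (𝒢.unit (𝒢.src g)) v) := by
  refine (𝒢.mfderivWithin_inv_mul (𝒢.src_unit _) rfl hv).trans ?_
  have h1 : 𝒢.mul (𝒢.inv g) (𝒢.unit (𝒢.src g)) = 𝒢.inv g := by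
    rw [← 𝒢.tgt_inv, 𝒢.mul_unit]
  exact congrArg (fun y => (show EG →L[ℝ] EG from mfderiv 𝓘(ℝ, EG) 𝓘(ℝ, EG) 𝒢.inv y) _) h1

theorem mfderiv_src_mul_left {g : G} {x : M} (hx : 𝒢.tgt g = x)
    {v : TangentSpace 𝓘(ℝ, EG) (𝒢.unit x)}
    (hv : mfderiv 𝓘(ℝ, EG) 𝓘(ℝ, EM) 𝒢.src (𝒢.unit x) v = 0) :
    mfderiv 𝓘(ℝ, EG) 𝓘(ℝ, EM) 𝒢.src g
      (show TangentSpace 𝓘(ℝ, EG) g from (show EG →L[ℝ] EG from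
        mfderivWithin 𝓘(ℝ, EG) 𝓘(ℝ, EG) (𝒢.mul g) {h | 𝒢.src h = x} (𝒢.unit x)) v) = 0 := by
  subst hx
  exact 𝒢.mfderiv_src_leftTangent hv

/-- Inversion exchanges `α` and `β`, so this reduces to the `α`-verticality of left-translated
vectors. -/
theorem mfderiv_tgt_rightInvTangent {g : G} {v : TangentSpace 𝓘(ℝ, EG) (𝒢.unit (𝒢.src g))}
    (hv : mfderiv 𝓘(ℝ, EG) 𝓘(ℝ, EM) 𝒢.src (𝒢.unit (𝒢.src g)) v = 0) :
    mfderiv 𝓘(ℝ, EG) 𝓘(ℝ, EM) 𝒢.tgt g (𝒢.rightInvTangent g v) = 0 := by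
  have h1 := 𝒢.mfderiv_tgt_inv (𝒢.inv g) (mfderivWithin 𝓘(ℝ, EG) 𝓘(ℝ, EG) (𝒢.mul (𝒢.inv g))
    {h | 𝒢.src h = 𝒢.src g} (𝒢.unit (𝒢.src g)) v)
  rw [𝒢.rightInvTangent_eq hv]
  refine Eq.trans ?_ (h1.trans (𝒢.mfderiv_src_mul_left (𝒢.tgt_inv g) hv))
  exact congrArg (fun y => (show EG →L[ℝ] EM from mfderiv 𝓘(ℝ, EG) 𝓘(ℝ, EM) 𝒢.tgt y) _)
    (𝒢.inv_inv g).symm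

/-- Translation by `g⁻¹` undoes translation by `g` on the `α`-fibre, and derivatives within the
fibre are unique on vertical vectors. -/
theorem mul_left_injective_on_vertical {g : G} {x : M} (hx : 𝒢.tgt g = x)
    {v : TangentSpace 𝓘(ℝ, EG) (𝒢.unit x)}
    (hv : mfderiv 𝓘(ℝ, EG) 𝓘(ℝ, EM) 𝒢.src (𝒢.unit x) v = 0)
    (h0 : mfderivWithin 𝓘(ℝ, EG) 𝓘(ℝ, EG) (𝒢.mul g) {h | 𝒢.src h = x} (𝒢.unit x) v = 0) :
    v = 0 := by
  subst hx
  have hd : MDifferentiableWithinAt 𝓘(ℝ, EG) 𝓘(ℝ, EG) (𝒢.mul (𝒢.inv g))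
      {h | 𝒢.src h = 𝒢.src g} g := by
    have := 𝒢.mdifferentiableWithinAt_mul_left (g := 𝒢.inv g) (h := g) (𝒢.tgt_inv g).symm
    rwa [𝒢.tgt_inv] at this
  have h1 := 𝒢.mfderivWithin_leftTangent rfl hd hv
  have h2 : 𝒢.leftTangent g v = 0 := h0
  rw [h2, map_zero] at h1
  have h3 : HasMFDerivWithinAt 𝓘(ℝ, EG) 𝓘(ℝ, EG) (fun h => 𝒢.mul (𝒢.inv g) (𝒢.mul g h))
      {h | 𝒢.src h = 𝒢.tgt g} (𝒢.unit (𝒢.tgt g))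
      (ContinuousLinearMap.id ℝ (TangentSpace 𝓘(ℝ, EG) (𝒢.unit (𝒢.tgt g)))) := by
    have h4 : ∀ h, 𝒢.src h = 𝒢.tgt g → 𝒢.mul (𝒢.inv g) (𝒢.mul g h) = h := fun h hh =>
      𝒢.inv_mul_cancel_left hh.symm
    have h5 : (fun h => 𝒢.mul (𝒢.inv g) (𝒢.mul g h))
        =ᶠ[𝓝[{h | 𝒢.src h = 𝒢.tgt g}] 𝒢.unit (𝒢.tgt g)] id :=
      eventually_of_mem self_mem_nhdsWithin h4
    exact HasMFDerivWithinAt.congr_of_eventuallyEq (hasMFDerivWithinAt_id _ _) h5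
      (h4 _ (𝒢.src_unit _))
  have h6 := hasMFDerivWithinAt_fibre_unique (𝒢.isSubmersionAt_src _) 𝒢.src.contMDiff
    (𝒢.src_unit (𝒢.tgt g)) h3 h3.mdifferentiableWithinAt.hasMFDerivWithinAt hv
  exact h6.trans h1.symm

theorem leftTangent_injective {g : G} {v : TangentSpace 𝓘(ℝ, EG) (𝒢.unit (𝒢.tgt g))}
    (hv : mfderiv 𝓘(ℝ, EG) 𝓘(ℝ, EM) 𝒢.src (𝒢.unit (𝒢.tgt g)) v = 0)
    (h0 : 𝒢.leftTangent g v = 0) : v = 0 :=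
  𝒢.mul_left_injective_on_vertical rfl hv h0

theorem rightInvTangent_injective {g : G} {v : TangentSpace 𝓘(ℝ, EG) (𝒢.unit (𝒢.src g))}
    (hv : mfderiv 𝓘(ℝ, EG) 𝓘(ℝ, EM) 𝒢.src (𝒢.unit (𝒢.src g)) v = 0)
    (h0 : 𝒢.rightInvTangent g v = 0) : v = 0 := by
  rw [𝒢.rightInvTangent_eq hv] at h0
  refine 𝒢.mul_left_injective_on_vertical (𝒢.tgt_inv g) hv ?_
  have h1 := 𝒢.mfderiv_inv_inv (𝒢.inv g) (mfderivWithin 𝓘(ℝ, EG) 𝓘(ℝ, EG) (𝒢.mul (𝒢.inv g))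
    {h | 𝒢.src h = 𝒢.src g} (𝒢.unit (𝒢.src g)) v)
  refine h1.symm.trans ?_
  exact (congrArg (mfderiv 𝓘(ℝ, EG) 𝓘(ℝ, EG) 𝒢.inv (𝒢.inv (𝒢.inv g))) h0).trans (map_zero _)

variable [IsManifold 𝓘(ℝ, EG) ∞ G]

theorem contMDiffOn_rightInvTangent {U : Set G} (hU : IsOpen U)
    {ξ : ∀ g, TangentSpace 𝓘(ℝ, EG) (𝒢.unit (𝒢.src g))}
    (hv : ∀ g ∈ U, mfderiv 𝓘(ℝ, EG) 𝓘(ℝ, EM) 𝒢.src (𝒢.unit (𝒢.src g)) (ξ g) = 0)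
    (hξ : ContMDiffOn 𝓘(ℝ, EG) 𝓘(ℝ, EG).tangent ∞
      (fun g => (⟨𝒢.unit (𝒢.src g), ξ g⟩ : TangentBundle 𝓘(ℝ, EG) G)) U) :
    ContMDiffOn 𝓘(ℝ, EG) 𝓘(ℝ, EG).tangent ∞
      (fun g => (⟨g, 𝒢.rightInvTangent g (ξ g)⟩ : TangentBundle 𝓘(ℝ, EG) G)) U := by
  have h1 : ContMDiffOn (𝓘(ℝ, EG).prod 𝓘(ℝ, EG)) 𝓘(ℝ, EG) ∞
      (fun p : G × G => 𝒢.mul (𝒢.inv p.2) p.1) {p | 𝒢.src p.1 = 𝒢.src p.2} :=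
    𝒢.smooth_mul.comp ((𝒢.inv.contMDiff.comp contMDiff_snd).prodMk contMDiff_fst).contMDiffOn
      fun p hp => (𝒢.tgt_inv _).trans (Eq.symm hp)
  refine (𝒢.contMDiffOn_fibreDerivative 𝒢.src.contMDiff (ψ := fun g h => 𝒢.mul (𝒢.inv h) g)
    h1 hU hv hξ).congr fun g _ => ?_
  have h2 : 𝒢.mul (𝒢.inv (𝒢.unit (𝒢.src g))) g = g := by
    rw [𝒢.inv_unit, 𝒢.unit_mul]
  exact TotalSpace.ext h2.symm HEq.rfl

/-- Inversion carries `←X` to `-→X`; the minus sign comes from the convention in the definition of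
`→X`. -/
theorem neg_rightInvariant (X : 𝒢.AlgebroidSection) (g : G) :
    -𝒢.rightInvariant X g = mfderiv 𝓘(ℝ, EG) 𝓘(ℝ, EG) 𝒢.inv (𝒢.inv g)
      (𝒢.leftInvariant X (𝒢.inv g)) := by
  rw [rightInvariant, neg_neg, 𝒢.rightInvTangent_eq (sectionVal X (𝒢.src g)).2,
    𝒢.leftInvariant_eq X (𝒢.tgt_inv g)]

theorem mfderiv_inv_leftInvariant (X : 𝒢.AlgebroidSection) (g : G) :
    mfderiv 𝓘(ℝ, EG) 𝓘(ℝ, EG) 𝒢.inv g (𝒢.leftInvariant X g) =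
      -𝒢.rightInvariant X (𝒢.inv g) := by
  rw [neg_rightInvariant]
  exact congrArg (fun y => (show EG from mfderiv 𝓘(ℝ, EG) 𝓘(ℝ, EG) 𝒢.inv y
    (𝒢.leftInvariant X y))) (𝒢.inv_inv g).symm

theorem mfderiv_tgt_rightInvariant (X : 𝒢.AlgebroidSection) (g : G) :
    mfderiv 𝓘(ℝ, EG) 𝓘(ℝ, EM) 𝒢.tgt g (𝒢.rightInvariant X g) = 0 := by
  rw [rightInvariant, map_neg, 𝒢.mfderiv_tgt_rightInvTangent (sectionVal X (𝒢.src g)).2, neg_zero]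

theorem contMDiff_neg_rightInvariant (X : 𝒢.AlgebroidSection) :
    ContMDiff 𝓘(ℝ, EG) 𝓘(ℝ, EG).tangent ∞
      (fun g => (⟨g, -𝒢.rightInvariant X g⟩ : TangentBundle 𝓘(ℝ, EG) G)) := by
  simp only [rightInvariant, neg_neg]
  exact contMDiffOn_univ.1 (𝒢.contMDiffOn_rightInvTangent isOpen_univ
    (fun g _ => (sectionVal X (𝒢.src g)).2)
    ((𝒢.contMDiff_algebroidSection X).comp 𝒢.src.contMDiff).contMDiffOn)

theorem contMDiff_rightInvariant (X : 𝒢.AlgebroidSection) :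
    ContMDiff 𝓘(ℝ, EG) 𝓘(ℝ, EG).tangent ∞
      (fun g => (⟨g, 𝒢.rightInvariant X g⟩ : TangentBundle 𝓘(ℝ, EG) G)) := by
  have h1 := (𝒢.contMDiff_neg_rightInvariant X).neg_section
  simp only [Pi.neg_apply, neg_neg] at h1
  exact h1

end LieGroupoid

/-! ### Commutation of left- and right-invariant fields. -/

namespace LieGroupoid

open Filter Set VectorField
open scoped Topology

variable {EG EM G M : Type*} [NormedAddCommGroup EG] [NormedSpace ℝ EG]
    [NormedAddCommGroup EM] [NormedSpace ℝ EM] [TopologicalSpace G] [ChartedSpace EG G]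
    [TopologicalSpace M] [ChartedSpace EM M] (𝒢 : LieGroupoid EG EM G M)

section Commutation

variable {e e' : OpenPartialHomeomorph G (M × FibreModel EG EM)}

/-- The product `c⁻¹ g d` of elements of two `α`-fibres, in the coordinates of the fibres. -/
noncomputable def fibreProduct (e e' : OpenPartialHomeomorph G (M × FibreModel EG EM)) (g : G)
    (z : FibreModel EG EM × FibreModel EG EM) : G :=
  𝒢.mul (𝒢.mul (𝒢.inv (e.symm (𝒢.src g, z.1))) g) (e'.symm (𝒢.tgt g, z.2))

theorem contMDiffAt_fibreProduct (he : IsSubmersionChart 𝒢.src e) (he' : IsSubmersionChart 𝒢.src e')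
    (g : G) {z : FibreModel EG EM × FibreModel EG EM} (hz : (𝒢.src g, z.1) ∈ e.target)
    (hz' : (𝒢.tgt g, z.2) ∈ e'.target) :
    ContMDiffAt 𝓘(ℝ, FibreModel EG EM × FibreModel EG EM) 𝓘(ℝ, EG) ∞ (𝒢.fibreProduct e e' g) z := by
  have h1 : ContMDiff 𝓘(ℝ, FibreModel EG EM × FibreModel EG EM) 𝓘(ℝ, FibreModel EG EM) ∞
      (Prod.fst : FibreModel EG EM × FibreModel EG EM → _) := contDiff_fst.contMDiff
  have h2 : ContMDiff 𝓘(ℝ, FibreModel EG EM × FibreModel EG EM) 𝓘(ℝ, FibreModel EG EM) ∞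
      (Prod.snd : FibreModel EG EM × FibreModel EG EM → _) := contDiff_snd.contMDiff
  let O : Set (FibreModel EG EM × FibreModel EG EM) :=
    {z | (𝒢.src g, z.1) ∈ e.target ∧ (𝒢.tgt g, z.2) ∈ e'.target}
  have hO : O ∈ 𝓝 z := by
    refine inter_mem ?_ ?_
    · exact continuous_fst.continuousAt.eventually (eventually_fibre_mem_target e hz)
    · exact continuous_snd.continuousAt.eventually (eventually_fibre_mem_target e' hz')
  refine ContMDiffOn.contMDiffAt ?_ hO
  have h3 : ContMDiffOn 𝓘(ℝ, FibreModel EG EM × FibreModel EG EM) 𝓘(ℝ, EG) ∞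
      (fun z => e.symm (𝒢.src g, z.1)) O := fun z hz =>
    ((he.contMDiffAt_fibre hz.1).comp z (h1 z)).contMDiffWithinAt
  have h4 : ContMDiffOn 𝓘(ℝ, FibreModel EG EM × FibreModel EG EM) 𝓘(ℝ, EG) ∞
      (fun z => e'.symm (𝒢.tgt g, z.2)) O := fun z hz =>
    ((he'.contMDiffAt_fibre hz.2).comp z (h2 z)).contMDiffWithinAt
  have h5 : ContMDiffOn 𝓘(ℝ, FibreModel EG EM × FibreModel EG EM) 𝓘(ℝ, EG) ∞
      (fun z => 𝒢.mul (𝒢.inv (e.symm (𝒢.src g, z.1))) g) O :=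
    𝒢.smooth_mul.comp ((𝒢.inv.contMDiff.comp_contMDiffOn h3).prodMk contMDiffOn_const)
      fun z hz => (𝒢.tgt_inv _).trans (he.apply_symm hz.1)
  refine 𝒢.smooth_mul.comp (h5.prodMk h4) fun z hz => ?_
  exact (𝒢.tgt_mul _ _ ((𝒢.tgt_inv _).trans (he.apply_symm hz.1))).trans (he'.apply_symm hz.2).symm

variable [FiniteDimensional ℝ EG] [FiniteDimensional ℝ EM] [IsManifold 𝓘(ℝ, EG) ∞ G]

/-- The vector field `-→X` is related to `←X` by the maps `k ↦ k⁻¹ w`. -/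
theorem mfderivWithin_inv_mul_leftInvariant (X : 𝒢.AlgebroidSection) {k w : G} {x : M}
    (hk : 𝒢.src k = x) (hw : 𝒢.src w = x) :
    mfderivWithin 𝓘(ℝ, EG) 𝓘(ℝ, EG) (fun h => 𝒢.mul (𝒢.inv h) w) {h | 𝒢.src h = x} k
      (𝒢.leftInvariant X k) = -𝒢.rightInvariant X (𝒢.mul (𝒢.inv k) w) := by
  subst hw
  have h1 := 𝒢.mfderivWithin_mul_leftInvariant X (g := 𝒢.inv w) (k := k)
    (hk.trans (𝒢.tgt_inv w).symm)
  rw [𝒢.tgt_inv] at h1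
  refine (𝒢.mfderivWithin_inv_mul hk rfl (𝒢.mfderiv_src_leftInvariant X k)).trans ?_
  rw [h1, 𝒢.mfderiv_inv_leftInvariant]
  exact congrArg (fun y => (show EG from -𝒢.rightInvariant X y)) (𝒢.inv_mul_eq_inv hk).symm

/-- With `d` fixed, associativity makes the product the map `c ↦ c⁻¹ (g d)` of an `α`-fibre, which
relates `←X` to `-→X`. -/
theorem mfderiv_fibreProduct_left (he : IsSubmersionChart 𝒢.src e)
    (he' : IsSubmersionChart 𝒢.src e') (X : 𝒢.AlgebroidSection) (g : G)
    {z : FibreModel EG EM × FibreModel EG EM} (hz : (𝒢.src g, z.1) ∈ e.target)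
    (hz' : (𝒢.tgt g, z.2) ∈ e'.target) :
    mfderiv 𝓘(ℝ, FibreModel EG EM × FibreModel EG EM) 𝓘(ℝ, EG) (𝒢.fibreProduct e e' g) z
      ((IsSubmersionChart.fibreField e (𝒢.leftInvariant X) (𝒢.src g) z.1,
        (0 : FibreModel EG EM)) : FibreModel EG EM × FibreModel EG EM) =
      -𝒢.rightInvariant X (𝒢.fibreProduct e e' g z) := by
  have h1 : HasMFDerivAt 𝓘(ℝ, FibreModel EG EM) 𝓘(ℝ, FibreModel EG EM × FibreModel EG EM)
      (fun a => ((a, z.2) : FibreModel EG EM × FibreModel EG EM)) z.1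
      (ContinuousLinearMap.inl ℝ (FibreModel EG EM) (FibreModel EG EM)) :=
    (hasFDerivAt_prodMk_left z.1 z.2).hasMFDerivAt
  have h2 : HasMFDerivAt 𝓘(ℝ, FibreModel EG EM × FibreModel EG EM) 𝓘(ℝ, EG)
      (𝒢.fibreProduct e e' g) (z.1, z.2) _ :=
    ((𝒢.contMDiffAt_fibreProduct he he' g hz hz').mdifferentiableAt (by simp)).hasMFDerivAt
  have h3 := DFunLike.congr_fun (HasMFDerivAt.comp z.1 h2 h1).mfderiv
    (IsSubmersionChart.fibreField e (𝒢.leftInvariant X) (𝒢.src g) z.1)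
  refine h3.symm.trans ?_
  set d := e'.symm (𝒢.tgt g, z.2) with hd
  have hsd : 𝒢.src d = 𝒢.tgt g := he'.apply_symm hz'
  have hgd : 𝒢.src (𝒢.mul g d) = 𝒢.src g := 𝒢.src_mul _ _ hsd.symm
  have hφ : MDifferentiableWithinAt 𝓘(ℝ, EG) 𝓘(ℝ, EG) (fun k => 𝒢.mul (𝒢.inv k) (𝒢.mul g d))
      {k | 𝒢.src k = 𝒢.src g} (e.symm (𝒢.src g, z.1)) := by
    refine ((𝒢.smooth_mul.comp (𝒢.inv.contMDiff.prodMk contMDiff_const).contMDiffOn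
      fun k (hk : 𝒢.src k = 𝒢.src g) => ?_) _ (he.apply_symm hz)).mdifferentiableWithinAt (by simp)
    exact (𝒢.tgt_inv k).trans (hk.trans hgd.symm)
  have h4 := he.mfderiv_fibreField 𝒢.src.contMDiff (𝒢.mfderiv_src_leftInvariant X) hz hφ
  rw [𝒢.mfderivWithin_inv_mul_leftInvariant X (he.apply_symm hz) hgd] at h4
  have h5 : ∀ a, (𝒢.src g, a) ∈ e.target → 𝒢.fibreProduct e e' g (a, z.2) =
      𝒢.mul (𝒢.inv (e.symm (𝒢.src g, a))) (𝒢.mul g d) := fun a ha =>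
    (𝒢.mul_assoc _ _ _ ((𝒢.tgt_inv _).trans (he.apply_symm ha)) hsd.symm).symm
  have h6 : (𝒢.fibreProduct e e' g ∘ fun a => (a, z.2)) =ᶠ[𝓝 z.1]
      fun a => 𝒢.mul (𝒢.inv (e.symm (𝒢.src g, a))) (𝒢.mul g d) :=
    (eventually_fibre_mem_target e hz).mono h5
  have h7 := DFunLike.congr_fun (h6.mfderiv_eq (I := 𝓘(ℝ, FibreModel EG EM)) (I' := 𝓘(ℝ, EG)))
    (IsSubmersionChart.fibreField e (𝒢.leftInvariant X) (𝒢.src g) z.1)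
  refine h7.trans (h4.trans ?_)
  exact congrArg (fun y => (show EG from -𝒢.rightInvariant X y)) (h5 z.1 hz).symm

/-- With `c` fixed, the product is left translation by `c⁻¹ g`, which relates `←Y` to itself. -/
theorem mfderiv_fibreProduct_right (he : IsSubmersionChart 𝒢.src e)
    (he' : IsSubmersionChart 𝒢.src e') (Y : 𝒢.AlgebroidSection) (g : G)
    {z : FibreModel EG EM × FibreModel EG EM} (hz : (𝒢.src g, z.1) ∈ e.target)
    (hz' : (𝒢.tgt g, z.2) ∈ e'.target) :
    mfderiv 𝓘(ℝ, FibreModel EG EM × FibreModel EG EM) 𝓘(ℝ, EG) (𝒢.fibreProduct e e' g) z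
      (((0 : FibreModel EG EM), IsSubmersionChart.fibreField e' (𝒢.leftInvariant Y) (𝒢.tgt g) z.2) :
        FibreModel EG EM × FibreModel EG EM) =
      𝒢.leftInvariant Y (𝒢.fibreProduct e e' g z) := by
  have h1 : HasMFDerivAt 𝓘(ℝ, FibreModel EG EM) 𝓘(ℝ, FibreModel EG EM × FibreModel EG EM)
      (fun a => ((z.1, a) : FibreModel EG EM × FibreModel EG EM)) z.2
      (ContinuousLinearMap.inr ℝ (FibreModel EG EM) (FibreModel EG EM)) :=
    (hasFDerivAt_prodMk_right z.1 z.2).hasMFDerivAt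
  have h2 : HasMFDerivAt 𝓘(ℝ, FibreModel EG EM × FibreModel EG EM) 𝓘(ℝ, EG)
      (𝒢.fibreProduct e e' g) (z.1, z.2) _ :=
    ((𝒢.contMDiffAt_fibreProduct he he' g hz hz').mdifferentiableAt (by simp)).hasMFDerivAt
  have h3 := DFunLike.congr_fun (HasMFDerivAt.comp z.2 h2 h1).mfderiv
    (IsSubmersionChart.fibreField e' (𝒢.leftInvariant Y) (𝒢.tgt g) z.2)
  refine h3.symm.trans ?_
  set w := 𝒢.mul (𝒢.inv (e.symm (𝒢.src g, z.1))) g with hw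
  have htw : 𝒢.tgt w = 𝒢.tgt g := 𝒢.tgt_mul _ _ ((𝒢.tgt_inv _).trans (he.apply_symm hz))
  have hsd : 𝒢.src (e'.symm (𝒢.tgt g, z.2)) = 𝒢.tgt w := (he'.apply_symm hz').trans htw.symm
  have hφ := 𝒢.mdifferentiableWithinAt_mul_left hsd
  have h8 := 𝒢.mfderivWithin_mul_leftInvariant Y hsd
  rw [htw] at hφ h8
  have h4 := he'.mfderiv_fibreField 𝒢.src.contMDiff (𝒢.mfderiv_src_leftInvariant Y) hz' hφ
  exact h4.trans h8

variable [IsManifold 𝓘(ℝ, EM) ∞ M]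

/-- Right-invariant and left-invariant vector fields commute. -/
theorem mlieBracket_neg_rightInvariant_leftInvariant (X Y : 𝒢.AlgebroidSection) (g : G) :
    mlieBracket 𝓘(ℝ, EG) (fun g => -𝒢.rightInvariant X g) (𝒢.leftInvariant Y) g = 0 := by
  have : CompleteSpace EG := FiniteDimensional.complete ℝ EG
  have : IsManifold 𝓘(ℝ, EG) 2 G := .of_le (n := ∞) two_le_smooth
  obtain ⟨e, hp, he⟩ := exists_chart_of_isSubmersionAt (𝒢.isSubmersionAt_src (𝒢.unit (𝒢.src g)))
  obtain ⟨e', hp', he'⟩ := exists_chart_of_isSubmersionAt (𝒢.isSubmersionAt_src (𝒢.unit (𝒢.tgt g)))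
  let z : FibreModel EG EM × FibreModel EG EM :=
    ((e (𝒢.unit (𝒢.src g))).2, (e' (𝒢.unit (𝒢.tgt g))).2)
  have hz : (𝒢.src g, z.1) ∈ e.target := by
    have := he.mem_target hp
    rwa [𝒢.src_unit] at this
  have hz' : (𝒢.tgt g, z.2) ∈ e'.target := by
    have := he'.mem_target hp'
    rwa [𝒢.src_unit] at this
  have hcz : e.symm (𝒢.src g, z.1) = 𝒢.unit (𝒢.src g) := by
    have := he.symm_apply hp
    rwa [𝒢.src_unit] at this
  have hcz' : e'.symm (𝒢.tgt g, z.2) = 𝒢.unit (𝒢.tgt g) := by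
    have := he'.symm_apply hp'
    rwa [𝒢.src_unit] at this
  let a := IsSubmersionChart.fibreField e (𝒢.leftInvariant X) (𝒢.src g)
  let b := IsSubmersionChart.fibreField e' (𝒢.leftInvariant Y) (𝒢.tgt g)
  have ha : ContMDiffAt 𝓘(ℝ, FibreModel EG EM) 𝓘(ℝ, FibreModel EG EM) ∞ a z.1 :=
    (he.contMDiffOn_fibreField (𝒢.contMDiff_leftInvariant X) _).contMDiffAt
      (eventually_fibre_mem_target e hz)
  have hb : ContMDiffAt 𝓘(ℝ, FibreModel EG EM) 𝓘(ℝ, FibreModel EG EM) ∞ b z.2 :=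
    (he'.contMDiffOn_fibreField (𝒢.contMDiff_leftInvariant Y) _).contMDiffAt
      (eventually_fibre_mem_target e' hz')
  let C := FibreModel EG EM × FibreModel EG EM
  let A : ∀ y : C, TangentSpace 𝓘(ℝ, C) y := fun q => ((a q.1, 0) : C)
  let B : ∀ y : C, TangentSpace 𝓘(ℝ, C) y := fun q => ((0, b q.2) : C)
  have hA : MDifferentiableAt 𝓘(ℝ, C) 𝓘(ℝ, C).tangent
      (fun y => (⟨y, A y⟩ : TangentBundle 𝓘(ℝ, C) C)) z := by
    have h1 : ContMDiffOn 𝓘(ℝ, C) 𝓘(ℝ, C) ∞ (fun q : C => ((a q.1, 0) : C))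
        {q | (𝒢.src g, q.1) ∈ e.target} := by
      rw [contMDiffOn_iff_contDiffOn]
      exact ((he.contMDiffOn_fibreField (𝒢.contMDiff_leftInvariant X) _).contDiffOn.comp
        contDiffOn_fst fun q hq => hq).prodMk contDiffOn_const
    have h2 := (contMDiffOn_tangent_vectorSpace contMDiffOn_id h1).contMDiffAt (x := z)
      (continuous_fst.continuousAt.eventually (eventually_fibre_mem_target e hz))
    exact h2.mdifferentiableAt (by simp)
  have hB : MDifferentiableAt 𝓘(ℝ, C) 𝓘(ℝ, C).tangent
      (fun y => (⟨y, B y⟩ : TangentBundle 𝓘(ℝ, C) C)) z := by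
    have h1 : ContMDiffOn 𝓘(ℝ, C) 𝓘(ℝ, C) ∞ (fun q : C => ((0, b q.2) : C))
        {q | (𝒢.tgt g, q.2) ∈ e'.target} := by
      rw [contMDiffOn_iff_contDiffOn]
      exact contDiffOn_const.prodMk ((he'.contMDiffOn_fibreField
        (𝒢.contMDiff_leftInvariant Y) _).contDiffOn.comp contDiffOn_snd fun q hq => hq)
    have h2 := (contMDiffOn_tangent_vectorSpace contMDiffOn_id h1).contMDiffAt (x := z)
      (continuous_snd.continuousAt.eventually (eventually_fibre_mem_target e' hz'))
    exact h2.mdifferentiableAt (by simp)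
  have hev : ∀ᶠ q : C in 𝓝 z, (𝒢.src g, q.1) ∈ e.target ∧ (𝒢.tgt g, q.2) ∈ e'.target :=
    (continuous_fst.continuousAt.eventually (eventually_fibre_mem_target e hz)).and
      (continuous_snd.continuousAt.eventually (eventually_fibre_mem_target e' hz'))
  -- The point `z` stands for two units, so the product there is `g`, the point at which the bracket
  -- is wanted.
  have hmz : 𝒢.fibreProduct e e' g z = g := by
    rw [fibreProduct, hcz, hcz', 𝒢.inv_unit, 𝒢.unit_mul, 𝒢.mul_unit]
  have key := mfderiv_mlieBracket_of_related
    ((𝒢.contMDiffAt_fibreProduct he he' g hz hz').of_le two_le_smooth) hA hB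
    ((𝒢.contMDiff_neg_rightInvariant X _).mdifferentiableAt (by simp))
    (𝒢.mdifferentiableAt_leftInvariant Y _)
    (hev.mono fun q hq => 𝒢.mfderiv_fibreProduct_left he he' X g hq.1 hq.2)
    (hev.mono fun q hq => 𝒢.mfderiv_fibreProduct_right he he' Y g hq.1 hq.2)
  have h0 : mlieBracket 𝓘(ℝ, C) A B z = 0 := by
    rw [← mlieBracketWithin_univ, mlieBracketWithin_eq_lieBracketWithin, lieBracketWithin_univ]
    exact lieBracket_prod_eq_zero (ha.contDiffAt.differentiableAt (by simp))
      (hb.contDiffAt.differentiableAt (by simp))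
  rw [h0, map_zero] at key
  refine Eq.trans ?_ key.symm
  exact congrArg (fun y => (show EG from mlieBracket 𝓘(ℝ, EG) (fun g => -𝒢.rightInvariant X g)
    (𝒢.leftInvariant Y) y)) hmz.symm

end Commutation

variable [FiniteDimensional ℝ EG] [FiniteDimensional ℝ EM] [IsManifold 𝓘(ℝ, EG) ∞ G]
    [IsManifold 𝓘(ℝ, EM) ∞ M]

/-- Inversion relates `←X` to `-→X`. The signs of the two arguments cancel in the bracket, whereas
the image of `←⟦X, Y⟧` keeps its own. -/
theorem mlieBracket_rightInvariant (X Y : 𝒢.AlgebroidSection) (g : G) :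
    mlieBracket 𝓘(ℝ, EG) (𝒢.rightInvariant X) (𝒢.rightInvariant Y) g =
      -𝒢.rightInvariant (𝒢.leftBracket X Y) g := by
  have : CompleteSpace EG := FiniteDimensional.complete ℝ EG
  have : IsManifold 𝓘(ℝ, EG) 2 G := .of_le (n := ∞) two_le_smooth
  have : IsManifold 𝓘(ℝ, EG) 1 G := .of_le (n := ∞) (by simp)
  have key := mfderiv_mlieBracket_of_related ((𝒢.inv.contMDiff (𝒢.inv g)).of_le two_le_smooth)
    (𝒢.mdifferentiableAt_leftInvariant X _) (𝒢.mdifferentiableAt_leftInvariant Y _)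
    ((𝒢.contMDiff_neg_rightInvariant X _).mdifferentiableAt (by simp))
    ((𝒢.contMDiff_neg_rightInvariant Y _).mdifferentiableAt (by simp))
    (Eventually.of_forall (𝒢.mfderiv_inv_leftInvariant X))
    (Eventually.of_forall (𝒢.mfderiv_inv_leftInvariant Y))
  rw [← 𝒢.leftInvariant_leftBracket, 𝒢.mfderiv_inv_leftInvariant] at key
  have h2 : ∀ X : 𝒢.AlgebroidSection,
      (fun g => -𝒢.rightInvariant X g) = (-1 : ℝ) • 𝒢.rightInvariant X := fun X =>
    funext fun g => (neg_one_smul ℝ (𝒢.rightInvariant X g)).symm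
  have h3 : mlieBracket 𝓘(ℝ, EG) (fun g => -𝒢.rightInvariant X g)
      (fun g => -𝒢.rightInvariant Y g) =
      mlieBracket 𝓘(ℝ, EG) (𝒢.rightInvariant X) (𝒢.rightInvariant Y) := by
    funext k
    rw [h2, h2, mlieBracket_const_smul_left, mlieBracket_const_smul_right, smul_smul]
    · norm_num
    · exact (𝒢.contMDiff_rightInvariant Y k).mdifferentiableAt (by simp)
    · exact (𝒢.contMDiff_rightInvariant X k).mdifferentiableAt (by simp)
  rw [h3] at key
  have h4 := 𝒢.inv_inv g
  rw [h4] at key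
  exact key.symm

/-- The mixed brackets vanish by commutation. Such sums are the anchors of the invariant sections of
`Vβ ⊕ Vα`. -/
theorem mlieBracket_right_add_leftInvariant (X Y X' Y' : 𝒢.AlgebroidSection) (g : G) :
    mlieBracket 𝓘(ℝ, EG) (𝒢.rightInvariant X + 𝒢.leftInvariant Y)
      (𝒢.rightInvariant X' + 𝒢.leftInvariant Y') g =
      -𝒢.rightInvariant (𝒢.leftBracket X X') g + 𝒢.leftInvariant (𝒢.leftBracket Y Y') g := by
  have : CompleteSpace EG := FiniteDimensional.complete ℝ EG
  have : IsManifold 𝓘(ℝ, EG) 1 G := .of_le (n := ∞) (by simp)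
  have hr : ∀ X, MDifferentiableAt 𝓘(ℝ, EG) 𝓘(ℝ, EG).tangent
      (fun g => (⟨g, 𝒢.rightInvariant X g⟩ : TangentBundle 𝓘(ℝ, EG) G)) g := fun X =>
    (𝒢.contMDiff_rightInvariant X g).mdifferentiableAt (by simp)
  have hl := fun X => 𝒢.mdifferentiableAt_leftInvariant X g
  have hc : ∀ X Y, mlieBracket 𝓘(ℝ, EG) (𝒢.rightInvariant X) (𝒢.leftInvariant Y) g = 0 := by
    intro X Y
    have h1 := 𝒢.mlieBracket_neg_rightInvariant_leftInvariant X Y g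
    have h2 : (fun g => -𝒢.rightInvariant X g) = (-1 : ℝ) • 𝒢.rightInvariant X :=
      funext fun g => (neg_one_smul ℝ (𝒢.rightInvariant X g)).symm
    rw [h2, mlieBracket_const_smul_left (hr X), neg_one_smul, neg_eq_zero] at h1
    exact h1
  rw [mlieBracket_add_left (hr X) (hl Y), mlieBracket_add_right (hr X') (hl Y'),
    mlieBracket_add_right (hr X') (hl Y'), hc, 𝒢.mlieBracket_rightInvariant,
    mlieBracket_swap_apply (V := 𝒢.leftInvariant Y), hc, neg_zero, add_zero, zero_add,
    𝒢.leftInvariant_leftBracket Y Y']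

end LieGroupoid

/-! ### Embedded submanifolds described by charts with smooth local extensions. -/

section SubmanifoldCharts

open Filter Set
open scoped Topology

variable {E E' H S N : Type*} [NormedAddCommGroup E] [NormedSpace ℝ E]
  [NormedAddCommGroup E'] [NormedSpace ℝ E'] [TopologicalSpace H] {I : ModelWithCorners ℝ E' H}
  [TopologicalSpace S] [TopologicalSpace N] [ChartedSpace H N]

/-- A chart `φ` of the subspace `ι : S → N` which makes it a submanifold: its inverse is smooth as
a map to `N`, and `φ` is locally the restriction of a smooth map on `N`. -/
structure IsSubmanifoldChart (I : ModelWithCorners ℝ E' H) (ι : S → N)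
    (φ : OpenPartialHomeomorph S E) : Prop where
  contMDiffOn_symm : ContMDiffOn 𝓘(ℝ, E) I ∞ (ι ∘ φ.symm) φ.target
  exists_extension : ∃ (Φ : N → E) (O : Set N), IsOpen O ∧ ContMDiffOn I 𝓘(ℝ, E) ∞ Φ O ∧
    ∀ p ∈ φ.source, ι p ∈ O ∧ Φ (ι p) = φ p

variable {ι : S → N}

/-- A change of charts is the ambient extension of one chart composed with the inverse of the other,
both smooth. -/
theorem isManifold_of_isSubmanifoldChart [ChartedSpace E S]
    (h : ∀ φ ∈ atlas E S, IsSubmanifoldChart I ι φ) : IsManifold 𝓘(ℝ, E) ∞ S := by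
  refine isManifold_of_contDiffOn 𝓘(ℝ, E) ∞ S fun φ φ' hφ hφ' => ?_
  obtain ⟨Φ, O, hO, hΦ, hφΦ⟩ := (h φ' hφ').exists_extension
  simp only [modelWithCornersSelf_coe, modelWithCornersSelf_coe_symm, range_id, inter_univ,
    preimage_id, Function.comp_id, Function.id_comp]
  have h1 : ContMDiffOn 𝓘(ℝ, E) 𝓘(ℝ, E) ∞ (Φ ∘ (ι ∘ φ.symm)) (φ.symm.trans φ').source :=
    hΦ.comp ((h φ hφ).contMDiffOn_symm.mono fun y hy => hy.1) fun y hy => (hφΦ _ hy.2).1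
  exact (h1.congr fun y hy => ((hφΦ _ hy.2).2).symm).contDiffOn

variable [ChartedSpace E S] [IsManifold 𝓘(ℝ, E) ∞ S]

theorem contMDiff_of_isSubmanifoldChart (h : ∀ p, IsSubmanifoldChart I ι (chartAt E p)) :
    ContMDiff 𝓘(ℝ, E) I ∞ ι := by
  intro p
  have h1 : ContMDiffOn 𝓘(ℝ, E) I ∞ ((ι ∘ (chartAt E p).symm) ∘ chartAt E p)
      (chartAt E p).source :=
    (h p).contMDiffOn_symm.comp (contMDiffOn_chart (I := 𝓘(ℝ, E))) (chartAt E p).mapsTo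
  exact (h1.congr fun q hq => congrArg ι ((chartAt E p).left_inv hq).symm).contMDiffAt
    (chart_source_mem_nhds E p)

/-- A map to a submanifold is smooth if it is smooth as a map to the ambient manifold. -/
theorem contMDiffWithinAt_of_isSubmanifoldChart (h : ∀ p, IsSubmanifoldChart I ι (chartAt E p))
    (hι : Topology.IsInducing ι) {E'' H'' P : Type*} [NormedAddCommGroup E''] [NormedSpace ℝ E'']
    [TopologicalSpace H''] {J : ModelWithCorners ℝ E'' H''} [TopologicalSpace P]
    [ChartedSpace H'' P] {f : P → S} {U : Set P} {x : P}
    (hf : ContMDiffWithinAt J I ∞ (ι ∘ f) U x) : ContMDiffWithinAt J 𝓘(ℝ, E) ∞ f U x := by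
  obtain ⟨Φ, O, hO, hΦ, hφΦ⟩ := (h (f x)).exists_extension
  have hc : ContinuousWithinAt f U x := hι.continuousWithinAt_iff.2 hf.continuousWithinAt
  have hx := mem_chart_source E (f x)
  -- Near `x` the map `f` factors as the inverse chart after `Φ` after `ι ∘ f`.
  have h1 : ContMDiffWithinAt J 𝓘(ℝ, E) ∞ (Φ ∘ (ι ∘ f)) U x :=
    (hΦ.contMDiffAt (hO.mem_nhds (hφΦ _ hx).1)).comp_contMDiffWithinAt x hf
  have h2 : ContMDiffAt 𝓘(ℝ, E) 𝓘(ℝ, E) ∞ (chartAt E (f x)).symm (Φ (ι (f x))) := by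
    rw [(hφΦ _ hx).2]
    exact (contMDiffOn_chart_symm (I := 𝓘(ℝ, E))).contMDiffAt (chart_target_mem_nhds E (f x))
  refine (ContMDiffAt.comp_contMDiffWithinAt x h2 h1).congr_of_eventuallyEq ?_ ?_
  · filter_upwards [hc.preimage_mem_nhdsWithin (chart_source_mem_nhds E (f x))] with y hy
    simp only [Function.comp_apply]
    rw [(hφΦ _ hy).2, (chartAt E (f x)).left_inv hy]
  · simp only [Function.comp_apply]
    rw [(hφΦ _ hx).2, (chartAt E (f x)).left_inv hx]

/-- The inclusion of a submanifold has injective derivatives. -/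
theorem mfderiv_injective_of_isSubmanifoldChart (h : ∀ p, IsSubmanifoldChart I ι (chartAt E p))
    (p : S) : Function.Injective (mfderiv 𝓘(ℝ, E) I ι p) := by
  obtain ⟨Φ, O, hO, hΦ, hφΦ⟩ := (h p).exists_extension
  have hp := mem_chart_source E p
  have h1 : HasMFDerivAt I 𝓘(ℝ, E) Φ (ι p) _ :=
    ((hΦ.contMDiffAt (hO.mem_nhds (hφΦ _ hp).1)).mdifferentiableAt (by simp)).hasMFDerivAt
  have h2 := ((contMDiff_of_isSubmanifoldChart h p).mdifferentiableAt (by simp)).hasMFDerivAt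
  have h3 : MDifferentiableAt 𝓘(ℝ, E) 𝓘(ℝ, E) (chartAt E p).symm (Φ (ι p)) := by
    rw [(hφΦ _ hp).2]
    exact ((contMDiffOn_chart_symm (I := 𝓘(ℝ, E)) (n := ∞)).contMDiffAt
      (chart_target_mem_nhds E p)).mdifferentiableAt (by simp)
  have h4 := (HasMFDerivAt.comp p h3.hasMFDerivAt (HasMFDerivAt.comp p h1 h2)).mfderiv
  -- The map `(chartAt E p).symm ∘ Φ` is a local left inverse of the inclusion.
  have h5 : ((chartAt E p).symm ∘ (Φ ∘ ι)) =ᶠ[𝓝 p] id := by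
    filter_upwards [chart_source_mem_nhds E p] with q hq
    simp only [Function.comp_apply, id]
    rw [(hφΦ _ hq).2, (chartAt E p).left_inv hq]
  rw [h5.mfderiv_eq, mfderiv_id] at h4
  intro v w hvw
  have hv := DFunLike.congr_fun h4 v
  have hw := DFunLike.congr_fun h4 w
  refine Eq.trans hv (Eq.trans ?_ hw.symm)
  simp only [ContinuousLinearMap.comp_apply]
  rw [hvw]

end SubmanifoldCharts

/-! ### Charts of `G_β ⋆ G_α`. -/

namespace LieGroupoid

open Filter Set
open scoped Topology

variable {EG EM G M : Type*} [NormedAddCommGroup EG] [NormedSpace ℝ EG]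
    [NormedAddCommGroup EM] [NormedSpace ℝ EM] [TopologicalSpace G] [ChartedSpace EG G]
    [TopologicalSpace M] [ChartedSpace EM M] (𝒢 : LieGroupoid EG EM G M)
    {e e' : OpenPartialHomeomorph G (M × FibreModel EG EM)}

/-- The coordinates `(h, q(g), q'(s))` of an element `(g, h, s)` of `G_β ⋆ G_α`, where `q` and `q'`
are the fibre components of charts adapted to `β` and to `α`. -/
noncomputable def starCoordinates (he : IsSubmersionChart 𝒢.tgt e)
    (he' : IsSubmersionChart 𝒢.src e') (p₀ : 𝒢.Star) :
    OpenPartialHomeomorph 𝒢.Star (G × FibreModel EG EM × FibreModel EG EM) where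
  toFun p := (p.1.2.1, (e p.1.1).2, (e' p.1.2.2).2)
  invFun := by
    classical
    exact fun q => if hq : (𝒢.tgt q.1, q.2.1) ∈ e.target ∧ (𝒢.src q.1, q.2.2) ∈ e'.target then
      ⟨(e.symm (𝒢.tgt q.1, q.2.1), q.1, e'.symm (𝒢.src q.1, q.2.2)),
        he.apply_symm hq.1, (he'.apply_symm hq.2).symm⟩ else p₀
  source := {p | p.1.1 ∈ e.source ∧ p.1.2.2 ∈ e'.source}
  target := {q | (𝒢.tgt q.1, q.2.1) ∈ e.target ∧ (𝒢.src q.1, q.2.2) ∈ e'.target}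
  map_source' p hp := ⟨by
    have := he.mem_target hp.1
    rwa [p.2.1] at this, by
    have := he'.mem_target hp.2
    rwa [← p.2.2] at this⟩
  map_target' q hq := by
    rw [dif_pos (And.intro hq.1 hq.2)]
    exact ⟨e.map_target hq.1, e'.map_target hq.2⟩
  left_inv' p hp := by
    have h1 := he.mem_target hp.1
    have h2 := he'.mem_target hp.2
    have h3 := he.symm_apply hp.1
    have h4 := he'.symm_apply hp.2
    rw [p.2.1] at h1 h3
    rw [← p.2.2] at h2 h4
    rw [dif_pos ⟨h1, h2⟩]
    exact Subtype.ext (Prod.ext h3 (Prod.ext rfl h4))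
  right_inv' q hq := by
    rw [dif_pos (And.intro hq.1 hq.2)]
    refine Prod.ext rfl (Prod.ext ?_ ?_)
    · exact congrArg (fun z : M × FibreModel EG EM => z.2) (e.right_inv hq.1)
    · exact congrArg (fun z : M × FibreModel EG EM => z.2) (e'.right_inv hq.2)
  open_source := (e.open_source.preimage (continuous_fst.comp continuous_subtype_val)).inter
    (e'.open_source.preimage (continuous_snd.comp (continuous_snd.comp continuous_subtype_val)))
  open_target := (e.open_target.preimage ((𝒢.tgt.contMDiff.continuous.comp continuous_fst).prodMk
    (continuous_fst.comp continuous_snd))).inter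
    (e'.open_target.preimage ((𝒢.src.contMDiff.continuous.comp continuous_fst).prodMk
    (continuous_snd.comp continuous_snd)))
  continuousOn_toFun := by
    refine ContinuousOn.prodMk ?_ (ContinuousOn.prodMk ?_ ?_)
    · exact (continuous_fst.comp (continuous_snd.comp continuous_subtype_val)).continuousOn
    · exact continuous_snd.comp_continuousOn (e.continuousOn.comp
        (continuous_fst.comp continuous_subtype_val).continuousOn fun p hp => hp.1)
    · exact continuous_snd.comp_continuousOn (e'.continuousOn.comp
        (continuous_snd.comp (continuous_snd.comp continuous_subtype_val)).continuousOn
        fun p hp => hp.2)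
  continuousOn_invFun := by
    refine Topology.IsInducing.subtypeVal.continuousOn_iff.2 ?_
    have h1 : ContinuousOn (fun q : G × FibreModel EG EM × FibreModel EG EM =>
        (e.symm (𝒢.tgt q.1, q.2.1), q.1, e'.symm (𝒢.src q.1, q.2.2)))
        {q | (𝒢.tgt q.1, q.2.1) ∈ e.target ∧ (𝒢.src q.1, q.2.2) ∈ e'.target} := by
      refine ContinuousOn.prodMk ?_ (continuous_fst.continuousOn.prodMk ?_)
      · exact e.symm.continuousOn.comp ((𝒢.tgt.contMDiff.continuous.comp continuous_fst).prodMk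
          (continuous_fst.comp continuous_snd)).continuousOn fun q hq => hq.1
      · exact e'.symm.continuousOn.comp ((𝒢.src.contMDiff.continuous.comp continuous_fst).prodMk
          (continuous_snd.comp continuous_snd)).continuousOn fun q hq => hq.2
    refine h1.congr fun q hq => ?_
    simp only [Function.comp_apply]
    rw [dif_pos (And.intro hq.1 hq.2)]

theorem starCoordinates_symm_apply (he : IsSubmersionChart 𝒢.tgt e)
    (he' : IsSubmersionChart 𝒢.src e') (p₀ : 𝒢.Star)
    {q : G × FibreModel EG EM × FibreModel EG EM}
    (hq : q ∈ (𝒢.starCoordinates he he' p₀).target) :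
    ((𝒢.starCoordinates he he' p₀).symm q).1 =
      (e.symm (𝒢.tgt q.1, q.2.1), q.1, e'.symm (𝒢.src q.1, q.2.2)) :=
  congrArg Subtype.val (dif_pos hq)

variable [FiniteDimensional ℝ EG] [FiniteDimensional ℝ EM]

/-- The model space of `G_β ⋆ G_α`. -/
abbrev StarModel (EG EM : Type*) [NormedAddCommGroup EG] [NormedSpace ℝ EG]
    [NormedAddCommGroup EM] [NormedSpace ℝ EM] : Type :=
  EuclideanSpace ℝ (Fin (Module.finrank ℝ (EG × FibreModel EG EM × FibreModel EG EM)))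

noncomputable def starModelEquiv (EG EM : Type*) [NormedAddCommGroup EG] [NormedSpace ℝ EG]
    [NormedAddCommGroup EM] [NormedSpace ℝ EM] [FiniteDimensional ℝ EG] [FiniteDimensional ℝ EM] :
    (EG × FibreModel EG EM × FibreModel EG EM) ≃L[ℝ] StarModel EG EM :=
  ContinuousLinearEquiv.ofFinrankEq (finrank_euclideanSpace_fin).symm

noncomputable def starChart (he : IsSubmersionChart 𝒢.tgt e)
    (he' : IsSubmersionChart 𝒢.src e') (p₀ : 𝒢.Star) :
    OpenPartialHomeomorph 𝒢.Star (StarModel EG EM) :=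
  ((𝒢.starCoordinates he he' p₀).trans
    ((chartAt EG p₀.1.2.1).prod (OpenPartialHomeomorph.refl (FibreModel EG EM × FibreModel EG EM)))).trans
    (starModelEquiv EG EM).toHomeomorph.toOpenPartialHomeomorph

theorem mem_starChart_source (he : IsSubmersionChart 𝒢.tgt e)
    (he' : IsSubmersionChart 𝒢.src e') (p₀ : 𝒢.Star) (hp : p₀.1.1 ∈ e.source)
    (hp' : p₀.1.2.2 ∈ e'.source) : p₀ ∈ (𝒢.starChart he he' p₀).source :=
  ⟨⟨⟨hp, hp'⟩, mem_chart_source EG _, mem_univ _⟩, mem_univ _⟩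

variable [IsManifold 𝓘(ℝ, EG) ∞ G]

theorem isSubmanifoldChart_starChart (he : IsSubmersionChart 𝒢.tgt e)
    (he' : IsSubmersionChart 𝒢.src e') (p₀ : 𝒢.Star) :
    IsSubmanifoldChart (𝓘(ℝ, EG).prod (𝓘(ℝ, EG).prod 𝓘(ℝ, EG)))
      (Subtype.val : 𝒢.Star → G × G × G) (𝒢.starChart he he' p₀) where
  contMDiffOn_symm := by
    let L := (starModelEquiv EG EM).symm
    have hL : ContDiff ℝ ∞ L := L.contDiff
    have hh : ContMDiffOn 𝓘(ℝ, StarModel EG EM) 𝓘(ℝ, EG) ∞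
        (fun y => (chartAt EG p₀.1.2.1).symm (L y).1) (𝒢.starChart he he' p₀).target :=
      (contMDiffOn_chart_symm (I := 𝓘(ℝ, EG))).comp hL.fst.contMDiff.contMDiffOn
        fun y hy => hy.2.1.1
    have ha : ContMDiff 𝓘(ℝ, StarModel EG EM) 𝓘(ℝ, FibreModel EG EM) ∞ (fun y => (L y).2.1) :=
      hL.snd.fst.contMDiff
    have hb : ContMDiff 𝓘(ℝ, StarModel EG EM) 𝓘(ℝ, FibreModel EG EM) ∞ (fun y => (L y).2.2) :=
      hL.snd.snd.contMDiff
    have h1 := (he.contMDiffOn_symm.comp ((𝒢.tgt.contMDiff.comp_contMDiffOn hh).prodMk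
      ha.contMDiffOn) fun y hy => hy.2.2.1).prodMk
      (hh.prodMk (he'.contMDiffOn_symm.comp ((𝒢.src.contMDiff.comp_contMDiffOn hh).prodMk
      hb.contMDiffOn) fun y hy => hy.2.2.2))
    exact h1.congr fun y hy => 𝒢.starCoordinates_symm_apply he he' p₀ hy.2.2
  exists_extension := by
    refine ⟨fun n => starModelEquiv EG EM
      (chartAt EG p₀.1.2.1 n.2.1, (e n.1).2, (e' n.2.2).2),
      e.source ×ˢ ((chartAt EG p₀.1.2.1).source ×ˢ e'.source),
      e.open_source.prod ((chartAt EG p₀.1.2.1).open_source.prod e'.open_source), ?_,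
      fun p hp => ⟨⟨hp.1.1.1, hp.1.2.1, hp.1.1.2⟩, rfl⟩⟩
    refine (starModelEquiv EG EM).contDiff.contMDiff.comp_contMDiffOn ?_
    refine ContMDiffOn.prodMk_space ?_ (ContMDiffOn.prodMk_space ?_ ?_)
    · exact (contMDiffOn_chart (I := 𝓘(ℝ, EG))).comp
        (contMDiff_fst.comp contMDiff_snd).contMDiffOn fun n hn => hn.2.1
    · exact he.contMDiffOn_snd.comp contMDiffOn_fst fun n hn => hn.1
    · exact he'.contMDiffOn_snd.comp (contMDiff_snd.comp contMDiff_snd).contMDiffOn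
        fun n hn => hn.2.2

end LieGroupoid

theorem surjective_mfderiv_of_local_section {E E' N N' : Type*} [NormedAddCommGroup E]
    [NormedSpace ℝ E] [NormedAddCommGroup E'] [NormedSpace ℝ E'] [TopologicalSpace N]
    [ChartedSpace E N] [TopologicalSpace N'] [ChartedSpace E' N'] {f : N → N'} {σ : N' → N} {p : N}
    (hf : MDifferentiableAt 𝓘(ℝ, E) 𝓘(ℝ, E') f p)
    (hσ : MDifferentiableAt 𝓘(ℝ, E') 𝓘(ℝ, E) σ (f p)) (hp : σ (f p) = p)
    (h : ∀ᶠ y in nhds (f p), f (σ y) = y) :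
    Function.Surjective (mfderiv 𝓘(ℝ, E) 𝓘(ℝ, E') f p) := by
  intro v
  have h1 : ∀ q, q = p → HasMFDerivAt 𝓘(ℝ, E) 𝓘(ℝ, E') f q
      (show TangentSpace 𝓘(ℝ, E) q →L[ℝ] TangentSpace 𝓘(ℝ, E') (f q) from
        mfderiv 𝓘(ℝ, E) 𝓘(ℝ, E') f p) := by
    rintro q rfl; exact hf.hasMFDerivAt
  have h2 := (HasMFDerivAt.comp (f p) (h1 _ hp) hσ.hasMFDerivAt).mfderiv
  have h3 : f ∘ σ =ᶠ[nhds (f p)] id := h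
  rw [h3.mfderiv_eq, mfderiv_id] at h2
  exact ⟨_, (DFunLike.congr_fun h2 v).symm⟩

/-! ### The Lie groupoid `G_β ⋆ G_α ⇉ G`. -/

namespace LieGroupoid

open Filter Set
open scoped Topology

variable {EG EM G M : Type*} [NormedAddCommGroup EG] [NormedSpace ℝ EG]
    [NormedAddCommGroup EM] [NormedSpace ℝ EM] [TopologicalSpace G] [ChartedSpace EG G]
    [TopologicalSpace M] [ChartedSpace EM M] (𝒢 : LieGroupoid EG EM G M)

/-- Products of the form `a b⁻¹ c` are the middle entries of both the product and the inverse of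
`G_β ⋆ G_α`. -/
theorem tgt_mul_inv_mul {g h k : G} (h1 : 𝒢.tgt g = 𝒢.tgt h) (h2 : 𝒢.src h = 𝒢.src k) :
    𝒢.tgt (𝒢.mul (𝒢.mul g (𝒢.inv h)) k) = 𝒢.tgt k := by
  have h3 := h1.trans (𝒢.src_inv h).symm
  rw [𝒢.tgt_mul _ _ (by rw [𝒢.tgt_mul _ _ h3, 𝒢.tgt_inv, h2])]

theorem src_mul_inv_mul {g h k : G} (h1 : 𝒢.tgt g = 𝒢.tgt h) (h2 : 𝒢.src h = 𝒢.src k) :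
    𝒢.src (𝒢.mul (𝒢.mul g (𝒢.inv h)) k) = 𝒢.src g := by
  have h3 := h1.trans (𝒢.src_inv h).symm
  rw [𝒢.src_mul _ _ (by rw [𝒢.tgt_mul _ _ h3, 𝒢.tgt_inv, h2]), 𝒢.src_mul _ _ h3]

theorem contMDiffOn_mul_inv_mul {E H P : Type*} [NormedAddCommGroup E] [NormedSpace ℝ E]
    [TopologicalSpace H] {J : ModelWithCorners ℝ E H} [TopologicalSpace P] [ChartedSpace H P]
    {a b c : P → G} {U : Set P} (ha : ContMDiff J 𝓘(ℝ, EG) ∞ a) (hb : ContMDiff J 𝓘(ℝ, EG) ∞ b)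
    (hc : ContMDiff J 𝓘(ℝ, EG) ∞ c) (h1 : ∀ y ∈ U, 𝒢.tgt (a y) = 𝒢.tgt (b y))
    (h2 : ∀ y ∈ U, 𝒢.src (b y) = 𝒢.src (c y)) :
    ContMDiffOn J 𝓘(ℝ, EG) ∞ (fun y => 𝒢.mul (𝒢.mul (a y) (𝒢.inv (b y))) (c y)) U := by
  have h3 : ∀ y ∈ U, 𝒢.tgt (a y) = 𝒢.src (𝒢.inv (b y)) := fun y hy =>
    (h1 y hy).trans (𝒢.src_inv _).symm
  have h4 : ContMDiffOn J 𝓘(ℝ, EG) ∞ (fun y => 𝒢.mul (a y) (𝒢.inv (b y))) U :=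
    𝒢.smooth_mul.comp (ha.prodMk (𝒢.inv.contMDiff.comp hb)).contMDiffOn h3
  refine 𝒢.smooth_mul.comp (h4.prodMk hc.contMDiffOn) fun y hy => ?_
  exact (𝒢.tgt_mul _ _ (h3 y hy)).trans ((𝒢.tgt_inv _).trans (h2 y hy))

open Classical in
/-- The product of `G_β ⋆ G_α ⇉ G`. -/
noncomputable def starMul (p q : 𝒢.Star) : 𝒢.Star :=
  if h : p.1.2.2 = q.1.1 then
    ⟨(p.1.1, 𝒢.mul (𝒢.mul q.1.2.1 (𝒢.inv q.1.1)) p.1.2.1, q.1.2.2), by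
      have h2 : 𝒢.src q.1.1 = 𝒢.src p.1.2.1 := by rw [← h, p.2.2]
      exact ⟨p.2.1.trans (𝒢.tgt_mul_inv_mul q.2.1.symm h2).symm,
        (𝒢.src_mul_inv_mul q.2.1.symm h2).trans q.2.2⟩⟩
  else p

theorem starMul_val {p q : 𝒢.Star} (h : p.1.2.2 = q.1.1) : (𝒢.starMul p q).1 =
    (p.1.1, 𝒢.mul (𝒢.mul q.1.2.1 (𝒢.inv q.1.1)) p.1.2.1, q.1.2.2) :=
  congrArg Subtype.val (dif_pos h)

variable [FiniteDimensional ℝ EG] [FiniteDimensional ℝ EM]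

/-- A point `g` is needed: for empty `G` the submersion condition says nothing about the model
spaces. -/
theorem finrank_le (𝒢 : LieGroupoid EG EM G M) (g : G) : Module.finrank ℝ EM ≤ Module.finrank ℝ EG :=
  (exists_isSubmersionChart (𝒢.isSubmersionAt_src g)).1

noncomputable instance chartedSpaceStar : ChartedSpace (StarModel EG EM) 𝒢.Star where
  atlas := range fun p : 𝒢.Star => 𝒢.starChart
    (exists_chart_of_isSubmersionAt (𝒢.isSubmersionAt_tgt p.1.1)).choose_spec.2
    (exists_chart_of_isSubmersionAt (𝒢.isSubmersionAt_src p.1.2.2)).choose_spec.2 p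
  chartAt := fun p : 𝒢.Star => 𝒢.starChart
    (exists_chart_of_isSubmersionAt (𝒢.isSubmersionAt_tgt p.1.1)).choose_spec.2
    (exists_chart_of_isSubmersionAt (𝒢.isSubmersionAt_src p.1.2.2)).choose_spec.2 p
  mem_chart_source p := 𝒢.mem_starChart_source _ _ p
    (exists_chart_of_isSubmersionAt (𝒢.isSubmersionAt_tgt p.1.1)).choose_spec.1
    (exists_chart_of_isSubmersionAt (𝒢.isSubmersionAt_src p.1.2.2)).choose_spec.1
  chart_mem_atlas p := mem_range_self p

variable [IsManifold 𝓘(ℝ, EG) ∞ G]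

theorem isSubmanifoldChart_of_mem_atlas (φ : OpenPartialHomeomorph 𝒢.Star (StarModel EG EM))
    (hφ : φ ∈ atlas (StarModel EG EM) 𝒢.Star) :
    IsSubmanifoldChart (𝓘(ℝ, EG).prod (𝓘(ℝ, EG).prod 𝓘(ℝ, EG)))
      (Subtype.val : 𝒢.Star → G × G × G) φ := by
  obtain ⟨p, rfl⟩ := hφ
  exact 𝒢.isSubmanifoldChart_starChart _ _ p

instance isManifoldStar : IsManifold 𝓘(ℝ, StarModel EG EM) ∞ 𝒢.Star :=
  isManifold_of_isSubmanifoldChart 𝒢.isSubmanifoldChart_of_mem_atlas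

theorem contMDiff_star_val : ContMDiff 𝓘(ℝ, StarModel EG EM)
    (𝓘(ℝ, EG).prod (𝓘(ℝ, EG).prod 𝓘(ℝ, EG))) ∞ (Subtype.val : 𝒢.Star → G × G × G) :=
  contMDiff_of_isSubmanifoldChart fun p =>
    𝒢.isSubmanifoldChart_of_mem_atlas _ (chart_mem_atlas _ p)

theorem contMDiff_star_fst :
    ContMDiff 𝓘(ℝ, StarModel EG EM) 𝓘(ℝ, EG) ∞ (fun p : 𝒢.Star => p.1.1) :=
  contMDiff_fst.comp 𝒢.contMDiff_star_val

theorem contMDiff_star_mid :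
    ContMDiff 𝓘(ℝ, StarModel EG EM) 𝓘(ℝ, EG) ∞ (fun p : 𝒢.Star => p.1.2.1) :=
  (contMDiff_fst.comp contMDiff_snd).comp 𝒢.contMDiff_star_val

theorem contMDiff_star_last :
    ContMDiff 𝓘(ℝ, StarModel EG EM) 𝓘(ℝ, EG) ∞ (fun p : 𝒢.Star => p.1.2.2) :=
  (contMDiff_snd.comp contMDiff_snd).comp 𝒢.contMDiff_star_val

theorem contMDiffWithinAt_star {E H P : Type*} [NormedAddCommGroup E] [NormedSpace ℝ E]
    [TopologicalSpace H] {J : ModelWithCorners ℝ E H} [TopologicalSpace P] [ChartedSpace H P]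
    {f : P → 𝒢.Star} {U : Set P} {x : P} (hf : ContMDiffWithinAt J
      (𝓘(ℝ, EG).prod (𝓘(ℝ, EG).prod 𝓘(ℝ, EG))) ∞ (fun x => (f x).1) U x) :
    ContMDiffWithinAt J 𝓘(ℝ, StarModel EG EM) ∞ f U x :=
  contMDiffWithinAt_of_isSubmanifoldChart (fun p =>
    𝒢.isSubmanifoldChart_of_mem_atlas _ (chart_mem_atlas _ p)) Topology.IsInducing.subtypeVal hf

theorem mfderiv_star_val_injective (p : 𝒢.Star) : Function.Injective
    (mfderiv 𝓘(ℝ, StarModel EG EM) (𝓘(ℝ, EG).prod (𝓘(ℝ, EG).prod 𝓘(ℝ, EG)))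
      (Subtype.val : 𝒢.Star → G × G × G) p) :=
  mfderiv_injective_of_isSubmanifoldChart (fun p =>
    𝒢.isSubmanifoldChart_of_mem_atlas _ (chart_mem_atlas _ p)) p

/-- The two equations defining `G_β ⋆ G_α` take values in `M`, so the codimension is `2 dim M` and
`EM × EM` serves as the complement. -/
theorem isSmoothEmbedding_star_val : IsSmoothEmbedding 𝓘(ℝ, StarModel EG EM)
    (𝓘(ℝ, EG).prod (𝓘(ℝ, EG).prod 𝓘(ℝ, EG))) ∞ (Subtype.val : 𝒢.Star → G × G × G) := by
  refine ⟨?_, Topology.IsEmbedding.subtypeVal⟩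
  refine IsImmersionOfComplement.isImmersion (F := EM × EM) fun p => ?_
  have h1 := 𝒢.contMDiff_star_val
  have h2 := 𝒢.mfderiv_star_val_injective p
  have h3 : IsManifold (𝓘(ℝ, EG).prod (𝓘(ℝ, EG).prod 𝓘(ℝ, EG))) ∞ (G × G × G) := inferInstance
  -- The immersion criterion needs a model of the form `𝓘(ℝ, E)`; the product model is rewritten to
  -- that form, and the product charts are viewed over `EG × EG × EG`.
  rw [← modelWithCornersSelf_prod, ← modelWithCornersSelf_prod] at h1 h2 h3 ⊢
  let _ : ChartedSpace (EG × EG × EG) (G × G × G) :=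
    inferInstanceAs (ChartedSpace (ModelProd EG (ModelProd EG EG)) (G × G × G))
  refine isImmersionAtOfComplement_of_injective_mfderiv h1 p h2 (EM × EM) ?_
  have := 𝒢.finrank_le p.1.1
  simp only [Module.finrank_prod, finrank_euclideanSpace_fin]
  omega

section Submersions

theorem isSubmersion_of_surjective {f : 𝒢.Star → G}
    (hf : ContMDiff 𝓘(ℝ, StarModel EG EM) 𝓘(ℝ, EG) ∞ f)
    (hs : ∀ p, Function.Surjective (mfderiv 𝓘(ℝ, StarModel EG EM) 𝓘(ℝ, EG) f p)) :
    IsSubmersion 𝓘(ℝ, StarModel EG EM) 𝓘(ℝ, EG) ∞ f := by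
  refine ⟨FibreModel EG EM × FibreModel EG EM, inferInstance, inferInstance, fun p => ?_⟩
  refine isSubmersionAtOfComplement_of_surjective_mfderiv hf p (hs p) _ ?_
  simp only [Module.finrank_prod, finrank_euclideanSpace_fin]

/-- Smooth families of composable triples are smooth families of elements of `G_β ⋆ G_α`. -/
theorem exists_contMDiffAt_star {a b c : G → G} {x : G} (ha : ContMDiffAt 𝓘(ℝ, EG) 𝓘(ℝ, EG) ∞ a x)
    (hb : ContMDiffAt 𝓘(ℝ, EG) 𝓘(ℝ, EG) ∞ b x) (hc : ContMDiffAt 𝓘(ℝ, EG) 𝓘(ℝ, EG) ∞ c x)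
    (h : ∀ᶠ y in 𝓝 x, 𝒢.tgt (a y) = 𝒢.tgt (b y) ∧ 𝒢.src (b y) = 𝒢.src (c y)) :
    ∃ σ : G → 𝒢.Star, ContMDiffAt 𝓘(ℝ, EG) 𝓘(ℝ, StarModel EG EM) ∞ σ x ∧
      ∀ᶠ y in 𝓝 x, (σ y).1 = (a y, b y, c y) := by
  classical
  let σ : G → 𝒢.Star := fun y =>
    if hy : 𝒢.tgt (a y) = 𝒢.tgt (b y) ∧ 𝒢.src (b y) = 𝒢.src (c y) then ⟨(a y, b y, c y), hy⟩
    else ⟨(a x, b x, c x), h.self_of_nhds⟩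
  have h1 : ∀ᶠ y in 𝓝 x, (σ y).1 = (a y, b y, c y) :=
    h.mono fun y hy => congrArg Subtype.val (dif_pos hy)
  exact ⟨σ, 𝒢.contMDiffWithinAt_star ((ha.prodMk (hb.prodMk hc)).congr_of_eventuallyEq h1), h1⟩

/-- A local section exists: for `g'` near `g`, hold the fibre coordinate of `h` fixed to get `τ g'`
with `β(τ g') = β(g')`, and then that of `s` to get `ρ g'` with `α(ρ g') = α(τ g')`. -/
theorem surjective_mfderiv_star_fst (p : 𝒢.Star) : Function.Surjective
    (mfderiv 𝓘(ℝ, StarModel EG EM) 𝓘(ℝ, EG) (fun p : 𝒢.Star => p.1.1) p) := by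
  obtain ⟨⟨g, h, s⟩, hgh : 𝒢.tgt g = 𝒢.tgt h, hhs : 𝒢.src h = 𝒢.src s⟩ := p
  obtain ⟨e, hh, he⟩ := exists_chart_of_isSubmersionAt (𝒢.isSubmersionAt_tgt h)
  obtain ⟨e', hs', he'⟩ := exists_chart_of_isSubmersionAt (𝒢.isSubmersionAt_src s)
  let τ : G → G := fun g' => e.symm (𝒢.tgt g', (e h).2)
  let ρ : G → G := fun g' => e'.symm (𝒢.src (τ g'), (e' s).2)
  have hgt : (𝒢.tgt g, (e h).2) ∈ e.target := hgh ▸ he.mem_target hh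
  have hτ : τ g = h := by simp only [τ, hgh]; exact he.symm_apply hh
  have hst : (𝒢.src (τ g), (e' s).2) ∈ e'.target := by rw [hτ, hhs]; exact he'.mem_target hs'
  have hρ : ρ g = s := by simp only [ρ, hτ, hhs]; exact he'.symm_apply hs'
  have h1 : ContMDiffAt 𝓘(ℝ, EG) 𝓘(ℝ, EG) ∞ τ g :=
    ContMDiffAt.comp g (he.contMDiffAt_symm hgt) ((𝒢.tgt.contMDiff g).prodMk contMDiffAt_const)
  have h2 : ContMDiffAt 𝓘(ℝ, EG) (𝓘(ℝ, EM).prod 𝓘(ℝ, FibreModel EG EM)) ∞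
      (fun g' => (𝒢.src (τ g'), (e' s).2)) g :=
    (𝒢.src.contMDiff.contMDiffAt.comp g h1).prodMk contMDiffAt_const
  have h3 : ∀ᶠ g' in 𝓝 g, 𝒢.tgt g' = 𝒢.tgt (τ g') ∧ 𝒢.src (τ g') = 𝒢.src (ρ g') := by
    filter_upwards [((𝒢.tgt.contMDiff.continuous.prodMk continuous_const).continuousAt
      (x := g)).preimage_mem_nhds (e.open_target.mem_nhds hgt),
      h2.continuousAt.preimage_mem_nhds (e'.open_target.mem_nhds hst)] with g' h4 h5
    exact ⟨(he.apply_symm h4).symm, (he'.apply_symm h5).symm⟩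
  obtain ⟨σ, hσ, hσ'⟩ := 𝒢.exists_contMDiffAt_star contMDiffAt_id h1
    (ContMDiffAt.comp g (he'.contMDiffAt_symm hst) h2) h3
  refine surjective_mfderiv_of_local_section (σ := σ)
    (𝒢.contMDiff_star_fst.mdifferentiableAt (by simp)) (hσ.mdifferentiableAt (by simp))
    (Subtype.ext (hσ'.self_of_nhds.trans ?_)) (hσ'.mono fun y hy => congrArg Prod.fst hy)
  exact Prod.ext rfl (Prod.ext hτ hρ)

/-- The construction for the first projection with `α` and `β` exchanged: from `s'` to a middle
entry along `α`, and from there to a first entry along `β`. -/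
theorem surjective_mfderiv_star_last (p : 𝒢.Star) : Function.Surjective
    (mfderiv 𝓘(ℝ, StarModel EG EM) 𝓘(ℝ, EG) (fun p : 𝒢.Star => p.1.2.2) p) := by
  obtain ⟨⟨g, h, s⟩, hgh : 𝒢.tgt g = 𝒢.tgt h, hhs : 𝒢.src h = 𝒢.src s⟩ := p
  obtain ⟨e, hh, he⟩ := exists_chart_of_isSubmersionAt (𝒢.isSubmersionAt_src h)
  obtain ⟨e', hg', he'⟩ := exists_chart_of_isSubmersionAt (𝒢.isSubmersionAt_tgt g)
  let τ : G → G := fun s' => e.symm (𝒢.src s', (e h).2)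
  let ρ : G → G := fun s' => e'.symm (𝒢.tgt (τ s'), (e' g).2)
  have hst : (𝒢.src s, (e h).2) ∈ e.target := hhs ▸ he.mem_target hh
  have hτ : τ s = h := by simp only [τ, ← hhs]; exact he.symm_apply hh
  have hgt : (𝒢.tgt (τ s), (e' g).2) ∈ e'.target := by rw [hτ, ← hgh]; exact he'.mem_target hg'
  have hρ : ρ s = g := by simp only [ρ, hτ, ← hgh]; exact he'.symm_apply hg'
  have h1 : ContMDiffAt 𝓘(ℝ, EG) 𝓘(ℝ, EG) ∞ τ s :=
    ContMDiffAt.comp s (he.contMDiffAt_symm hst) ((𝒢.src.contMDiff s).prodMk contMDiffAt_const)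
  have h2 : ContMDiffAt 𝓘(ℝ, EG) (𝓘(ℝ, EM).prod 𝓘(ℝ, FibreModel EG EM)) ∞
      (fun s' => (𝒢.tgt (τ s'), (e' g).2)) s :=
    (𝒢.tgt.contMDiff.contMDiffAt.comp s h1).prodMk contMDiffAt_const
  have h3 : ∀ᶠ s' in 𝓝 s, 𝒢.tgt (ρ s') = 𝒢.tgt (τ s') ∧ 𝒢.src (τ s') = 𝒢.src s' := by
    filter_upwards [((𝒢.src.contMDiff.continuous.prodMk continuous_const).continuousAt
      (x := s)).preimage_mem_nhds (e.open_target.mem_nhds hst),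
      h2.continuousAt.preimage_mem_nhds (e'.open_target.mem_nhds hgt)] with s' h4 h5
    exact ⟨he'.apply_symm h5, he.apply_symm h4⟩
  obtain ⟨σ, hσ, hσ'⟩ := 𝒢.exists_contMDiffAt_star
    (ContMDiffAt.comp s (he'.contMDiffAt_symm hgt) h2) h1 contMDiffAt_id h3
  refine surjective_mfderiv_of_local_section (σ := σ)
    (𝒢.contMDiff_star_last.mdifferentiableAt (by simp)) (hσ.mdifferentiableAt (by simp))
    (Subtype.ext (hσ'.self_of_nhds.trans ?_))
    (hσ'.mono fun y hy => congrArg (fun q : G × G × G => q.2.2) hy)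
  exact Prod.ext hρ (Prod.ext hτ rfl)

end Submersions

section StarGroupoid

/-- The Lie groupoid `G_β ⋆ G_α ⇉ G`. -/
noncomputable def starGroupoid : LieGroupoid (StarModel EG EM) EG 𝒢.Star G where
  src := ⟨fun p => p.1.1, 𝒢.contMDiff_star_fst⟩
  tgt := ⟨fun p => p.1.2.2, 𝒢.contMDiff_star_last⟩
  unit := ⟨fun g => ⟨(g, g, g), rfl, rfl⟩, fun g => 𝒢.contMDiffWithinAt_star
    (contMDiffAt_id.prodMk (contMDiffAt_id.prodMk contMDiffAt_id))⟩
  inv := ⟨fun p => ⟨(p.1.2.2, 𝒢.mul (𝒢.mul p.1.1 (𝒢.inv p.1.2.1)) p.1.2.2, p.1.1),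
    (𝒢.tgt_mul_inv_mul p.2.1 p.2.2).symm, 𝒢.src_mul_inv_mul p.2.1 p.2.2⟩, fun p =>
      𝒢.contMDiffWithinAt_star ((𝒢.contMDiff_star_last p).prodMk ((contMDiffOn_univ.1
        (𝒢.contMDiffOn_mul_inv_mul 𝒢.contMDiff_star_fst 𝒢.contMDiff_star_mid
          𝒢.contMDiff_star_last (fun p _ => p.2.1) (fun p _ => p.2.2)) p).prodMk
        (𝒢.contMDiff_star_fst p)))⟩
  mul := 𝒢.starMul
  isSubmersion_src := 𝒢.isSubmersion_of_surjective 𝒢.contMDiff_star_fst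
    𝒢.surjective_mfderiv_star_fst
  isSubmersion_tgt := 𝒢.isSubmersion_of_surjective 𝒢.contMDiff_star_last
    𝒢.surjective_mfderiv_star_last
  smooth_mul := by
    have h1 : ContMDiffOn (𝓘(ℝ, StarModel EG EM).prod 𝓘(ℝ, StarModel EG EM))
        (𝓘(ℝ, EG).prod (𝓘(ℝ, EG).prod 𝓘(ℝ, EG))) ∞
        (fun z : 𝒢.Star × 𝒢.Star => (𝒢.starMul z.1 z.2).1) {z | z.1.1.2.2 = z.2.1.1} := by
      refine ContMDiffOn.congr ?_ fun z hz => 𝒢.starMul_val hz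
      refine (𝒢.contMDiff_star_fst.comp contMDiff_fst).contMDiffOn.prodMk (ContMDiffOn.prodMk ?_
        (𝒢.contMDiff_star_last.comp contMDiff_snd).contMDiffOn)
      refine 𝒢.contMDiffOn_mul_inv_mul (𝒢.contMDiff_star_mid.comp contMDiff_snd)
        (𝒢.contMDiff_star_fst.comp contMDiff_snd) (𝒢.contMDiff_star_mid.comp contMDiff_fst)
        (fun z _ => z.2.2.1.symm) fun z hz => ?_
      exact (congrArg 𝒢.src hz).symm.trans z.1.2.2.symm
    exact fun z hz => 𝒢.contMDiffWithinAt_star (h1 z hz)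
  src_mul p q h := show (𝒢.starMul p q).1.1 = p.1.1 by rw [𝒢.starMul_val h]
  tgt_mul p q h := show (𝒢.starMul p q).1.2.2 = q.1.2.2 by rw [𝒢.starMul_val h]
  mul_assoc p q r h h' := by
    have hpq := 𝒢.starMul_val h
    have hqr := 𝒢.starMul_val h'
    have h1 : p.1.2.2 = (𝒢.starMul q r).1.1 := by rw [hqr]; exact h
    have h2 : (𝒢.starMul p q).1.2.2 = r.1.1 := by rw [hpq]; exact h'
    refine Subtype.ext ?_
    rw [𝒢.starMul_val h1, 𝒢.starMul_val h2, hpq, hqr]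
    refine Prod.ext rfl (Prod.ext ?_ rfl)
    have h3 : 𝒢.tgt r.1.2.1 = 𝒢.src (𝒢.inv r.1.1) := r.2.1.symm.trans (𝒢.src_inv _).symm
    have h4 : 𝒢.tgt (𝒢.mul r.1.2.1 (𝒢.inv r.1.1)) = 𝒢.src q.1.2.1 := by
      rw [𝒢.tgt_mul _ _ h3, 𝒢.tgt_inv, q.2.2]; exact (congrArg 𝒢.src h').symm
    have h5 : 𝒢.tgt q.1.2.1 = 𝒢.src (𝒢.inv q.1.1) := q.2.1.symm.trans (𝒢.src_inv _).symm
    have h6 : 𝒢.tgt (𝒢.mul q.1.2.1 (𝒢.inv q.1.1)) = 𝒢.src p.1.2.1 := by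
      rw [𝒢.tgt_mul _ _ h5, 𝒢.tgt_inv, p.2.2]; exact (congrArg 𝒢.src h).symm
    -- With `p = (g, h, s)`, `q = (s, h', s')`, `r = (s', h'', s'')`, both middle entries are
    -- bracketings of `h'' s'⁻¹ h' s⁻¹ h`.
    change 𝒢.mul (𝒢.mul (𝒢.mul (𝒢.mul r.1.2.1 (𝒢.inv r.1.1)) q.1.2.1) (𝒢.inv q.1.1)) p.1.2.1 =
      𝒢.mul (𝒢.mul r.1.2.1 (𝒢.inv r.1.1)) (𝒢.mul (𝒢.mul q.1.2.1 (𝒢.inv q.1.1)) p.1.2.1)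
    rw [𝒢.mul_assoc _ _ _ (by rw [𝒢.src_mul _ _ h5, h4]) h6, 𝒢.mul_assoc _ _ _ h4 h5]
  src_unit _ := rfl
  tgt_unit _ := rfl
  unit_mul p := Subtype.ext <| (𝒢.starMul_val rfl).trans <|
    Prod.ext rfl (Prod.ext (𝒢.inv_mul_cancel_right p.2.1.symm) rfl)
  mul_unit p := Subtype.ext <| (𝒢.starMul_val rfl).trans <| Prod.ext rfl <| Prod.ext (by
    change 𝒢.mul (𝒢.mul p.1.2.2 (𝒢.inv p.1.2.2)) p.1.2.1 = p.1.2.1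
    rw [𝒢.mul_inv, ← p.2.2, 𝒢.unit_mul]) rfl
  src_inv _ := rfl
  tgt_inv _ := rfl
  inv_mul p := Subtype.ext <| (𝒢.starMul_val rfl).trans <| Prod.ext rfl <| Prod.ext (by
    change 𝒢.mul (𝒢.mul p.1.2.1 (𝒢.inv p.1.1)) (𝒢.mul (𝒢.mul p.1.1 (𝒢.inv p.1.2.1)) p.1.2.2) =
      p.1.2.2
    have h1 : 𝒢.tgt p.1.1 = 𝒢.src (𝒢.inv p.1.2.1) := p.2.1.trans (𝒢.src_inv _).symm
    have h2 : 𝒢.tgt p.1.2.1 = 𝒢.src (𝒢.inv p.1.1) := p.2.1.symm.trans (𝒢.src_inv _).symm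
    have h3 : 𝒢.tgt (𝒢.inv p.1.2.1) = 𝒢.src p.1.2.2 := (𝒢.tgt_inv _).trans p.2.2
    rw [← 𝒢.mul_assoc p.1.1 _ _ h1 h3, ← 𝒢.mul_assoc p.1.2.1 _ _ h2 (by
      rw [𝒢.tgt_inv, 𝒢.src_mul _ _ (by rw [𝒢.src_mul _ _ h3, h1])]), 𝒢.inv_mul_cancel_left
      (by rw [𝒢.src_mul _ _ h3, h1]), 𝒢.mul_inv_cancel_left p.2.2]) rfl
  mul_inv p := Subtype.ext <| (𝒢.starMul_val rfl).trans <| Prod.ext rfl <| Prod.ext (by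
    change 𝒢.mul (𝒢.mul (𝒢.mul (𝒢.mul p.1.1 (𝒢.inv p.1.2.1)) p.1.2.2) (𝒢.inv p.1.2.2)) p.1.2.1 =
      p.1.1
    rw [𝒢.mul_inv_cancel_right (by
      rw [𝒢.tgt_mul _ _ (p.2.1.trans (𝒢.src_inv _).symm), 𝒢.tgt_inv, p.2.2]),
      𝒢.inv_mul_cancel_right p.2.1]) rfl

theorem isStarGroupoid_starGroupoid : 𝒢.IsStarGroupoid 𝒢.starGroupoid where
  src_eq _ := rfl
  tgt_eq _ := rfl
  unit_eq _ := rfl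
  mul_eq _ _ h := 𝒢.starMul_val h
  inv_eq _ := rfl

end StarGroupoid

end LieGroupoid

/-! ### Subbundles of pullbacks and products; isomorphisms by rank. -/

section BundleConstructions

open Set

variable {EB B F F' : Type*} [NormedAddCommGroup EB] [NormedSpace ℝ EB]
  [TopologicalSpace B] [ChartedSpace EB B] [NormedAddCommGroup F] [NormedSpace ℝ F]
  [NormedAddCommGroup F'] [NormedSpace ℝ F']

/-- The smooth maps to a pulled back bundle over a smooth map to the base. -/
theorem contMDiffOn_pullback_totalSpace {EB' B' EX X : Type*} [NormedAddCommGroup EB']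
    [NormedSpace ℝ EB'] [TopologicalSpace B'] [ChartedSpace EB' B'] [NormedAddCommGroup EX]
    [NormedSpace ℝ EX] [TopologicalSpace X] [ChartedSpace EX X]
    {V : B → Type*} [TopologicalSpace (TotalSpace F V)] [∀ x, TopologicalSpace (V x)]
    [FiberBundle F V] [∀ x, Zero (V x)]
    (f : C^∞⟮𝓘(ℝ, EB'), B'; 𝓘(ℝ, EB), B⟯) {h : X → B'} (hh : ContMDiff 𝓘(ℝ, EX) 𝓘(ℝ, EB') ∞ h)
    (s : ∀ x, ((f : B' → B) *ᵖ V) (h x)) (U : Set X) :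
    ContMDiffOn 𝓘(ℝ, EX) (𝓘(ℝ, EB').prod 𝓘(ℝ, F)) ∞
        (fun x => (⟨h x, s x⟩ : TotalSpace F ((f : B' → B) *ᵖ V))) U ↔
      ContMDiffOn 𝓘(ℝ, EX) (𝓘(ℝ, EB).prod 𝓘(ℝ, F)) ∞
        (fun x => (⟨f (h x), s x⟩ : TotalSpace F V)) U := by
  refine forall₂_congr fun x hx => ?_
  rw [contMDiffWithinAt_totalSpace, contMDiffWithinAt_totalSpace]
  refine and_congr ?_ Iff.rfl
  exact ⟨fun _ => (f.contMDiff.comp hh x).contMDiffWithinAt, fun _ => (hh x).contMDiffWithinAt⟩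

variable {V : B → Type*} [TopologicalSpace (TotalSpace F V)] [∀ x, TopologicalSpace (V x)]
  [FiberBundle F V] [∀ x, AddCommGroup (V x)] [∀ x, Module ℝ (V x)]
  {V' : B → Type*} [TopologicalSpace (TotalSpace F' V')] [∀ x, TopologicalSpace (V' x)]
  [FiberBundle F' V'] [∀ x, AddCommGroup (V' x)] [∀ x, Module ℝ (V' x)]
  {K : ∀ x, Submodule ℝ (V x)} {K' : ∀ x, Submodule ℝ (V' x)}

theorem IsSmoothSubbundle.pullback {EB' B' : Type*} [NormedAddCommGroup EB']
    [NormedSpace ℝ EB'] [TopologicalSpace B'] [ChartedSpace EB' B']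
    (hK : IsSmoothSubbundle EB F K) (f : C^∞⟮𝓘(ℝ, EB'), B'; 𝓘(ℝ, EB), B⟯) :
    IsSmoothSubbundle EB' F (V := (f : B' → B) *ᵖ V) fun x => K (f x) := by
  intro x₀
  obtain ⟨U, hU, hxU, k, s, hs, hli⟩ := hK (f x₀)
  refine ⟨f ⁻¹' U, hU.preimage f.contMDiff.continuous, hxU, k, fun i x => s i (f x), fun i => ?_,
    fun x hx => hli (f x) hx⟩
  exact (smoothSectionOn_pullback f _ _).2
    ((hs i).comp f.contMDiff.contMDiffOn fun x hx => hx)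

theorem IsSmoothSubbundle.prod (hK : IsSmoothSubbundle EB F K) (hK' : IsSmoothSubbundle EB F' K')
    [VectorBundle ℝ F V] [VectorBundle ℝ F' V'] :
    IsSmoothSubbundle EB (F × F') (V := V ×ᵇ V')
      fun x => Submodule.prod (M := V x) (M' := V' x) (K x) (K' x) := by
  intro x₀
  obtain ⟨U, hU, hxU, k, s, hs, hli⟩ := hK x₀
  obtain ⟨U', hU', hxU', k', s', hs', hli'⟩ := hK' x₀
  let S : Fin k ⊕ Fin k' → ∀ x, (V ×ᵇ V') x := fun i x =>
    Sum.elim (fun i => ((s i x, 0) : V x × V' x)) (fun i => ((0, s' i x) : V x × V' x)) i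
  have hS : ∀ i, SmoothSectionOn EB (F × F') (S i) (U ∩ U') := by
    rintro (i | i)
    · exact (smoothSectionOn_prod _ _).2 ⟨(hs i).mono inter_subset_left,
        (contMDiff_zeroSection ℝ V').contMDiffOn⟩
    · exact (smoothSectionOn_prod _ _).2 ⟨(contMDiff_zeroSection ℝ V).contMDiffOn,
        (hs' i).mono inter_subset_right⟩
  refine ⟨U ∩ U', hU.inter hU', ⟨hxU, hxU'⟩, k + k', fun i => S (finSumFinEquiv.symm i),
    fun i => hS _, fun x hx => ?_⟩
  have h1 : (fun i => S (finSumFinEquiv.symm i) x) =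
      (Sum.elim (LinearMap.inl ℝ (V x) (V' x) ∘ fun i => s i x)
        (LinearMap.inr ℝ (V x) (V' x) ∘ fun i => s' i x)) ∘ finSumFinEquiv.symm := by
    funext i
    simp only [S, Function.comp_apply]
    rcases finSumFinEquiv.symm i with i | i <;> rfl
  have h2 : LinearIndependent ℝ ((Sum.elim (LinearMap.inl ℝ (V x) (V' x) ∘ fun i => s i x)
      (LinearMap.inr ℝ (V x) (V' x) ∘ fun i => s' i x)) ∘ finSumFinEquiv.symm) :=
    (linearIndependent_inl_union_inr' (hli x hx.1).1 (hli' x hx.2).1).comp _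
      finSumFinEquiv.symm.injective
  have h3 : Submodule.span ℝ (range ((Sum.elim (LinearMap.inl ℝ (V x) (V' x) ∘ fun i => s i x)
      (LinearMap.inr ℝ (V x) (V' x) ∘ fun i => s' i x)) ∘ finSumFinEquiv.symm)) =
      Submodule.prod (K x) (K' x) := by
    rw [EquivLike.range_comp, Sum.elim_range, range_comp, range_comp]
    refine LinearMap.span_inl_union_inr.trans ?_
    rw [(hli x hx.1).2, (hli' x hx.2).2]
  rw [← h1] at h2 h3
  exact ⟨h2, h3⟩

section Equiv

variable (Φ : ∀ x, K x →ₗ[ℝ] V' x) (hmem : ∀ x v, Φ x v ∈ K' x)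
  (hinj : ∀ x, Function.Injective (Φ x))
  [∀ x, FiniteDimensional ℝ (K' x)]
  (hdim : ∀ x, Module.finrank ℝ (K x) = Module.finrank ℝ (K' x))

/-- A fibrewise injective map between subbundles of the same rank. -/
noncomputable def subbundleEquiv (x : B) : K x ≃ₗ[ℝ] K' x :=
  LinearEquiv.ofInjectiveOfFinrankEq ((Φ x).codRestrict (K' x) (hmem x))
    (fun _ _ h => hinj x (congrArg Subtype.val h)) (hdim x)

/-- A smooth fibrewise injection reflects smoothness of sections
(`SmoothBundleMap.smoothSectionOn_of_comp`), so no separate formula for the inverse is required. -/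
theorem smoothBundleMap_subbundleEquiv_symm [FiniteDimensional ℝ F] [FiniteDimensional ℝ F']
    [VectorBundle ℝ F V] [VectorBundle ℝ F' V']
    (hK : IsSmoothSubbundle EB F K) (hΦ : SmoothBundleMap EB F F' Φ) :
    SmoothBundleMap EB F' F (V' := V) fun x =>
      (K x).subtype ∘ₗ (subbundleEquiv Φ hmem hinj hdim x).symm.toLinearMap := by
  intro U s hU hs
  refine hΦ.smoothSectionOn_of_comp hK hinj hU
    (t := fun x => (subbundleEquiv Φ hmem hinj hdim x).symm (s x)) ?_
  refine hs.congr fun x hx => ?_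
  exact congrArg (fun v : K' x => TotalSpace.mk' F' x (v : V' x))
    ((subbundleEquiv Φ hmem hinj hdim x).apply_symm_apply (s x))

end Equiv

end BundleConstructions

theorem finrank_ker_of_surjective {E E' : Type*} [AddCommGroup E] [Module ℝ E]
    [FiniteDimensional ℝ E] [AddCommGroup E'] [Module ℝ E'] {f : E →ₗ[ℝ] E'}
    (hf : Function.Surjective f) :
    Module.finrank ℝ (LinearMap.ker f) = Module.finrank ℝ E - Module.finrank ℝ E' := by
  have h1 := f.finrank_range_add_finrank_ker
  rw [LinearMap.range_eq_top.2 hf, finrank_top] at h1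
  omega

theorem finrank_submodule_prod {E E' : Type*} [AddCommGroup E] [Module ℝ E]
    [FiniteDimensional ℝ E] [AddCommGroup E'] [Module ℝ E'] [FiniteDimensional ℝ E']
    (p : Submodule ℝ E) (q : Submodule ℝ E') :
    Module.finrank ℝ (p.prod q) = Module.finrank ℝ p + Module.finrank ℝ q := by
  have e : p.prod q ≃ₗ[ℝ] p × q :=
    { toFun := fun x => (⟨x.1.1, x.2.1⟩, ⟨x.1.2, x.2.2⟩)
      invFun := fun y => ⟨(y.1.1, y.2.1), y.1.2, y.2.2⟩
      map_add' := fun _ _ => rfl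
      map_smul' := fun _ _ => rfl
      left_inv := fun _ => rfl
      right_inv := fun _ => rfl }
  rw [e.finrank_eq, Module.finrank_prod]

/-! ### The isomorphisms `Θ` and `Ψ`. -/

namespace LieGroupoid

open Filter Set VectorField
open scoped Topology

variable {EG EM G M : Type*} [NormedAddCommGroup EG] [NormedSpace ℝ EG]
    [NormedAddCommGroup EM] [NormedSpace ℝ EM] [TopologicalSpace G] [ChartedSpace EG G]
    [TopologicalSpace M] [ChartedSpace EM M] (𝒢 : LieGroupoid EG EM G M)
    [FiniteDimensional ℝ EG] [FiniteDimensional ℝ EM]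

instance finiteDimensional_verticalSum (g : G) : FiniteDimensional ℝ (𝒢.verticalSum g) :=
  have : FiniteDimensional ℝ (((TangentSpace 𝓘(ℝ, EG) : G → Type _) ×ᵇ
      (TangentSpace 𝓘(ℝ, EG) : G → Type _)) g) := inferInstanceAs (FiniteDimensional ℝ (EG × EG))
  inferInstance

theorem finrank_algebroidFiber (x : M) : Module.finrank ℝ (𝒢.algebroidFiber x) =
    Module.finrank ℝ EG - Module.finrank ℝ EM :=
  finrank_ker_of_surjective (E := EG) (E' := EM) (𝒢.mfderiv_src_surjective (𝒢.unit x))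

theorem finrank_verticalSum (g : G) : Module.finrank ℝ (𝒢.verticalSum g) =
    2 * (Module.finrank ℝ EG - Module.finrank ℝ EM) := by
  have h1 := finrank_ker_of_surjective (E := EG) (E' := EM) (𝒢.mfderiv_src_surjective g)
  have h2 := finrank_ker_of_surjective (E := EG) (E' := EM) (𝒢.mfderiv_tgt_surjective g)
  refine (finrank_submodule_prod (E := EG) (E' := EG) _ _).trans ?_
  rw [two_mul]
  exact congrArg₂ _ h2 h1

theorem finrank_prolongation (g : G) : Module.finrank ℝ (𝒢.prolongation g) =
    2 * (Module.finrank ℝ EG - Module.finrank ℝ EM) := by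
  refine (finrank_submodule_prod (E := EG) (E' := EG) _ _).trans ?_
  rw [two_mul]
  exact congrArg₂ _ (𝒢.finrank_algebroidFiber _) (𝒢.finrank_algebroidFiber _)

section Prolongation

/-- The map `(u, g, v) ↦ (T(r_g ∘ i) u, T l_g v)`. -/
noncomputable def prolongationMap (g : G) : 𝒢.prolongation g →ₗ[ℝ]
    ((TangentSpace 𝓘(ℝ, EG) : G → Type _) ×ᵇ (TangentSpace 𝓘(ℝ, EG) : G → Type _)) g :=
  (LinearMap.prodMap (𝒢.rightInvTangent g).toLinearMap (𝒢.leftTangent g).toLinearMap) ∘ₗ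
    (𝒢.prolongation g).subtype

theorem prolongationMap_mem (g : G) (w : 𝒢.prolongation g) :
    𝒢.prolongationMap g w ∈ 𝒢.verticalSum g :=
  ⟨𝒢.mfderiv_tgt_rightInvTangent w.2.1, 𝒢.mfderiv_src_leftTangent w.2.2⟩

theorem prolongationMap_injective (g : G) : Function.Injective (𝒢.prolongationMap g) := by
  refine (injective_iff_map_eq_zero _).2 fun w hw => Subtype.ext (Prod.ext ?_ ?_)
  · exact 𝒢.rightInvTangent_injective w.2.1 (congrArg Prod.fst hw)
  · exact 𝒢.leftTangent_injective w.2.2 (congrArg Prod.snd hw)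

variable [IsManifold 𝓘(ℝ, EG) ∞ G] [IsManifold 𝓘(ℝ, EM) ∞ M]

theorem isSmoothSubbundle_prolongation : IsSmoothSubbundle EG (EG × EG) 𝒢.prolongation :=
  IsSmoothSubbundle.prod (V := (𝒢.src : G → M) *ᵖ 𝒢.AmbientBundle)
    (V' := (𝒢.tgt : G → M) *ᵖ 𝒢.AmbientBundle)
    (𝒢.isSmoothSubbundle_algebroidFiber.pullback 𝒢.src)
    (𝒢.isSmoothSubbundle_algebroidFiber.pullback 𝒢.tgt)

theorem smoothBundleMap_prolongationMap :
    SmoothBundleMap EG (EG × EG) (EG × EG) 𝒢.prolongationMap := by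
  intro U s hU hs
  obtain ⟨h1, h2⟩ := (smoothSectionOn_prod _ U).1 hs
  have h3 := (contMDiffOn_pullback_totalSpace 𝒢.unit 𝒢.src.contMDiff _ U).1
    ((smoothSectionOn_pullback 𝒢.src _ U).1 h1)
  have h4 := (contMDiffOn_pullback_totalSpace 𝒢.unit 𝒢.tgt.contMDiff _ U).1
    ((smoothSectionOn_pullback 𝒢.tgt _ U).1 h2)
  refine (smoothSectionOn_prod _ U).2 ⟨?_, ?_⟩
  · exact 𝒢.contMDiffOn_rightInvTangent hU (fun g _ => (s g).2.1) h3
  · exact 𝒢.contMDiffOn_leftTangent contMDiff_id hU (fun g _ => (s g).2.2) h4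

/-- The isomorphism `Θ`. -/
noncomputable def prolongationEquiv (g : G) : 𝒢.prolongation g ≃ₗ[ℝ] 𝒢.verticalSum g :=
  subbundleEquiv 𝒢.prolongationMap 𝒢.prolongationMap_mem 𝒢.prolongationMap_injective
    (fun g => (𝒢.finrank_prolongation g).trans (𝒢.finrank_verticalSum g).symm) g

theorem smoothBundleMap_prolongationEquiv : SmoothBundleMap EG (EG × EG) (EG × EG)
    fun g => (𝒢.verticalSum g).subtype ∘ₗ (𝒢.prolongationEquiv g).toLinearMap :=
  𝒢.smoothBundleMap_prolongationMap

theorem smoothBundleMap_prolongationEquiv_symm : SmoothBundleMap EG (EG × EG) (EG × EG)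
    fun g => (𝒢.prolongation g).subtype ∘ₗ (𝒢.prolongationEquiv g).symm.toLinearMap :=
  smoothBundleMap_subbundleEquiv_symm _ _ _ _ 𝒢.isSmoothSubbundle_prolongation
    𝒢.smoothBundleMap_prolongationMap

end Prolongation

section InvariantSections

variable [IsManifold 𝓘(ℝ, EG) ∞ G] [IsManifold 𝓘(ℝ, EM) ∞ M]

/-- The section `(→X, ←Y)` of `Vβ ⊕ Vα`. -/
noncomputable def invariantSection (X Y : 𝒢.AlgebroidSection) :
    SubbundleSection EG (EG × EG) 𝒢.verticalSum :=
  ⟨⟨fun g => (𝒢.rightInvariant X g, 𝒢.leftInvariant Y g), contMDiffOn_univ.1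
      ((smoothSectionOn_prod _ univ).2 ⟨(𝒢.contMDiff_rightInvariant X).contMDiffOn,
        (𝒢.contMDiff_leftInvariant Y).contMDiffOn⟩)⟩,
    fun g => ⟨𝒢.mfderiv_tgt_rightInvariant X g, 𝒢.mfderiv_src_leftInvariant Y g⟩⟩

theorem sectionVal_invariantSection (X Y : 𝒢.AlgebroidSection) (g : G) :
    (sectionVal (𝒢.invariantSection X Y) g).1 = (𝒢.rightInvariant X g, 𝒢.leftInvariant Y g) := rfl

/-- Since `Θ` is onto, `w` comes from two vectors of `AG`, which extend to global sections. The sign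
in `→X` is compensated by taking `-X`. This is the spanning property behind uniqueness. -/
theorem exists_invariantSection [T2Space M] (g : G) (w : 𝒢.verticalSum g) :
    ∃ X Y, sectionVal (𝒢.invariantSection X Y) g = w := by
  obtain ⟨w, rfl⟩ := (𝒢.prolongationEquiv g).surjective w
  obtain ⟨X, hX⟩ := 𝒢.isSmoothSubbundle_algebroidFiber.exists_section (𝒢.src g) ⟨w.1.1, w.2.1⟩
  obtain ⟨Y, hY⟩ := 𝒢.isSmoothSubbundle_algebroidFiber.exists_section (𝒢.tgt g) ⟨w.1.2, w.2.2⟩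
  refine ⟨-X, Y, Subtype.ext (Prod.ext ?_ ?_)⟩
  · have h1 : 𝒢.rightInvariant (-X) g = 𝒢.rightInvTangent g (sectionVal X (𝒢.src g)).1 :=
      neg_eq_iff_eq_neg.2 ((𝒢.rightInvTangent g).map_neg _)
    refine h1.trans ?_
    rw [hX]
    rfl
  · have h1 : 𝒢.leftInvariant Y g = 𝒢.leftTangent g w.1.2 := by
      rw [leftInvariant, hY]
    exact h1

end InvariantSections

section StarAlgebroid

variable [IsManifold 𝓘(ℝ, EG) ∞ G]

/-- The map `Ψ` from the Lie algebroid of `G_β ⋆ G_α`. -/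
noncomputable def starMap (g : G) : 𝒢.starGroupoid.algebroidFiber g →ₗ[ℝ]
    ((TangentSpace 𝓘(ℝ, EG) : G → Type _) ×ᵇ (TangentSpace 𝓘(ℝ, EG) : G → Type _)) g :=
  (LinearMap.prod (M := StarModel EG EM) (M₂ := EG) (M₃ := EG)
    (show StarModel EG EM →L[ℝ] EG from mfderiv 𝓘(ℝ, StarModel EG EM) 𝓘(ℝ, EG)
      (fun p : 𝒢.Star => p.1.2.1) (𝒢.starGroupoid.unit g)).toLinearMap
    ((show StarModel EG EM →L[ℝ] EG from mfderiv 𝓘(ℝ, StarModel EG EM) 𝓘(ℝ, EG)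
      (fun p : 𝒢.Star => p.1.2.2) (𝒢.starGroupoid.unit g)) -
      (show StarModel EG EM →L[ℝ] EG from mfderiv 𝓘(ℝ, StarModel EG EM) 𝓘(ℝ, EG)
      (fun p : 𝒢.Star => p.1.2.1) (𝒢.starGroupoid.unit g))).toLinearMap) ∘ₗ
    (𝒢.starGroupoid.algebroidFiber g).subtype

/-- The derivative of the defining equation `β(g) = β(h)`. -/
theorem mfderiv_tgt_star (p : 𝒢.Star) (w : TangentSpace 𝓘(ℝ, StarModel EG EM) p) :
    mfderiv 𝓘(ℝ, EG) 𝓘(ℝ, EM) 𝒢.tgt p.1.2.1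
      (mfderiv 𝓘(ℝ, StarModel EG EM) 𝓘(ℝ, EG) (fun p : 𝒢.Star => p.1.2.1) p w) =
    mfderiv 𝓘(ℝ, EG) 𝓘(ℝ, EM) 𝒢.tgt p.1.1
      (mfderiv 𝓘(ℝ, StarModel EG EM) 𝓘(ℝ, EG) (fun p : 𝒢.Star => p.1.1) p w) := by
  have ht : ∀ g, HasMFDerivAt 𝓘(ℝ, EG) 𝓘(ℝ, EM) 𝒢.tgt g _ := fun g =>
    ((𝒢.tgt.contMDiff g).mdifferentiableAt (by simp)).hasMFDerivAt
  have h1 := ((𝒢.contMDiff_star_fst p).mdifferentiableAt (by simp)).hasMFDerivAt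
  have h2 := ((𝒢.contMDiff_star_mid p).mdifferentiableAt (by simp)).hasMFDerivAt
  have h3 := (HasMFDerivAt.comp p (ht p.1.1) h1).mfderiv
  have h4 := (HasMFDerivAt.comp p (ht p.1.2.1) h2).mfderiv
  have h5 : (𝒢.tgt ∘ fun p : 𝒢.Star => p.1.1) = 𝒢.tgt ∘ fun p : 𝒢.Star => p.1.2.1 :=
    funext fun p => p.2.1
  rw [h5] at h3
  exact DFunLike.congr_fun (h4.symm.trans h3) w

theorem mfderiv_src_star (p : 𝒢.Star) (w : TangentSpace 𝓘(ℝ, StarModel EG EM) p) :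
    mfderiv 𝓘(ℝ, EG) 𝓘(ℝ, EM) 𝒢.src p.1.2.1
      (mfderiv 𝓘(ℝ, StarModel EG EM) 𝓘(ℝ, EG) (fun p : 𝒢.Star => p.1.2.1) p w) =
    mfderiv 𝓘(ℝ, EG) 𝓘(ℝ, EM) 𝒢.src p.1.2.2
      (mfderiv 𝓘(ℝ, StarModel EG EM) 𝓘(ℝ, EG) (fun p : 𝒢.Star => p.1.2.2) p w) := by
  have ht : ∀ g, HasMFDerivAt 𝓘(ℝ, EG) 𝓘(ℝ, EM) 𝒢.src g _ := fun g =>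
    ((𝒢.src.contMDiff g).mdifferentiableAt (by simp)).hasMFDerivAt
  have h1 := ((𝒢.contMDiff_star_last p).mdifferentiableAt (by simp)).hasMFDerivAt
  have h2 := ((𝒢.contMDiff_star_mid p).mdifferentiableAt (by simp)).hasMFDerivAt
  have h3 := (HasMFDerivAt.comp p (ht p.1.2.2) h1).mfderiv
  have h4 := (HasMFDerivAt.comp p (ht p.1.2.1) h2).mfderiv
  have h5 : (𝒢.src ∘ fun p : 𝒢.Star => p.1.2.2) = 𝒢.src ∘ fun p : 𝒢.Star => p.1.2.1 :=
    funext fun p => p.2.2.symm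
  rw [h5] at h3
  exact DFunLike.congr_fun (h4.symm.trans h3) w

/-- For a vector `(0, X, Z)` at `(g, g, g)`, the derivatives of the two defining equations read `Tβ
X = 0` and `Tα X = Tα Z`. -/
theorem starMap_mem (g : G) (v : 𝒢.starGroupoid.algebroidFiber g) :
    𝒢.starMap g v ∈ 𝒢.verticalSum g := by
  have h1 := 𝒢.mfderiv_tgt_star (𝒢.starGroupoid.unit g) v.1
  have h2 := 𝒢.mfderiv_src_star (𝒢.starGroupoid.unit g) v.1
  have h3 : mfderiv 𝓘(ℝ, StarModel EG EM) 𝓘(ℝ, EG) (fun p : 𝒢.Star => p.1.1)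
    (𝒢.starGroupoid.unit g) v.1 = 0 := v.2
  refine ⟨h1.trans ((congrArg _ h3).trans (map_zero _)), ?_⟩
  refine (map_sub (mfderiv 𝓘(ℝ, EG) 𝓘(ℝ, EM) 𝒢.src g) (𝒢.tangentLast 𝒢.starGroupoid g v)
    (𝒢.tangentMid 𝒢.starGroupoid g v)).trans (sub_eq_zero.2 h2.symm)

theorem eq_zero_of_mfderiv_star {p : 𝒢.Star} {w : TangentSpace 𝓘(ℝ, StarModel EG EM) p}
    (h1 : mfderiv 𝓘(ℝ, StarModel EG EM) 𝓘(ℝ, EG) (fun p : 𝒢.Star => p.1.1) p w = 0)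
    (h2 : mfderiv 𝓘(ℝ, StarModel EG EM) 𝓘(ℝ, EG) (fun p : 𝒢.Star => p.1.2.1) p w = 0)
    (h3 : mfderiv 𝓘(ℝ, StarModel EG EM) 𝓘(ℝ, EG) (fun p : 𝒢.Star => p.1.2.2) p w = 0) :
    w = 0 := by
  have d1 := ((𝒢.contMDiff_star_fst p).mdifferentiableAt (by simp)).hasMFDerivAt
  have d2 := ((𝒢.contMDiff_star_mid p).mdifferentiableAt (by simp)).hasMFDerivAt
  have d3 := ((𝒢.contMDiff_star_last p).mdifferentiableAt (by simp)).hasMFDerivAt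
  have d4 := (d1.prodMk (d2.prodMk d3)).mfderiv
  refine 𝒢.mfderiv_star_val_injective p (Eq.trans ?_ (map_zero _).symm)
  refine (DFunLike.congr_fun d4 w).trans ?_
  exact Prod.ext h1 (Prod.ext h2 h3)

theorem starMap_injective (g : G) : Function.Injective (𝒢.starMap g) := by
  refine (injective_iff_map_eq_zero _).2 fun v hv => Subtype.ext ?_
  have h2 : 𝒢.tangentMid 𝒢.starGroupoid g v = 0 := congrArg Prod.fst hv
  have h3 : 𝒢.tangentLast 𝒢.starGroupoid g v - 𝒢.tangentMid 𝒢.starGroupoid g v = 0 :=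
    congrArg Prod.snd hv
  rw [h2, sub_zero] at h3
  exact 𝒢.eq_zero_of_mfderiv_star v.2 h2 h3

theorem finrank_starFiber (g : G) : Module.finrank ℝ (𝒢.starGroupoid.algebroidFiber g) =
    2 * (Module.finrank ℝ EG - Module.finrank ℝ EM) := by
  rw [finrank_algebroidFiber, finrank_euclideanSpace_fin]
  simp only [Module.finrank_prod, finrank_euclideanSpace_fin]
  omega

theorem smoothBundleMap_starMap :
    SmoothBundleMap EG (StarModel EG EM) (EG × EG) 𝒢.starMap := by
  intro U s hU hs
  have h1 := (smoothSectionOn_pullback 𝒢.starGroupoid.unit (fun g => (s g).1) U).1 hs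
  have h2 : SmoothSectionOn EG EG (fun g => 𝒢.tangentMid 𝒢.starGroupoid g (s g)) U :=
    (𝒢.contMDiff_star_mid.contMDiffOn.tangentMap_comp isOpen_univ h1 fun _ _ => mem_univ _).congr
      fun g _ => rfl
  have h3 : SmoothSectionOn EG EG (fun g => 𝒢.tangentLast 𝒢.starGroupoid g (s g)) U :=
    (𝒢.contMDiff_star_last.contMDiffOn.tangentMap_comp isOpen_univ h1 fun _ _ => mem_univ _).congr
      fun g _ => rfl
  exact (smoothSectionOn_prod _ U).2 ⟨h2, ContMDiffOn.sub_section h3 h2⟩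

/-- The isomorphism `Ψ`. -/
noncomputable def starEquiv (g : G) : 𝒢.starGroupoid.algebroidFiber g ≃ₗ[ℝ] 𝒢.verticalSum g :=
  subbundleEquiv 𝒢.starMap 𝒢.starMap_mem 𝒢.starMap_injective
    (fun g => (𝒢.finrank_starFiber g).trans (𝒢.finrank_verticalSum g).symm) g

theorem starEquiv_apply (g : G) (v : 𝒢.starGroupoid.algebroidFiber g) :
    (𝒢.starEquiv g v).1 = (𝒢.tangentMid 𝒢.starGroupoid g v,
      𝒢.tangentLast 𝒢.starGroupoid g v - 𝒢.tangentMid 𝒢.starGroupoid g v) := rfl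

theorem smoothBundleMap_starEquiv : SmoothBundleMap EG (StarModel EG EM) (EG × EG)
    fun g => (𝒢.verticalSum g).subtype ∘ₗ (𝒢.starEquiv g).toLinearMap :=
  𝒢.smoothBundleMap_starMap

theorem smoothBundleMap_starEquiv_symm : SmoothBundleMap EG (EG × EG) (StarModel EG EM)
    fun g => (𝒢.starGroupoid.algebroidFiber g).subtype ∘ₗ (𝒢.starEquiv g).symm.toLinearMap :=
  smoothBundleMap_subbundleEquiv_symm _ _ _ _ 𝒢.starGroupoid.isSmoothSubbundle_algebroidFiber
    𝒢.smoothBundleMap_starMap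

end StarAlgebroid

end LieGroupoid

/-! ### The algebroid structure on `Vβ ⊕ Vα` and its bracket. -/

namespace LieGroupoid

open Filter Set VectorField
open scoped Topology

variable {EG EM G M : Type*} [NormedAddCommGroup EG] [NormedSpace ℝ EG]
    [NormedAddCommGroup EM] [NormedSpace ℝ EM] [TopologicalSpace G] [ChartedSpace EG G]
    [TopologicalSpace M] [ChartedSpace EM M] (𝒢 : LieGroupoid EG EM G M)
    [FiniteDimensional ℝ EG] [FiniteDimensional ℝ EM]

/-- The derivative of a left translation, followed by that of a map `φ` of the total space, is
determined by any derivative of the composite along the fibre. -/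
theorem mfderiv_leftTangent_eq {E N : Type*} [NormedAddCommGroup E] [NormedSpace ℝ E]
    [TopologicalSpace N] [ChartedSpace E N] {φ : G → N} {g : G}
    (hφ : MDifferentiableAt 𝓘(ℝ, EG) 𝓘(ℝ, E) φ g)
    {v : TangentSpace 𝓘(ℝ, EG) (𝒢.unit (𝒢.tgt g))}
    (hv : mfderiv 𝓘(ℝ, EG) 𝓘(ℝ, EM) 𝒢.src (𝒢.unit (𝒢.tgt g)) v = 0)
    {ψ : G → N} (hψ : ∀ h, 𝒢.src h = 𝒢.tgt g → ψ h = φ (𝒢.mul g h))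
    {D : TangentSpace 𝓘(ℝ, EG) (𝒢.unit (𝒢.tgt g)) →L[ℝ]
      TangentSpace 𝓘(ℝ, E) (ψ (𝒢.unit (𝒢.tgt g)))}
    (hD : HasMFDerivWithinAt 𝓘(ℝ, EG) 𝓘(ℝ, E) ψ {h | 𝒢.src h = 𝒢.tgt g}
      (𝒢.unit (𝒢.tgt g)) D) :
    (show E from mfderiv 𝓘(ℝ, EG) 𝓘(ℝ, E) φ g (𝒢.leftTangent g v)) = (show E from D v) := by
  have h1 : ∀ y, y = g → HasMFDerivAt 𝓘(ℝ, EG) 𝓘(ℝ, E) φ y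
      (show TangentSpace 𝓘(ℝ, EG) y →L[ℝ] TangentSpace 𝓘(ℝ, E) (φ y) from
        mfderiv 𝓘(ℝ, EG) 𝓘(ℝ, E) φ g) := by
    rintro y rfl; exact hφ.hasMFDerivAt
  have h2 := (𝒢.mdifferentiableWithinAt_mul_left (𝒢.src_unit (𝒢.tgt g))).hasMFDerivWithinAt
  have h3 := HasMFDerivAt.comp_hasMFDerivWithinAt _ (h1 _ (𝒢.mul_unit g)) h2
  have h4 := HasMFDerivWithinAt.congr_of_eventuallyEq h3
    (eventually_of_mem self_mem_nhdsWithin hψ) (hψ _ (𝒢.src_unit _))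
  exact hasMFDerivWithinAt_fibre_unique (𝒢.isSubmersionAt_src _) 𝒢.src.contMDiff
    (𝒢.src_unit _) h4 hD hv

variable [IsManifold 𝓘(ℝ, EG) ∞ G]

theorem mfderiv_inv_rightInvariant (X : 𝒢.AlgebroidSection) (g : G) :
    mfderiv 𝓘(ℝ, EG) 𝓘(ℝ, EG) 𝒢.inv g (𝒢.rightInvariant X g) =
      -𝒢.leftInvariant X (𝒢.inv g) := by
  have h1 := 𝒢.mfderiv_inv_inv (𝒢.inv g) (𝒢.leftInvariant X (𝒢.inv g))
  have h2 := 𝒢.neg_rightInvariant X g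
  have h3 : mfderiv 𝓘(ℝ, EG) 𝓘(ℝ, EG) 𝒢.inv g (-𝒢.rightInvariant X g) =
      𝒢.leftInvariant X (𝒢.inv g) := by
    rw [h2]
    refine Eq.trans ?_ h1
    exact congrArg (fun y => (show EG →L[ℝ] EG from mfderiv 𝓘(ℝ, EG) 𝓘(ℝ, EG) 𝒢.inv y) _)
      (𝒢.inv_inv g).symm
  rw [← h3, map_neg, neg_neg]

/-- The Lie algebroid structure of `Vβ ⊕ Vα`. -/
noncomputable def verticalAlgebroid : LieAlgebroid EG (EG × EG) 𝒢.verticalSum :=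
  𝒢.starGroupoid.lieAlgebroid.transport 𝒢.starEquiv 𝒢.smoothBundleMap_starEquiv
    𝒢.smoothBundleMap_starEquiv_symm

theorem verticalAlgebroid_anchor (g : G) (w : 𝒢.verticalSum g) :
    𝒢.verticalAlgebroid.anchor g w = w.1.1 + w.1.2 := by
  obtain ⟨v, rfl⟩ := (𝒢.starEquiv g).surjective w
  refine (𝒢.starGroupoid.lieAlgebroid.transport_anchor _ _ _ g v).trans ?_
  -- The anchor of `G_β ⋆ G_α` is the tangent map of its target, so it sends `(0, X, Z)` to `Z = X +
  -- (Z - X)`.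
  exact (add_sub_cancel (𝒢.tangentMid 𝒢.starGroupoid g v)
    (𝒢.tangentLast 𝒢.starGroupoid g v)).symm

variable [IsManifold 𝓘(ℝ, EM) ∞ M]

/-- The section of the Lie algebroid of `G_β ⋆ G_α` which corresponds to `(→X, ←Y)`. -/
noncomputable def starSection (X Y : 𝒢.AlgebroidSection) : 𝒢.starGroupoid.AlgebroidSection :=
  (sectionEquiv 𝒢.starEquiv 𝒢.smoothBundleMap_starEquiv 𝒢.smoothBundleMap_starEquiv_symm).symm
    (𝒢.invariantSection X Y)

theorem starEquiv_starSection (X Y : 𝒢.AlgebroidSection) (g : G) :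
    𝒢.starEquiv g (sectionVal (𝒢.starSection X Y) g) = sectionVal (𝒢.invariantSection X Y) g := by
  rw [starSection, sectionVal_sectionEquiv_symm, LinearEquiv.apply_symm_apply]

theorem tangentMid_starSection (X Y : 𝒢.AlgebroidSection) (g : G) :
    𝒢.tangentMid 𝒢.starGroupoid g (sectionVal (𝒢.starSection X Y) g) = 𝒢.rightInvariant X g :=
  congrArg (fun w : 𝒢.verticalSum g => w.1.1) (𝒢.starEquiv_starSection X Y g)

theorem tangentLast_starSection (X Y : 𝒢.AlgebroidSection) (g : G) :
    𝒢.tangentLast 𝒢.starGroupoid g (sectionVal (𝒢.starSection X Y) g) =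
      𝒢.rightInvariant X g + 𝒢.leftInvariant Y g := by
  have h1 : 𝒢.tangentLast 𝒢.starGroupoid g (sectionVal (𝒢.starSection X Y) g) -
      𝒢.tangentMid 𝒢.starGroupoid g (sectionVal (𝒢.starSection X Y) g) = 𝒢.leftInvariant Y g :=
    congrArg (fun w : 𝒢.verticalSum g => w.1.2) (𝒢.starEquiv_starSection X Y g)
  rw [sub_eq_iff_eq_add, tangentMid_starSection, add_comm] at h1
  exact h1

/-- The left-invariant vector field of `(→X, ←Y)` projects to `→X + ←Y` under the target map. -/
theorem mfderiv_last_leftInvariant_starSection (X Y : 𝒢.AlgebroidSection) (p : 𝒢.Star) :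
    mfderiv 𝓘(ℝ, StarModel EG EM) 𝓘(ℝ, EG) (fun p : 𝒢.Star => p.1.2.2) p
      (𝒢.starGroupoid.leftInvariant (𝒢.starSection X Y) p) =
      (𝒢.rightInvariant X + 𝒢.leftInvariant Y) p.1.2.2 := by
  have h1 := ((𝒢.contMDiff_star_last (𝒢.starGroupoid.unit p.1.2.2)).mdifferentiableAt
    (by simp)).hasMFDerivAt.hasMFDerivWithinAt
      (s := {q | 𝒢.starGroupoid.src q = 𝒢.starGroupoid.tgt p})
  refine (𝒢.starGroupoid.mfderiv_leftTangent_eq (g := p)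
    ((𝒢.contMDiff_star_last p).mdifferentiableAt (by simp))
    (sectionVal (𝒢.starSection X Y) p.1.2.2).2 (fun q hq => ?_) h1).trans ?_
  -- The last entry of a product `p q` is that of `q`, so left translation by `p` does not change
  -- the last component of the vector.
  · exact (congrArg (fun z : G × G × G => z.2.2) (𝒢.starMul_val (Eq.symm hq))).symm
  exact 𝒢.tangentLast_starSection X Y p.1.2.2

/-- The left-invariant vector field of `(→X, ←Y)` projects to `→X` under the middle projection. -/
theorem mfderiv_mid_leftInvariant_starSection (X Y : 𝒢.AlgebroidSection) (p : 𝒢.Star) :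
    mfderiv 𝓘(ℝ, StarModel EG EM) 𝓘(ℝ, EG) (fun p : 𝒢.Star => p.1.2.1) p
      (𝒢.starGroupoid.leftInvariant (𝒢.starSection X Y) p) =
      𝒢.rightInvariant X p.1.2.1 := by
  obtain ⟨⟨g, h, s⟩, hgh : 𝒢.tgt g = 𝒢.tgt h, hhs : 𝒢.src h = 𝒢.src s⟩ := p
  -- For `q = (s, h', s')` the middle entry of `p q` is `h' s⁻¹ h = φ (h'⁻¹)`. Passing through
  -- `h'⁻¹` turns the condition `β(h') = β(s)` into membership in an `α`-fibre, where the
  -- relatedness of `←X` and `-→X` applies; inversion contributes a second minus sign.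
  set w := 𝒢.mul (𝒢.inv s) h with hw
  have hsw : 𝒢.src w = 𝒢.tgt s := by
    rw [hw, 𝒢.src_mul _ _ ((𝒢.tgt_inv s).trans hhs.symm), 𝒢.src_inv]
  let φ : G → G := fun k => 𝒢.mul (𝒢.inv k) w
  have hφd : MDifferentiableWithinAt 𝓘(ℝ, EG) 𝓘(ℝ, EG) φ {k | 𝒢.src k = 𝒢.tgt s} (𝒢.inv s) := by
    refine ((𝒢.smooth_mul.comp (𝒢.inv.contMDiff.prodMk contMDiff_const).contMDiffOn
      fun k (hk : 𝒢.src k = 𝒢.tgt s) => ?_) _ (𝒢.src_inv s)).mdifferentiableWithinAt (by simp)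
    exact (𝒢.tgt_inv k).trans (hk.trans hsw.symm)
  have hsh : 𝒢.mul s w = h := 𝒢.mul_inv_cancel_left hhs.symm
  have hφs : φ (𝒢.inv s) = h := by simp only [φ, 𝒢.inv_inv, hsh]
  have h2 : HasMFDerivAt 𝓘(ℝ, StarModel EG EM) 𝓘(ℝ, EG) (fun p : 𝒢.Star => p.1.2.1)
      (𝒢.starGroupoid.unit s) _ :=
    ((𝒢.contMDiff_star_mid (𝒢.starGroupoid.unit s)).mdifferentiableAt (by simp)).hasMFDerivAt
  have h3 : HasMFDerivAt 𝓘(ℝ, EG) 𝓘(ℝ, EG) 𝒢.inv s _ :=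
    ((𝒢.inv.contMDiff s).mdifferentiableAt (by simp)).hasMFDerivAt
  have h4 := HasMFDerivAt.comp (𝒢.starGroupoid.unit s) h3 h2
  have h5 := HasMFDerivWithinAt.comp (𝒢.starGroupoid.unit s) hφd.hasMFDerivWithinAt
    (h4.hasMFDerivWithinAt (s := {q | 𝒢.starGroupoid.src q = s}))
    (u := {k | 𝒢.src k = 𝒢.tgt s}) fun q hq => (𝒢.src_inv q.1.2.1).trans (q.2.1.symm.trans (congrArg 𝒢.tgt hq))
  have h6 : ∀ q : 𝒢.Star, q.1.1 = s → (𝒢.starMul ⟨(g, h, s), hgh, hhs⟩ q).1.2.1 =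
      φ (𝒢.inv q.1.2.1) := by
    intro q hq
    have h7 : 𝒢.tgt q.1.2.1 = 𝒢.tgt s := q.2.1.symm.trans (congrArg 𝒢.tgt hq)
    refine (congrArg (fun z : G × G × G => z.2.1) (𝒢.starMul_val hq.symm)).trans ?_
    simp only [φ, 𝒢.inv_inv, hw, hq]
    exact (𝒢.mul_assoc _ _ _ (h7.trans (𝒢.src_inv s).symm)
      ((𝒢.tgt_inv s).trans hhs.symm)).symm
  refine (𝒢.starGroupoid.mfderiv_leftTangent_eq (g := ⟨(g, h, s), hgh, hhs⟩)
    ((𝒢.contMDiff_star_mid _).mdifferentiableAt (by simp))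
    (sectionVal (𝒢.starSection X Y) s).2 (fun q hq => (h6 q hq).symm) h5).trans ?_
  have h9 : mfderiv 𝓘(ℝ, EG) 𝓘(ℝ, EG) 𝒢.inv s
      (𝒢.tangentMid 𝒢.starGroupoid s (sectionVal (𝒢.starSection X Y) s)) =
      -𝒢.leftInvariant X (𝒢.inv s) := by
    rw [tangentMid_starSection, mfderiv_inv_rightInvariant]
  have h10 := 𝒢.mfderivWithin_inv_mul_leftInvariant X (𝒢.src_inv s) hsw
  refine (congrArg (mfderivWithin 𝓘(ℝ, EG) 𝓘(ℝ, EG) φ {k | 𝒢.src k = 𝒢.tgt s} (𝒢.inv s))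
    h9).trans ?_
  rw [map_neg]
  refine (congrArg (fun y : EG => -y) h10).trans ((neg_neg _).trans ?_)
  exact congrArg (fun y => (show EG from 𝒢.rightInvariant X y)) hφs

/-- The bracket of the left-invariant fields is related by the middle projection to `[→X, →X']` and
by the last one to `[→X + ←Y, →X' + ←Y']`. In the difference of the two the right-invariant parts
cancel. -/
theorem starEquiv_leftBracket (X Y X' Y' : 𝒢.AlgebroidSection) (g : G) :
    (𝒢.starEquiv g (sectionVal (𝒢.starGroupoid.leftBracket (𝒢.starSection X Y)
      (𝒢.starSection X' Y')) g)).1 = (-𝒢.rightInvariant (𝒢.leftBracket X X') g,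
        𝒢.leftInvariant (𝒢.leftBracket Y Y') g) := by
  have : CompleteSpace EG := FiniteDimensional.complete ℝ EG
  have : IsManifold 𝓘(ℝ, EG) 2 G := .of_le (n := ∞) two_le_smooth
  have : IsManifold 𝓘(ℝ, EG) 1 G := .of_le (n := ∞) (by simp)
  have : IsManifold 𝓘(ℝ, StarModel EG EM) 2 𝒢.Star := .of_le (n := ∞) two_le_smooth
  have hr : ∀ X, MDifferentiableAt 𝓘(ℝ, EG) 𝓘(ℝ, EG).tangent
      (fun g => (⟨g, 𝒢.rightInvariant X g⟩ : TangentBundle 𝓘(ℝ, EG) G)) g := fun X =>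
    (𝒢.contMDiff_rightInvariant X g).mdifferentiableAt (by simp)
  have ha : ∀ X Y, MDifferentiableAt 𝓘(ℝ, EG) 𝓘(ℝ, EG).tangent
      (fun g => (⟨g, (𝒢.rightInvariant X + 𝒢.leftInvariant Y) g⟩ : TangentBundle 𝓘(ℝ, EG) G)) g :=
    fun X Y => ((𝒢.contMDiff_rightInvariant X).add_section
      (𝒢.contMDiff_leftInvariant Y) g).mdifferentiableAt (by simp)
  have hs := fun X Y => 𝒢.starGroupoid.mdifferentiableAt_leftInvariant (𝒢.starSection X Y)
    (𝒢.starGroupoid.unit g)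
  have h1 : 𝒢.tangentMid 𝒢.starGroupoid g (sectionVal (𝒢.starGroupoid.leftBracket
      (𝒢.starSection X Y) (𝒢.starSection X' Y')) g) = -𝒢.rightInvariant (𝒢.leftBracket X X') g :=
    (mfderiv_mlieBracket_of_related
      ((𝒢.contMDiff_star_mid (𝒢.starGroupoid.unit g)).of_le two_le_smooth) (hs X Y) (hs X' Y')
      (hr X) (hr X') (Eventually.of_forall (𝒢.mfderiv_mid_leftInvariant_starSection X Y))
      (Eventually.of_forall (𝒢.mfderiv_mid_leftInvariant_starSection X' Y'))).trans
      (𝒢.mlieBracket_rightInvariant X X' g)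
  have h2 : 𝒢.tangentLast 𝒢.starGroupoid g (sectionVal (𝒢.starGroupoid.leftBracket
      (𝒢.starSection X Y) (𝒢.starSection X' Y')) g) =
      -𝒢.rightInvariant (𝒢.leftBracket X X') g + 𝒢.leftInvariant (𝒢.leftBracket Y Y') g :=
    (mfderiv_mlieBracket_of_related
      ((𝒢.contMDiff_star_last (𝒢.starGroupoid.unit g)).of_le two_le_smooth) (hs X Y) (hs X' Y')
      (ha X Y) (ha X' Y') (Eventually.of_forall (𝒢.mfderiv_last_leftInvariant_starSection X Y))
      (Eventually.of_forall (𝒢.mfderiv_last_leftInvariant_starSection X' Y'))).trans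
      (𝒢.mlieBracket_right_add_leftInvariant X Y X' Y' g)
  rw [starEquiv_apply, h1, h2, add_sub_cancel_left]

theorem verticalAlgebroid_bracket (X Y X' Y' : 𝒢.AlgebroidSection) (g : G) :
    (sectionVal (𝒢.verticalAlgebroid.bracket (𝒢.invariantSection X Y)
      (𝒢.invariantSection X' Y')) g).1 = (-𝒢.rightInvariant (𝒢.leftBracket X X') g,
        𝒢.leftInvariant (𝒢.leftBracket Y Y') g) :=
  (congrArg Subtype.val (𝒢.starGroupoid.lieAlgebroid.transport_bracket _ _ _ _ _ g)).trans
    (𝒢.starEquiv_leftBracket X Y X' Y' g)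

theorem eq_verticalAlgebroid [T2Space G] [T2Space M] {ℬ : LieAlgebroid EG (EG × EG) 𝒢.verticalSum}
    (hanchor : ∀ g (w : 𝒢.verticalSum g), ℬ.anchor g w = w.1.1 + w.1.2)
    (hbracket : ∀ X Y X' Y' g, (sectionVal (ℬ.bracket (𝒢.invariantSection X Y)
      (𝒢.invariantSection X' Y')) g).1 = (-𝒢.rightInvariant (𝒢.leftBracket X X') g,
        𝒢.leftInvariant (𝒢.leftBracket Y Y') g)) : ℬ = 𝒢.verticalAlgebroid := by
  refine LieAlgebroid.eq_of_bracket_eq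
    (fun g w => (hanchor g w).trans (𝒢.verticalAlgebroid_anchor g w).symm)
    (S := {s | ∃ X Y, s = 𝒢.invariantSection X Y}) (fun g w => ?_) ?_
  · obtain ⟨X, Y, h⟩ := 𝒢.exists_invariantSection g w
    exact ⟨_, ⟨X, Y, rfl⟩, h⟩
  · rintro _ ⟨X, Y, rfl⟩ _ ⟨X', Y', rfl⟩
    refine sectionVal_ext fun g => ?_
    rw [hbracket, verticalAlgebroid_bracket]

end LieGroupoid

/-! ### Assembly of the theorem. -/

theorem theorem3p1 {EG EM G M : Type*}
    [NormedAddCommGroup EG] [NormedSpace ℝ EG] [FiniteDimensional ℝ EG]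
    [NormedAddCommGroup EM] [NormedSpace ℝ EM] [FiniteDimensional ℝ EM]
    [TopologicalSpace G] [T2Space G] [SecondCountableTopology G]
    [ChartedSpace EG G] [IsManifold 𝓘(ℝ, EG) ∞ G]
    [TopologicalSpace M] [T2Space M] [SecondCountableTopology M]
    [ChartedSpace EM M] [IsManifold 𝓘(ℝ, EM) ∞ M]
    (𝒢 : LieGroupoid EG EM G M) :
    -- the Lie algebroid of `G ⇉ M`
    ∃ 𝒜 : LieAlgebroid EM EG 𝒢.algebroidFiber, 𝒢.IsLieAlgebroid 𝒜 ∧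
    -- the embedded submanifold `G_β ⋆ G_α` of `G × G × G`
    ∃ (d : ℕ) (_ : ChartedSpace (EuclideanSpace ℝ (Fin d)) 𝒢.Star)
      (_ : IsManifold 𝓘(ℝ, EuclideanSpace ℝ (Fin d)) ∞ 𝒢.Star),
      IsSmoothEmbedding 𝓘(ℝ, EuclideanSpace ℝ (Fin d))
        (𝓘(ℝ, EG).prod (𝓘(ℝ, EG).prod 𝓘(ℝ, EG))) ∞
        (Subtype.val : 𝒢.Star → G × G × G) ∧
    -- the Lie groupoid `G_β ⋆ G_α ⇉ G` and its Lie algebroid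
    ∃ ℋ : LieGroupoid (EuclideanSpace ℝ (Fin d)) EG 𝒢.Star G, 𝒢.IsStarGroupoid ℋ ∧
    ∃ 𝒜ℋ : LieAlgebroid EG (EuclideanSpace ℝ (Fin d)) ℋ.algebroidFiber, ℋ.IsLieAlgebroid 𝒜ℋ ∧
    -- the sections `(→X, ←Y)` of `Vβ ⊕ Vα`
    ∃ σ : 𝒢.AlgebroidSection → 𝒢.AlgebroidSection →
        SubbundleSection EG (EG × EG) 𝒢.verticalSum,
      (∀ X Y g, (sectionVal (σ X Y) g).1 = (𝒢.rightInvariant X g, 𝒢.leftInvariant Y g)) ∧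
    -- the Lie algebroid structure of `Vβ ⊕ Vα`
    ∃ ℬ : LieAlgebroid EG (EG × EG) 𝒢.verticalSum,
      (∀ g (w : 𝒢.verticalSum g), ℬ.anchor g w = w.1.1 + w.1.2) ∧
      (∀ X Y X' Y' g, (sectionVal (ℬ.bracket (σ X Y) (σ X' Y')) g).1 =
        (-𝒢.rightInvariant (𝒜.bracket X X') g, 𝒢.leftInvariant (𝒜.bracket Y Y') g)) ∧
      -- the anchor and the bracket relation characterize it
      (∀ ℬ' : LieAlgebroid EG (EG × EG) 𝒢.verticalSum,
        (∀ g (w : 𝒢.verticalSum g), ℬ'.anchor g w = w.1.1 + w.1.2) →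
        (∀ X Y X' Y' g, (sectionVal (ℬ'.bracket (σ X Y) (σ X' Y')) g).1 =
          (-𝒢.rightInvariant (𝒜.bracket X X') g, 𝒢.leftInvariant (𝒜.bracket Y Y') g)) →
        ℬ' = ℬ) ∧
      -- it is isomorphic to the Lie algebroid of `G_β ⋆ G_α ⇉ G`
      (∃ Ψ : LieAlgebroidIso 𝒜ℋ ℬ, ∀ g (v : ℋ.algebroidFiber g), (Ψ.toEquiv g v).1 =
        (𝒢.tangentMid ℋ g v, 𝒢.tangentLast ℋ g v - 𝒢.tangentMid ℋ g v)) ∧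
      -- it is carried over to `AG ×_{τ,α} G ×_{β,τ} AG → G` by `Θ`
      ∃ (𝒜P : LieAlgebroid EG (EG × EG) 𝒢.prolongation) (Θ : LieAlgebroidIso 𝒜P ℬ),
        ∀ g (w : 𝒢.prolongation g), (Θ.toEquiv g w).1 =
          (𝒢.rightInvTangent g w.1.1, 𝒢.leftTangent g w.1.2) := by
  -- The structure on the prolongation is transported from `Vβ ⊕ Vα` along the inverse of `Θ`; the
  -- resulting isomorphism is inverted to obtain `Θ` itself.
  let Θ := 𝒢.verticalAlgebroid.transportIso (fun g => (𝒢.prolongationEquiv g).symm)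
    𝒢.smoothBundleMap_prolongationEquiv_symm 𝒢.smoothBundleMap_prolongationEquiv
  exact ⟨𝒢.lieAlgebroid, 𝒢.isLieAlgebroid_lieAlgebroid, _, 𝒢.chartedSpaceStar,
    𝒢.isManifoldStar, 𝒢.isSmoothEmbedding_star_val, 𝒢.starGroupoid, 𝒢.isStarGroupoid_starGroupoid,
    𝒢.starGroupoid.lieAlgebroid, 𝒢.starGroupoid.isLieAlgebroid_lieAlgebroid,
    𝒢.invariantSection, 𝒢.sectionVal_invariantSection, 𝒢.verticalAlgebroid,
    𝒢.verticalAlgebroid_anchor, 𝒢.verticalAlgebroid_bracket,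
    fun ℬ h h' => 𝒢.eq_verticalAlgebroid h h',
    ⟨𝒢.starGroupoid.lieAlgebroid.transportIso 𝒢.starEquiv 𝒢.smoothBundleMap_starEquiv
      𝒢.smoothBundleMap_starEquiv_symm, 𝒢.starEquiv_apply⟩, _, Θ.symm, fun g w => rfl⟩
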